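/- Let $\mathcal{L}_A$ be the first-order language (with equality) of signature $\langle 0,1,+,\times,<\rangle$, and let $\mathrm{EA}=\mathrm{I}\Delta_0+\mathrm{exp}$ be elementary arithmetic, i.e. $\mathrm{PA}^-$ together with induction (with parameters) for $\Delta_0$ formulas of $\mathcal{L}_A$ and the axiom $\forall x\,\forall y\,\exists z\; x^y=z$, where $x^y=z$ is expressed by the usual kind of $\Delta_0$ formula. We consider sentences in the extensions of $\mathcal{L}_A$ by finitely many predicate symbols, taken from a fixed countable supply with countably many symbols of each arity, and fix a standard (computable) Gödel numbering $\sigma\mapsto\ulcorner\sigma\urcorner$ of these sentences; $\vdash$ denotes provability in first-order logic with equality (equivalently, by completeness, truth in all models). A *definition of truth* is a consistent sentence $\alpha$ (a theory with the single axiom $\alpha$) that proves all axioms of $\mathrm{EA}$ and for which there is a formula $\Theta(x)$ with one free variable such that $\alpha\vdash\Theta(\ulcorner\sigma\urcorner)\leftrightarrow\sigma$ for every $\mathcal{L}_A$-sentence $\sigma$. Let $\mathrm{DEF}$ be the set of all definitions of truth, and $\mathrm{cDEF}$ the set of those $\alpha\in\mathrm{DEF}$ that are conservative over $\mathrm{EA}$,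 i.e. every $\mathcal{L}_A$-sentence provable from $\alpha$ is provable in $\mathrm{EA}$. For sentences $\alpha,\beta$ write $\alpha\trianglelefteq\beta$ if there is a translation $\tau$, assigning to each non-arithmetical $n$-ary predicate symbol $P$ a formula $\tau(P)$ with $n$ free variables and leaving equality, the symbols of $\mathcal{L}_A$, the connectives and the (unrelativized) quantifiers unchanged, such that $\beta\vdash\tau[\alpha]$. This is a pre-order. A subset $B$ of $\mathrm{DEF}$ is *dense* in $\langle\mathrm{DEF},\trianglelefteq\rangle$ if for every $\alpha\in\mathrm{DEF}$ there is $\beta\in B$ with $\beta\trianglelefteq\alpha$; it is *$\Sigma_2$-definable* if the set of Gödel numbers of its elements is definable in the standard model $\mathbb{N}$ by a $\Sigma_2$ formula of $\mathcal{L}_A$. An element $\alpha$ of a pre-order is *minimal* if every $\beta\trianglelefteq\alpha$ in it satisfies $\alpha\trianglelefteq\beta$ (equivalently, the class of $\alpha$ is minimal in the quotient by mutual definability). Then: 1. If $B\subseteq\mathrm{DEF}$ is $\Sigma_2$-definable, then $B$ is not dense in $\langle\mathrm{DEF},\trianglelefteq\rangle$. 2. $\langle\mathrm{DEF},\trianglelefteq\rangle$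 has no minimal elements. 3. $\langle\mathrm{cDEF},\trianglelefteq\rangle$ has no minimal elements. -/

import Mathlib

open FirstOrder FirstOrder.Language

namespace TruthDefinitions

/-! ### The language of arithmetic and its extension by predicate symbols -/

/-- Function symbols `0, 1, +, ×` of the language of arithmetic. -/
inductive ArithFunc : ℕ → Type
  | zero : ArithFunc 0
  | one : ArithFunc 0
  | add : ArithFunc 2
  | mul : ArithFunc 2

/-- The only relation symbol of the language of arithmetic besides equality is `<`. -/
inductive ArithRel : ℕ → Type
  | lt : ArithRel 2

/-- The language of arithmetic `L_A`, of signature `⟨0, 1, +, ×, <⟩`. -/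
def LA : FirstOrder.Language.{0, 0} := ⟨ArithFunc, ArithRel⟩

/-- A countable supply of fresh predicate symbols: for each arity `n`, one symbol for every
`k : ℕ`. -/
def predLang : FirstOrder.Language.{0, 0} := ⟨fun _ => Empty, fun _ => ℕ⟩

/-- `L_A` together with all the fresh predicate symbols.  A sentence of `LP` is a sentence in the
language of arithmetic extended by the finitely many predicate symbols that occur in it. -/
def LP : FirstOrder.Language.{0, 0} := LA.sum predLang

/-- The inclusion of `L_A` into `LP`. -/
def incl : LA →ᴸ LP := LHom.sumInl

/-- The standard model of arithmetic. -/
instance natStructure : LA.Structure ℕ where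
  funMap := fun f v =>
    match f, v with
    | .zero, _ => 0
    | .one, _ => 1
    | .add, v => v 0 + v 1
    | .mul, v => v 0 * v 1
  RelMap := fun r v =>
    match r, v with
    | .lt, v => v 0 < v 1

section Terms

variable {γ : Type}

instance : Zero (LA.Term γ) := ⟨Term.func (L := LA) ArithFunc.zero ![]⟩
instance : One (LA.Term γ) := ⟨Term.func (L := LA) ArithFunc.one ![]⟩
instance : Add (LA.Term γ) := ⟨fun s t => Term.func (L := LA) ArithFunc.add ![s, t]⟩
instance : Mul (LA.Term γ) := ⟨fun s t => Term.func (L := LA) ArithFunc.mul ![s, t]⟩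

/-- The bound variable with index `i`, as a term. -/
def bv {n : ℕ} (i : Fin n) : LA.Term (γ ⊕ Fin n) := Term.var (Sum.inr i)

/-- The numeral `0 + 1 + ... + 1` naming `n`. -/
def numeral : ℕ → LA.Term γ
  | 0 => 0
  | n + 1 => numeral n + 1

/-- The atomic formula `s < t`. -/
def ltF {n : ℕ} (s t : LA.Term (γ ⊕ Fin n)) : LA.BoundedFormula γ n :=
  BoundedFormula.rel (L := LA) ArithRel.lt ![s, t]

/-- The term `t`, regarded in the scope of one more quantifier (whose variable it does not
contain). -/
def up {n : ℕ} (t : LA.Term (γ ⊕ Fin n)) : LA.Term (γ ⊕ Fin (n + 1)) :=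
  t.relabel (Sum.map id Fin.castSucc)

/-- Bounded universal quantification `∀ x < t. φ(x)`. -/
def ball {n : ℕ} (t : LA.Term (γ ⊕ Fin n)) (φ : LA.BoundedFormula γ (n + 1)) :
    LA.BoundedFormula γ n :=
  ∀' (ltF (bv (Fin.last n)) (up t) ⟹ φ)

/-- Bounded existential quantification `∃ x < t. φ(x)`. -/
def bex {n : ℕ} (t : LA.Term (γ ⊕ Fin n)) (φ : LA.BoundedFormula γ (n + 1)) :
    LA.BoundedFormula γ n :=
  ∃' (ltF (bv (Fin.last n)) (up t) ⊓ φ)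

/-! ### The arithmetical hierarchy (in the language of arithmetic) -/

/-- `Δ₀` formulas: built from atomic formulas by propositional connectives and bounded
quantifiers. -/
inductive IsDelta0 : ∀ {n : ℕ}, LA.BoundedFormula γ n → Prop
  | falsum {n : ℕ} : IsDelta0 (BoundedFormula.falsum : LA.BoundedFormula γ n)
  | equal {n : ℕ} (s t : LA.Term (γ ⊕ Fin n)) : IsDelta0 (BoundedFormula.equal s t)
  | rel {n l : ℕ} (R : LA.Relations l) (ts : Fin l → LA.Term (γ ⊕ Fin n)) :
      IsDelta0 (BoundedFormula.rel R ts)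
  | imp {n : ℕ} {φ ψ : LA.BoundedFormula γ n} :
      IsDelta0 φ → IsDelta0 ψ → IsDelta0 (φ ⟹ ψ)
  | ball {n : ℕ} (t : LA.Term (γ ⊕ Fin n)) {φ : LA.BoundedFormula γ (n + 1)} :
      IsDelta0 φ → IsDelta0 (ball t φ)
  | bex {n : ℕ} (t : LA.Term (γ ⊕ Fin n)) {φ : LA.BoundedFormula γ (n + 1)} :
      IsDelta0 φ → IsDelta0 (bex t φ)

/-- `Π₁` formulas: the closure of the `Δ₀` formulas under universal quantification. -/
inductive IsPi1 : ∀ {n : ℕ}, LA.BoundedFormula γ n → Prop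
  | delta0 {n : ℕ} {φ : LA.BoundedFormula γ n} : IsDelta0 φ → IsPi1 φ
  | all {n : ℕ} {φ : LA.BoundedFormula γ (n + 1)} : IsPi1 φ → IsPi1 (∀' φ)

/-- `Σ₂` formulas: the closure of the `Π₁` formulas under existential quantification. -/
inductive IsSigma2 : ∀ {n : ℕ}, LA.BoundedFormula γ n → Prop
  | pi1 {n : ℕ} {φ : LA.BoundedFormula γ n} : IsPi1 φ → IsSigma2 φ
  | ex {n : ℕ} {φ : LA.BoundedFormula γ (n + 1)} : IsSigma2 φ → IsSigma2 (∃' φ)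

end Terms

/-! ### The theory `EA = IΔ₀ + exp` -/

/-- The axioms of `PA⁻`, the theory of the nonnegative parts of discretely ordered rings. -/
def PAminus : Set LA.Sentence :=
  { ∀' ∀' ∀' (((bv 0 + bv 1) + bv 2) =' (bv 0 + (bv 1 + bv 2))),
    ∀' ∀' ((bv 0 + bv 1) =' (bv 1 + bv 0)),
    ∀' ∀' ∀' (((bv 0 * bv 1) * bv 2) =' (bv 0 * (bv 1 * bv 2))),
    ∀' ∀' ((bv 0 * bv 1) =' (bv 1 * bv 0)),
    ∀' ∀' ∀' ((bv 0 * (bv 1 + bv 2)) =' (bv 0 * bv 1 + bv 0 * bv 2)),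
    ∀' (((bv 0 + 0) =' bv 0) ⊓ ((bv 0 * 0) =' 0)),
    ∀' ((bv 0 * 1) =' bv 0),
    ∀' ∀' ∀' ((ltF (bv 0) (bv 1) ⊓ ltF (bv 1) (bv 2)) ⟹ ltF (bv 0) (bv 2)),
    ∀' ∼(ltF (bv 0) (bv 0)),
    ∀' ∀' (ltF (bv 0) (bv 1) ⊔ ((bv 0 =' bv 1) ⊔ ltF (bv 1) (bv 0))),
    ∀' ∀' ∀' (ltF (bv 0) (bv 1) ⟹ ltF (bv 0 + bv 2) (bv 1 + bv 2)),
    ∀' ∀' ∀' ((ltF 0 (bv 2) ⊓ ltF (bv 0) (bv 1)) ⟹ ltF (bv 0 * bv 2) (bv 1 * bv 2)),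
    ∀' ∀' (ltF (bv 0) (bv 1) ⟹ ∃' ((bv 0 + bv 2) =' bv 1)),
    ltF 0 1 ⊓ ∀' (ltF 0 (bv 0) ⟹ (ltF 1 (bv 0) ⊔ (1 =' bv 0))),
    ∀' (ltF 0 (bv 0) ⊔ (0 =' bv 0)) }

/-- For a formula `φ` with parameters indexed by `Fin m` and one distinguished variable, the
formula `φ(t)`, where the term `t` may use `k` bound variables. -/
def substLast {m k : ℕ} (φ : LA.Formula (Fin m ⊕ Fin 1)) (t : LA.Term (Fin m ⊕ Fin k)) :
    LA.BoundedFormula (Fin m) k :=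
  (BoundedFormula.relabel (id : Fin m ⊕ Fin k → Fin m ⊕ Fin k)
    (φ.subst (Sum.elim (fun i => Term.var (Sum.inl i)) (fun _ => t)) :
      LA.BoundedFormula (Fin m ⊕ Fin k) 0) : LA.BoundedFormula (Fin m) (k + 0))

/-- The universal closure of a formula with free variables indexed by `Fin m`. -/
def univClosure {m : ℕ} (φ : LA.Formula (Fin m)) : LA.Sentence :=
  (BoundedFormula.relabel (Sum.inr : Fin m → Empty ⊕ Fin m) φ :
    LA.BoundedFormula Empty (m + 0)).alls

/-- The induction axiom
`∀ p⃗ (φ(p⃗, 0) ∧ ∀ x (φ(p⃗, x) → φ(p⃗, x + 1)) → ∀ x φ(p⃗, x))`. -/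
def indAxiom {m : ℕ} (φ : LA.Formula (Fin m ⊕ Fin 1)) : LA.Sentence :=
  univClosure
    ((substLast (k := 0) φ 0 ⊓ ∀' (substLast φ (bv 0) ⟹ substLast φ (bv 0 + 1))) ⟹
      ∀' substLast φ (bv 0))

section Exponentiation

variable {γ : Type} {n : ℕ}

/-- `u` is a power of two: `u > 0` and every divisor of `u` is `1` or even. -/
def pow2F (u : LA.Term (γ ⊕ Fin n)) : LA.BoundedFormula γ n :=
  ltF 0 u ⊓ ball (u + 1)
    (bex (up u + 1) ((up (bv (Fin.last n)) * bv (Fin.last (n + 1))) =' up (up u)) ⟹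
      ((bv (Fin.last n) =' 1) ⊔
        bex (bv (Fin.last n))
          (up (bv (Fin.last n)) =' (bv (Fin.last (n + 1)) + bv (Fin.last (n + 1))))))

/-- `⌊m / u⌋` is odd: `m = (2 q + 1) u + r` for some `q ≤ m` and `r < u`. -/
def bitF (u m : LA.Term (γ ⊕ Fin n)) : LA.BoundedFormula γ n :=
  bex (m + 1) (bex (up u)
    (up (up m) =' ((up (bv (Fin.last n)) + up (bv (Fin.last n)) + 1) * up (up u) + bv (Fin.last (n + 1)))))

/-- `⌊m / u⌋ mod u = d`: one has `d < u` and `m = (q u + d) u + r` for some `q ≤ m`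
and `r < u`. -/
def digF (u m d : LA.Term (γ ⊕ Fin n)) : LA.BoundedFormula γ n :=
  ltF d u ⊓ bex (m + 1) (bex (up u)
    (up (up m) =' ((up (bv (Fin.last n)) * up (up u) + up (up d)) * up (up u) + bv (Fin.last (n + 1)))))

end Exponentiation

/-- The main clause of the `Δ₀` graph of exponentiation, for `x ≥ 2` and `y ≥ 1`: `x ^ y = z` iff
the computation of `x ^ y` by repeated squaring is coded by numbers `M, X, Y ≤ z ^ 6`. The ones
in the binary expansion of `M` mark locations `u` (powers of two); `X` and `Y` store at location
`u` an exponent `e` and the value `x ^ e`. A marked location holds the pair `(1, x)`, or it is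
`v * v` for a marked location `v` that holds some `(e, w)`, and holds `(2 e, w ^ 2)` or
`(2 e + 1, w ^ 2 x)`. Some marked location holds `(y, z)`. The free variables `0, 1, 2` stand for
`x, y, z`, and the bound variables `bv 0, bv 1, bv 2` for `M, X, Y`. -/
def expCore : LA.Formula (Fin 3) :=
  let x {k : ℕ} : LA.Term (Fin 3 ⊕ Fin k) := Term.var (Sum.inl 0)
  let y {k : ℕ} : LA.Term (Fin 3 ⊕ Fin k) := Term.var (Sum.inl 1)
  let z {k : ℕ} : LA.Term (Fin 3 ⊕ Fin k) := Term.var (Sum.inl 2)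
  let b {k : ℕ} : LA.Term (Fin 3 ⊕ Fin k) := z * z * z * z * z * z + 1
  bex b (bex b (bex b (
    -- `bv 3` is the location of the pair `(y, z)`
    bex b (pow2F (bv 3) ⊓ (bitF (bv 3) (bv 0) ⊓ (digF (bv 3) (bv 1) y ⊓ digF (bv 3) (bv 2) z))) ⊓
    -- `bv 3` is an arbitrary marked location `u`
    ball b ((pow2F (bv 3) ⊓ bitF (bv 3) (bv 0)) ⟹
      ((digF (bv 3) (bv 1) 1 ⊓ digF (bv 3) (bv 2) x) ⊔
        -- `bv 4, bv 5, bv 6` are `v, e, w`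
        bex (bv 3) (((bv 3 =' (bv 4 * bv 4)) ⊓ bitF (bv 4) (bv 0)) ⊓
          bex b (bex b ((digF (bv 4) (bv 1) (bv 5) ⊓ digF (bv 4) (bv 2) (bv 6)) ⊓
            ((digF (bv 3) (bv 1) (bv 5 + bv 5) ⊓ digF (bv 3) (bv 2) (bv 6 * bv 6)) ⊔
              (digF (bv 3) (bv 1) (bv 5 + bv 5 + 1) ⊓ digF (bv 3) (bv 2) (bv 6 * bv 6 * x)))))))))))

/-- The graph `x ^ y = z` of exponentiation as a `Δ₀` formula; the free variables `0, 1, 2` stand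
for `x, y, z`. -/
def expF : LA.Formula (Fin 3) :=
  let x : LA.Term (Fin 3 ⊕ Fin 0) := Term.var (Sum.inl 0)
  let y : LA.Term (Fin 3 ⊕ Fin 0) := Term.var (Sum.inl 1)
  let z : LA.Term (Fin 3 ⊕ Fin 0) := Term.var (Sum.inl 2)
  ((y =' 0) ⊓ (z =' 1)) ⊔
    ((ltF 0 y ⊓ (((x =' 0) ⊔ (x =' 1)) ⊓ (z =' x))) ⊔
      ((ltF 0 y ⊓ ltF 1 x) ⊓ expCore))

/-- The axiom `∀ x ∀ y ∃ z. x ^ y = z`. -/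
def expTotal : LA.Sentence :=
  ∀' ∀' ∃' (BoundedFormula.relabel (Sum.inr : Fin 3 → Empty ⊕ Fin 3) expF :
    LA.BoundedFormula Empty 3)

/-- Elementary arithmetic `EA = IΔ₀ + exp`. -/
def EA : LA.Theory :=
  PAminus ∪
    {σ | ∃ (m : ℕ) (φ : LA.Formula (Fin m ⊕ Fin 1)), IsDelta0 φ ∧ σ = indAxiom φ} ∪
    {expTotal}

/-! ### Gödel numbering -/

/-- Codes of tuples of numbers. -/
def codeTuple {n : ℕ} (v : Fin n → ℕ) : ℕ := Encodable.encode (List.ofFn v)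

/-- Codes of function symbols. -/
def codeFunc : ∀ {n : ℕ}, LP.Functions n → ℕ
  | _, Sum.inl ArithFunc.zero => 0
  | _, Sum.inl ArithFunc.one => 1
  | _, Sum.inl ArithFunc.add => 2
  | _, Sum.inl ArithFunc.mul => 3

/-- Codes of relation symbols; symbols of different arities may share a code, since the code of
an atomic formula records the length of the tuple of arguments. -/
def codeRel : ∀ {n : ℕ}, LP.Relations n → ℕ
  | _, Sum.inl ArithRel.lt => 0
  | _, Sum.inr k => Nat.succ k

/-- Codes of terms. -/
def codeTerm {n : ℕ} : LP.Term (Empty ⊕ Fin n) → ℕ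
  | .var (Sum.inr i) => Nat.pair 0 i
  | .func f ts => Nat.pair 1 (Nat.pair (codeFunc f) (codeTuple fun i => codeTerm (ts i)))

/-- Codes of formulas. -/
def codeFormula : ∀ {n : ℕ}, LP.BoundedFormula Empty n → ℕ
  | _, .falsum => Nat.pair 0 0
  | _, .equal s t => Nat.pair 1 (Nat.pair (codeTerm s) (codeTerm t))
  | _, .rel R ts => Nat.pair 2 (Nat.pair (codeRel R) (codeTuple fun i => codeTerm (ts i)))
  | _, .imp φ ψ => Nat.pair 3 (Nat.pair (codeFormula φ) (codeFormula ψ))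
  | _, .all φ => Nat.pair 4 (codeFormula φ)

/-- The Gödel number of a sentence. -/
def godel (σ : LP.Sentence) : ℕ := codeFormula σ

/-! ### Definitions of truth -/

/-- The finitely axiomatised theory with the single axiom `α` proves the sentence `σ`, in first-order
logic with equality (by the completeness theorem, `σ` is a consequence of `α`). -/
def Proves (α σ : LP.Sentence) : Prop := ({α} : LP.Theory) ⊨ᵇ σ

/-- The sentence `Θ(⌜σ⌝)`. -/
def applyToCode (Θ : LP.Formula (Fin 1)) (σ : LA.Sentence) : LP.Sentence :=
  BoundedFormula.subst Θ fun _ => incl.onTerm (numeral (godel (incl.onSentence σ)))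

/-- `DEF`: the definitions of truth for `L_A`, that is, the finitely axiomatised consistent
theories that contain `EA` and prove all the Tarski biconditionals for some formula `Θ(x)`. -/
def DEF : Set LP.Sentence :=
  {α | ¬ Proves α ⊥ ∧
    (∀ σ ∈ EA, Proves α (incl.onSentence σ)) ∧
    ∃ Θ : LP.Formula (Fin 1), ∀ σ : LA.Sentence,
      Proves α (applyToCode Θ σ ⇔ incl.onSentence σ)}

/-- `cDEF`: the definitions of truth that are conservative over `EA`. -/
def cDEF : Set LP.Sentence :=
  {α | α ∈ DEF ∧ ∀ σ : LA.Sentence, Proves α (incl.onSentence σ) → EA ⊨ᵇ σ}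

/-! ### The definability order -/

/-- An `L_A`-conservative translation: every `n`-ary predicate symbol is sent to a formula with
`n` free variables. -/
abbrev Translation : Type := ∀ n : ℕ, predLang.Relations n → LP.Formula (Fin n)

/-- The effect of a translation on formulas: each atomic formula `P(t₁, ..., tₙ)` is replaced by
the formula `τ(P)(t₁, ..., tₙ)`, and everything else is kept. -/
def Translation.apply (τ : Translation) {γ : Type} :
    ∀ {n : ℕ}, LP.BoundedFormula γ n → LP.BoundedFormula γ n
  | _, .falsum => .falsum
  | _, .equal s t => .equal s t
  | _, .rel (Sum.inl R) ts => .rel (L := LP) (Sum.inl R) ts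
  | n, .rel (l := l) (Sum.inr P) ts =>
      (BoundedFormula.relabel (id : γ ⊕ Fin n → γ ⊕ Fin n)
        (BoundedFormula.subst (τ l P) ts) : LP.BoundedFormula γ (n + 0))
  | _, .imp φ ψ => .imp (τ.apply φ) (τ.apply ψ)
  | _, .all φ => .all (τ.apply φ)

/-- `α ⊴ β`: the theory `α` is definable in the theory `β`. -/
def Definable (α β : LP.Sentence) : Prop := ∃ τ : Translation, Proves β (τ.apply α)

/-- A set of sentences is `Σ₂`-definable if the set of the Gödel numbers of its elements is
defined in the standard model by a `Σ₂` formula of `L_A`. -/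
def IsSigma2Definable (B : Set LP.Sentence) : Prop :=
  ∃ φ : LA.Formula (Fin 1), IsSigma2 φ ∧
    ∀ k : ℕ, φ.Realize (fun _ => k) ↔ ∃ β ∈ B, godel β = k

/-- `B` is dense in the pre-order `⟨A, ⊴⟩`: below every element of `A` there is one of `B`. -/
def IsDenseIn (B A : Set LP.Sentence) : Prop :=
  B ⊆ A ∧ ∀ α ∈ A, ∃ β ∈ B, Definable β α

/-- `α` is a minimal element of the pre-order `⟨A, ⊴⟩` (equivalently, its class is minimal
in the quotient of `A` by mutual definability). -/
def IsMinimalIn (A : Set LP.Sentence) (α : LP.Sentence) : Prop :=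
  α ∈ A ∧ ∀ β ∈ A, Definable β α → Definable α β

end TruthDefinitions

/-!
All three statements follow from `exists_forall_not_definable`: for every `Σ₂` set `B` of
definitions of truth there is a definition of truth `γ` in which no element of `B` is definable.
For a single `α`, the set `{α}` is `Σ₂`, so there is `γ` with `α` not definable in `γ`. The
disjunction `α ⊔ γ` is again a definition of truth (the two truth formulas are combined by cases on
`α`), it is conservative over `EA` if `α` is, and it is definable in `α`; but `α` is not definable
in it, because `α` would then be definable in `γ`. Hence `α` is not minimal.

The sentence `γ` is self-referential. The theory `Gam g M y` consists of `PA⁻`, the totality of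
exponentiation, induction for a truth predicate, and Tarski's clauses for that predicate, where the
clause for the formula with code `x` and `n` free variables is required only if the guard `g` holds
at `y, n, x`. If `k` is the code of the formula that expresses this about `y`, then `γ` says that
`Gam g M k` holds. The guard is as follows. Membership in `B` of the sentence with code `b` is
equivalent to `∃ e, R e b`, where the true instances of `¬ R` are provable in `PA⁻`
(`IsSigma2.exists_rel`). The guard holds at `y, n, x` if for all `b, t, e, N ≤ n + x` either
`¬ R e b`, or some number approximates up to `N` a Henkin valuation (`IsVal`): a description of a
structure in which the formula with code `y` is true of `y`, while the sentence with code `b` is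
false after the translation with code `t`. So it has the property that its true instances are
provable in `PA⁻`.

* Suppose that, for `y = k`, the guard is always true in `ℕ`. Then `γ` proves all of Tarski's
  clauses for standard formulas and is a definition of truth (`gamS_mem_DEF`); it is consistent
  since it holds in `ℕ` with the true truth predicate (`gam_natTruth`), which needs that the `Δ₀`
  formula for the graph of exponentiation works in `ℕ` (`nat_models_expTotal`). For `β ∈ B` and
  every translation there are arbitrarily good approximations to a valuation, hence there is a
  valuation (`exists_isVal`), and it describes a model of `γ` in which the translation of `β` fails
  (`IsVal.realize_of_code`, `IsVal.not_realize_apply`).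
* Suppose that the guard fails in `ℕ` at some `x`, because of `b, t, e, N`. Then `ℕ` with a truth
  predicate for formulas whose code and number of variables add up to less than `x` satisfies `γ`,
  since the guard makes no demand beyond. Here `b` is the code of some `β ∈ B`. If `β` failed in
  the image of this structure under the translation with code `t`, then the structure would give
  rise to a valuation (`isVal_valOf`), and so there would be approximations (`exists_approx`),
  contrary to the choice of `N`. Therefore `β` holds in the image. But the predicates of the image
  are arithmetical, and `β` defines the truth of arithmetical sentences there, contrary to Tarski's
  theorem (`not_arith_truth`).

Since truth in all models is used for provability, no proof calculus appears.
-/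

namespace TruthDefinitions

/-! ### Models of `PA⁻` -/

section Ops

variable {M : Type} [LA.Structure M]

/-- The interpretation of `0`. -/
def ze : M := Structure.funMap (L := LA) ArithFunc.zero ![]
/-- The interpretation of `1`. -/
def on : M := Structure.funMap (L := LA) ArithFunc.one ![]
/-- The interpretation of `+`. -/
def ad (a b : M) : M := Structure.funMap (L := LA) ArithFunc.add ![a, b]
/-- The interpretation of `×`. -/
def ml (a b : M) : M := Structure.funMap (L := LA) ArithFunc.mul ![a, b]
/-- The interpretation of `<`. -/
def ls (a b : M) : Prop := Structure.RelMap (L := LA) ArithRel.lt ![a, b]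

variable {γ : Type} (v : γ → M)

@[simp] theorem realize_zero : (0 : LA.Term γ).realize v = ze := by
  change Structure.funMap _ _ = _
  rw [Subsingleton.elim (fun i => _) (![] : Fin 0 → M)]; rfl

@[simp] theorem realize_one : (1 : LA.Term γ).realize v = on := by
  change Structure.funMap _ _ = _
  rw [Subsingleton.elim (fun i => _) (![] : Fin 0 → M)]; rfl

theorem comp_vec2 {α β : Type} (f : α → β) (a b : α) : (fun i => f (![a, b] i)) = ![f a, f b] := by
  funext i; fin_cases i <;> rfl

@[simp] theorem realize_add (s t : LA.Term γ) :
    (s + t).realize v = ad (s.realize v) (t.realize v) := by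
  change Structure.funMap _ _ = _
  rw [comp_vec2 (Term.realize v)]; rfl

@[simp] theorem realize_mul (s t : LA.Term γ) :
    (s * t).realize v = ml (s.realize v) (t.realize v) := by
  change Structure.funMap _ _ = _
  rw [comp_vec2 (Term.realize v)]; rfl

@[simp] theorem realize_bv {n : ℕ} (w : γ ⊕ Fin n → M) (i : Fin n) :
    (bv i : LA.Term (γ ⊕ Fin n)).realize w = w (Sum.inr i) := rfl

@[simp] theorem realize_ltF {n : ℕ} (s t : LA.Term (γ ⊕ Fin n)) (xs : Fin n → M) :
    (ltF s t).Realize v xs ↔ ls (s.realize (Sum.elim v xs)) (t.realize (Sum.elim v xs)) := by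
  change Structure.RelMap _ _ ↔ _
  rw [comp_vec2 (Term.realize (Sum.elim v xs))]; rfl

@[simp] theorem realize_up {n : ℕ} (t : LA.Term (γ ⊕ Fin n)) (xs : Fin n → M) (a : M) :
    (up t).realize (Sum.elim v (Fin.snoc xs a : Fin (n + 1) → M)) =
      t.realize (Sum.elim v xs) := by
  rw [up, Term.realize_relabel]
  congr 1
  funext i
  rcases i with i | i <;> simp

@[simp] theorem realize_ball {n : ℕ} (t : LA.Term (γ ⊕ Fin n)) (φ : LA.BoundedFormula γ (n + 1))
    (xs : Fin n → M) :
    (ball t φ).Realize v xs ↔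
      ∀ a, ls a (t.realize (Sum.elim v xs)) → φ.Realize v (Fin.snoc xs a) := by
  simp [ball]

@[simp] theorem realize_bex {n : ℕ} (t : LA.Term (γ ⊕ Fin n)) (φ : LA.BoundedFormula γ (n + 1))
    (xs : Fin n → M) :
    (bex t φ).Realize v xs ↔
      ∃ a, ls a (t.realize (Sum.elim v xs)) ∧ φ.Realize v (Fin.snoc xs a) := by
  simp [bex]

/-- The element of an arithmetical structure named by the numeral `n`. -/
def num (M : Type) [LA.Structure M] : ℕ → M
  | 0 => ze
  | n + 1 => ad (num M n) on

@[simp] theorem realize_numeral (n : ℕ) : (numeral n : LA.Term γ).realize v = num M n := by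
  induction n with
  | zero => exact realize_zero v
  | succ n ih => rw [numeral, realize_add, ih, realize_one]; rfl

end Ops

section NatOps

@[simp] theorem nat_ze : (ze : ℕ) = 0 := rfl
@[simp] theorem nat_on : (on : ℕ) = 1 := rfl
@[simp] theorem nat_ad (a b : ℕ) : ad a b = a + b := rfl
@[simp] theorem nat_ml (a b : ℕ) : ml a b = a * b := rfl
@[simp] theorem nat_ls (a b : ℕ) : ls a b ↔ a < b := Iff.rfl
@[simp] theorem nat_num (n : ℕ) : num ℕ n = n := by
  induction n with
  | zero => rfl
  | succ n ih => rw [num, ih]; rfl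

end NatOps

/-- The consequences of `PA⁻` that are used below, in semantic form. -/
structure IsPAm (M : Type) [LA.Structure M] : Prop where
  add_assoc : ∀ a b c : M, ad (ad a b) c = ad a (ad b c)
  add_comm : ∀ a b : M, ad a b = ad b a
  mul_add : ∀ a b c : M, ml a (ad b c) = ad (ml a b) (ml a c)
  add_zero : ∀ a : M, ad a ze = a
  mul_zero : ∀ a : M, ml a ze = ze
  mul_one : ∀ a : M, ml a on = a
  lt_trans : ∀ a b c : M, ls a b → ls b c → ls a c
  lt_irrefl : ∀ a : M, ¬ ls a a
  lt_total : ∀ a b : M, ls a b ∨ a = b ∨ ls b a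
  add_lt : ∀ a b c : M, ls a b → ls (ad a c) (ad b c)
  sub : ∀ a b : M, ls a b → ∃ c, ad a c = b
  zero_lt_one : ls (ze : M) on
  one_le : ∀ a : M, ls ze a → ls on a ∨ on = a
  zero_le : ∀ a : M, ls ze a ∨ ze = a

theorem isPAm_of_models {M : Type} [LA.Structure M] (h : ∀ σ ∈ PAminus, M ⊨ σ) : IsPAm M := by
  simp only [PAminus, Set.mem_insert_iff, Set.mem_singleton_iff, forall_eq_or_imp, forall_eq] at h
  simp [Sentence.Realize, Formula.Realize, Fin.snoc, BoundedFormula.realize_bdEqual] at h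
  obtain ⟨h1, h2, h3, h4, h5, h6, h7, h8, h9, h10, h11, h12, h13, ⟨h14, h14'⟩, h15⟩ := h
  exact ⟨h1, h2, h5, fun a => (h6 a).1, fun a => (h6 a).2, h7, h8, h9, h10, h11, h13, h14, h14',
    h15⟩

theorem nat_models_PAminus : ∀ σ ∈ PAminus, ℕ ⊨ σ := by
  simp only [PAminus, Set.mem_insert_iff, Set.mem_singleton_iff, forall_eq_or_imp, forall_eq]
  simp [Sentence.Realize, Formula.Realize, Fin.snoc, BoundedFormula.realize_bdEqual]
  refine ⟨fun a b c => by ring, fun a b => by ring, fun a b c => by ring, fun a b => by ring,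
    fun a b c => by ring, fun a b c => by omega, fun a b => by omega,
    fun a b c h1 h2 => Nat.mul_lt_mul_of_pos_right h2 h1, fun a b h => ⟨b - a, by omega⟩,
    fun a => by omega, fun a => by omega⟩

theorem nat_isPAm : IsPAm ℕ := isPAm_of_models nat_models_PAminus

namespace IsPAm

variable {M : Type} [LA.Structure M] (h : IsPAm M)
include h

theorem num_add (a b : ℕ) : num M (a + b) = ad (num M a) (num M b) := by
  induction b with
  | zero => exact (h.add_zero _).symm
  | succ b ih => rw [← Nat.add_assoc, num, ih, h.add_assoc]; rfl

theorem num_mul (a b : ℕ) : num M (a * b) = ml (num M a) (num M b) := by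
  induction b with
  | zero => exact (h.mul_zero _).symm
  | succ b ih => rw [Nat.mul_succ, h.num_add, ih, num, h.mul_add, h.mul_one]

theorem lt_add_one (a : M) : ls a (ad a on) := by
  have := h.add_lt _ _ a h.zero_lt_one
  rwa [h.add_comm ze, h.add_zero, h.add_comm on] at this

theorem num_lt {a b : ℕ} (hab : a < b) : ls (num M a) (num M b) := by
  induction b with
  | zero => omega
  | succ b ih =>
    rcases Nat.lt_succ_iff_lt_or_eq.1 hab with h1 | rfl
    · exact h.lt_trans _ _ _ (ih h1) (h.lt_add_one _)
    · exact h.lt_add_one _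

theorem num_lt_iff {a b : ℕ} : ls (num M a) (num M b) ↔ a < b := by
  refine ⟨fun hab => ?_, h.num_lt⟩
  by_contra hlt
  rcases Nat.lt_or_eq_of_le (not_lt.1 hlt) with h1 | h1
  · exact h.lt_irrefl _ (h.lt_trans _ _ _ hab (h.num_lt h1))
  · subst h1; exact h.lt_irrefl _ hab

theorem num_inj {a b : ℕ} : num M a = num M b ↔ a = b := by
  refine ⟨fun hab => ?_, fun hab => by rw [hab]⟩
  rcases lt_trichotomy a b with h1 | h1 | h1
  · exact absurd (hab ▸ h.num_lt h1) (h.lt_irrefl _)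
  · exact h1
  · exact absurd (hab ▸ h.num_lt h1) (h.lt_irrefl _)

/-- The elements below a standard numeral are standard. -/
theorem lt_num {x : M} {n : ℕ} (hx : ls x (num M n)) : ∃ k < n, x = num M k := by
  induction n with
  | zero =>
    rcases h.zero_le x with h1 | h1
    · exact absurd (h.lt_trans _ _ _ h1 hx) (h.lt_irrefl _)
    · rw [← h1] at hx; exact absurd hx (h.lt_irrefl _)
  | succ n ih =>
    rcases h.lt_total x (num M n) with h1 | h1 | h1
    · obtain ⟨k, hk, e⟩ := ih h1; exact ⟨k, by omega, e⟩
    · exact ⟨n, by omega, h1⟩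
    · obtain ⟨d, rfl⟩ := h.sub _ _ h1
      exfalso
      rcases h.zero_le d with h2 | h2
      · rcases h.one_le d h2 with h3 | h3
        · have := h.add_lt _ _ (num M n) h3
          rw [h.add_comm on, h.add_comm d] at this
          exact h.lt_irrefl _ (h.lt_trans _ _ _ hx this)
        · subst h3; exact h.lt_irrefl _ hx
      · subst h2; rw [h.add_zero] at h1; exact h.lt_irrefl _ h1

end IsPAm

/-! ### Formulas over environments -/

/-- Push an element on top of an environment. -/
def ncons {M : Type} (a : M) (ρ : ℕ → M) : ℕ → M
  | 0 => a
  | i + 1 => ρ i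

@[simp] theorem ncons_zero {M : Type} (a : M) (ρ : ℕ → M) : ncons a ρ 0 = a := rfl
@[simp] theorem ncons_succ {M : Type} (a : M) (ρ : ℕ → M) (i : ℕ) :
    ncons a ρ (i + 1) = ρ i := rfl

theorem comp_ncons {M N : Type} (f : M → N) (a : M) (ρ : ℕ → M) :
    (fun i => f (ncons a ρ i)) = ncons (f a) (fun i => f (ρ i)) := by
  funext i; cases i <;> rfl

section Quantifiers

variable {L : FirstOrder.Language.{0, 0}}

/-- Universal quantification of the variable `0` of a formula whose free variables are the entries
of an environment; the other variables are shifted down. -/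
def allH (φ : L.Formula ℕ) : L.Formula ℕ :=
  (BoundedFormula.relabel (fun j : ℕ => (ncons (Sum.inr 0) Sum.inl j : ℕ ⊕ Fin 1)) φ :
    L.BoundedFormula ℕ 1).all

/-- Existential quantification of the variable `0`. -/
def exH (φ : L.Formula ℕ) : L.Formula ℕ := (allH φ.not).not

variable {M : Type} [L.Structure M]

@[simp] theorem realize_allH (φ : L.Formula ℕ) (ρ : ℕ → M) :
    (allH φ).Realize ρ ↔ ∀ a, φ.Realize (ncons a ρ) := by
  rw [Formula.Realize, allH, BoundedFormula.realize_all]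
  refine forall_congr' fun a => ?_
  refine (BoundedFormula.realize_relabel (n := 0) (m := 1)).trans ?_
  rw [Formula.Realize, Subsingleton.elim (_ ∘ Fin.natAdd 1) (default : Fin 0 → M)]
  refine iff_of_eq (congrArg (fun w => BoundedFormula.Realize φ w default) ?_)
  funext i
  cases i <;> rfl

@[simp] theorem realize_exH (φ : L.Formula ℕ) (ρ : ℕ → M) :
    (exH φ).Realize ρ ↔ ∃ a, φ.Realize (ncons a ρ) := by
  simp [exH]

end Quantifiers

/-- The atomic formula `s < t` over an environment. -/
def ltN (s t : LA.Term ℕ) : LA.Formula ℕ := Relations.formula (L := LA) ArithRel.lt ![s, t]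

@[simp] theorem realize_ltN {M : Type} [LA.Structure M] (s t : LA.Term ℕ) (ρ : ℕ → M) :
    (ltN s t).Realize ρ ↔ ls (s.realize ρ) (t.realize ρ) := by
  refine (Formula.realize_rel (L := LA)).trans ?_
  rw [comp_vec2 (Term.realize ρ)]; rfl

/-! ### Relations absolute between `ℕ` and the models of `PA⁻` -/

/-- A relation on `ℕ` is absolute if a formula defines it both in `ℕ` and, at numerals, in every
model of `PA⁻`. -/
def DRel (R : (ℕ → ℕ) → Prop) : Prop :=
  ∃ φ : LA.Formula ℕ, ∀ (M : Type) [LA.Structure M], IsPAm M → ∀ ρ : ℕ → ℕ,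
    φ.Realize (fun i => num M (ρ i)) ↔ R ρ

/-- A function on `ℕ` is absolute if a formula defines its graph both in `ℕ` and, at numeral
arguments, in every model of `PA⁻`. -/
def DFun (f : (ℕ → ℕ) → ℕ) : Prop :=
  ∃ φ : LA.Formula ℕ, ∀ (M : Type) [LA.Structure M], IsPAm M → ∀ (ρ : ℕ → ℕ) (z : M),
    φ.Realize (ncons z fun i => num M (ρ i)) ↔ z = num M (f ρ)

/-- A relation on `ℕ` is persistent if it is defined in `ℕ` by a formula whose instances
that are true in `ℕ` hold in all models of `PA⁻`. -/
def SRel (R : (ℕ → ℕ) → Prop) : Prop :=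
  ∃ φ : LA.Formula ℕ, (∀ ρ : ℕ → ℕ, φ.Realize ρ ↔ R ρ) ∧
    ∀ (M : Type) [LA.Structure M], IsPAm M → ∀ ρ : ℕ → ℕ, R ρ →
      φ.Realize (fun i => num M (ρ i))

theorem comp_relabel {M : Type} (a b : M) (ρ : ℕ → M) :
    (ncons a (ncons b ρ)) ∘ (fun i => ncons 0 (fun j => j + 2) i) = ncons a ρ := by
  funext i; cases i <;> rfl

theorem comp_relabel' {M : Type} (a b : M) (ρ : ℕ → M) :
    (ncons a (ncons b ρ)) ∘ (fun i => i + 1) = ncons b ρ := by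
  funext i; cases i <;> rfl

theorem comp_relabel_three {M : Type} (a b c : M) (ρ : ℕ → M) :
    (ncons a (ncons b (ncons c ρ))) ∘ (fun i => ncons 0 (fun j => j + 3) i) = ncons a ρ := by
  funext i; cases i <;> rfl

namespace DRel

variable {R S : (ℕ → ℕ) → Prop} {f g : (ℕ → ℕ) → ℕ}

theorem not : DRel R → DRel fun ρ => ¬ R ρ := by
  rintro ⟨φ, hφ⟩
  exact ⟨φ.not, fun M _ h ρ => by rw [Formula.realize_not, hφ M h]⟩

theorem imp : DRel R → DRel S → DRel fun ρ => R ρ → S ρ := by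
  rintro ⟨φ, hφ⟩ ⟨ψ, hψ⟩
  exact ⟨φ.imp ψ, fun M _ h ρ => by rw [Formula.realize_imp, hφ M h, hψ M h]⟩

theorem of_iff (hR : DRel R) (h : ∀ ρ, S ρ ↔ R ρ) : DRel S := by
  rwa [show S = R from funext fun ρ => propext (h ρ)]

theorem and (hR : DRel R) (hS : DRel S) : DRel fun ρ => R ρ ∧ S ρ :=
  (hR.imp hS.not).not.of_iff fun ρ => by tauto

theorem or (hR : DRel R) (hS : DRel S) : DRel fun ρ => R ρ ∨ S ρ :=
  (hR.not.imp hS).of_iff fun ρ => by tauto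

theorem iff (hR : DRel R) (hS : DRel S) : DRel fun ρ => (R ρ ↔ S ρ) :=
  ((hR.imp hS).and (hS.imp hR)).of_iff fun ρ => by tauto

theorem eq (hf : DFun f) (hg : DFun g) : DRel fun ρ => f ρ = g ρ := by
  obtain ⟨φ, hφ⟩ := hf
  obtain ⟨ψ, hψ⟩ := hg
  refine ⟨exH (φ ⊓ ψ), fun M _ h ρ => ?_⟩
  simp [hφ M h, hψ M h, h.num_inj]

theorem lt (hf : DFun f) (hg : DFun g) : DRel fun ρ => f ρ < g ρ := by
  obtain ⟨φ, hφ⟩ := hf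
  obtain ⟨ψ, hψ⟩ := hg
  refine ⟨exH (exH ((φ.relabel fun i => ncons 0 (fun j => j + 2) i) ⊓
    ((ψ.relabel fun i => i + 1) ⊓ ltN (Term.var 0) (Term.var 1)))), fun M _ h ρ => ?_⟩
  simp [comp_relabel, comp_relabel', hφ M h, hψ M h, h.num_lt_iff]

theorem ball {R : ℕ → (ℕ → ℕ) → Prop} (hf : DFun f)
    (hR : DRel fun ρ => R (ρ 0) fun i => ρ (i + 1)) : DRel fun ρ => ∀ a, a < f ρ → R a ρ := by
  obtain ⟨φ, hφ⟩ := hf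
  obtain ⟨ψ, hψ⟩ := hR
  refine ⟨exH (φ ⊓ allH ((ltN (Term.var 0) (Term.var 1)).imp
    (ψ.relabel fun i => ncons 0 (fun j => j + 2) i))), fun M _ h ρ => ?_⟩
  have key : ∀ a, ψ.Realize (ncons (num M a) fun i => num M (ρ i)) ↔ R a ρ := fun a => by
    rw [← comp_ncons, hψ M h]; rfl
  simp only [realize_exH, Formula.realize_inf, hφ M h, exists_eq_left, realize_allH,
    Formula.realize_imp, realize_ltN, Term.realize_var, ncons_zero, Formula.realize_relabel,
    comp_relabel]
  constructor
  · intro H a ha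
    exact (key a).1 (H _ (h.num_lt ha))
  · intro H a ha
    obtain ⟨k, hk, rfl⟩ := h.lt_num ha
    exact (key k).2 (H k hk)

theorem bex {R : ℕ → (ℕ → ℕ) → Prop} (hf : DFun f)
    (hR : DRel fun ρ => R (ρ 0) fun i => ρ (i + 1)) : DRel fun ρ => ∃ a, a < f ρ ∧ R a ρ :=
  (ball (R := fun a ρ => ¬ R a ρ) hf hR.not).not.of_iff fun ρ => by
    constructor
    · rintro ⟨a, h1, h2⟩ h
      exact h a h1 h2
    · intro h; push Not at h; exact h

theorem comp (hR : DRel R) (g : ℕ → ℕ) : DRel fun ρ => R fun i => ρ (g i) := by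
  obtain ⟨φ, hφ⟩ := hR
  refine ⟨φ.relabel g, fun M _ h ρ => ?_⟩
  rw [Formula.realize_relabel]
  exact hφ M h fun i => ρ (g i)

end DRel

namespace DFun

variable {f g : (ℕ → ℕ) → ℕ}

theorem var (i : ℕ) : DFun fun ρ => ρ i :=
  ⟨(Term.var 0).equal (Term.var (i + 1)), fun M _ _ ρ z => by simp⟩

theorem const (n : ℕ) : DFun fun _ => n :=
  ⟨(Term.var 0).equal (numeral n), fun M _ _ ρ z => by simp⟩

theorem add (hf : DFun f) (hg : DFun g) : DFun fun ρ => f ρ + g ρ := by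
  obtain ⟨φ, hφ⟩ := hf
  obtain ⟨ψ, hψ⟩ := hg
  refine ⟨exH (exH ((φ.relabel fun i => ncons 0 (fun j => j + 3) i) ⊓
    ((ψ.relabel fun i => ncons 0 (fun j => j + 2) (i)).relabel (fun i => i + 1) ⊓
      (Term.var 2).equal (Term.var 0 + Term.var 1)))), fun M _ h ρ z => ?_⟩
  simp only [realize_exH, Formula.realize_inf, Formula.realize_relabel, comp_relabel',
    comp_relabel_three, comp_relabel, hφ M h, hψ M h]
  simp [h.num_add]

theorem mul (hf : DFun f) (hg : DFun g) : DFun fun ρ => f ρ * g ρ := by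
  obtain ⟨φ, hφ⟩ := hf
  obtain ⟨ψ, hψ⟩ := hg
  refine ⟨exH (exH ((φ.relabel fun i => ncons 0 (fun j => j + 3) i) ⊓
    ((ψ.relabel fun i => ncons 0 (fun j => j + 2) (i)).relabel (fun i => i + 1) ⊓
      (Term.var 2).equal (Term.var 0 * Term.var 1)))), fun M _ h ρ z => ?_⟩
  simp only [realize_exH, Formula.realize_inf, Formula.realize_relabel, comp_relabel',
    comp_relabel_three, comp_relabel, hφ M h, hψ M h]
  simp [h.num_mul]

theorem comp (hf : DFun f) (g : ℕ → ℕ) : DFun fun ρ => f fun i => ρ (g i) := by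
  obtain ⟨φ, hφ⟩ := hf
  refine ⟨φ.relabel fun i => ncons 0 (fun j => g j + 1) i, fun M _ h ρ z => ?_⟩
  rw [Formula.realize_relabel]
  refine Iff.trans (iff_of_eq (congrArg _ ?_)) (hφ M h (fun i => ρ (g i)) z)
  funext i; cases i <;> rfl

/-- A function with an absolute graph and an absolute bound is absolute. -/
theorem of_graph (hg : DFun g) (hf : DRel fun ρ => ρ 0 = f fun i => ρ (i + 1))
    (hfg : ∀ ρ, f ρ < g ρ) : DFun f := by
  obtain ⟨φ, hφ⟩ := DRel.lt (var 0) (hg.comp fun i => i + 1)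
  obtain ⟨ψ, hψ⟩ := hf
  obtain ⟨χ, hχ⟩ := hg
  refine ⟨ψ ⊓ exH ((χ.relabel fun i => ncons 0 (fun j => j + 2) i) ⊓
    ltN (Term.var 1) (Term.var 0)), fun M _ h ρ z => ?_⟩
  simp only [realize_exH, Formula.realize_inf, Formula.realize_relabel, comp_relabel, hχ M h,
    exists_eq_left, realize_ltN, Term.realize_var, ncons_zero, ncons_succ]
  have key : ∀ a, ψ.Realize (ncons (num M a) fun i => num M (ρ i)) ↔ a = f ρ := fun a => by
    rw [← comp_ncons, hψ M h]; rfl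
  constructor
  · rintro ⟨h1, h2⟩
    obtain ⟨k, hk, rfl⟩ := h.lt_num h2
    rw [(key k).1 h1]
  · rintro rfl
    exact ⟨(key _).2 rfl, h.num_lt (hfg ρ)⟩

theorem pair (hf : DFun f) (hg : DFun g) : DFun fun ρ => Nat.pair (f ρ) (g ρ) := by
  refine of_graph (g := fun ρ => (f ρ + g ρ + 1) * (f ρ + g ρ + 1))
    (((hf.add hg).add (const 1)).mul ((hf.add hg).add (const 1))) ?_ ?_
  · have hf' := hf.comp fun i => i + 1
    have hg' := hg.comp fun i => i + 1
    refine (((DRel.lt hf' hg').and (DRel.eq (var 0) ((hg'.mul hg').add hf'))).or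
      ((DRel.lt hf' hg').not.and (DRel.eq (var 0) (((hf'.mul hf').add hf').add hg')))).of_iff ?_
    intro ρ
    rw [Nat.pair]
    split <;> simp [*]
  · intro ρ
    rw [Nat.pair]
    split <;> nlinarith

theorem mod (hf : DFun f) (hg : DFun g) : DFun fun ρ => f ρ % (g ρ + 1) := by
  refine of_graph (hf.add (const 1)) ?_ fun ρ => Nat.lt_succ_of_le (Nat.mod_le _ _)
  have hf' := hf.comp fun i => i + 1
  have hg' := hg.comp fun i => i + 1
  have hq := DRel.bex (R := fun q ρ => f (fun i => ρ (i + 1)) =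
      q * (g (fun i => ρ (i + 1)) + 1) + ρ 0) (hf'.add (const 1))
    (DRel.eq (hf'.comp fun i => i + 1) (((var 0).mul ((hg'.comp fun i => i + 1).add
      (const 1))).add (var 1)))
  refine ((DRel.lt (var 0) (hg'.add (const 1))).and hq).of_iff fun ρ => ?_
  constructor
  · intro h
    rw [h]
    refine ⟨Nat.mod_lt _ (Nat.succ_pos _), _,
      Nat.lt_succ_of_le (Nat.div_le_self _ (g (fun i => ρ (i + 1)) + 1)), ?_⟩
    rw [Nat.div_add_mod']
  · rintro ⟨h1, q, -, h2⟩
    rw [h2, Nat.add_comm, Nat.add_mul_mod_self_right, Nat.mod_eq_of_lt h1]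

theorem unpair_fst (hf : DFun f) : DFun fun ρ => (f ρ).unpair.1 := by
  refine of_graph (hf.add (const 1)) ?_ fun ρ => Nat.lt_succ_of_le (Nat.unpair_left_le _)
  have hf' := hf.comp fun i => i + 1
  have hq := DRel.bex (R := fun q ρ => Nat.pair (ρ 0) q = f (fun i => ρ (i + 1)))
    (hf'.add (const 1)) (DRel.eq ((var 1).pair (var 0)) (hf'.comp fun i => i + 1))
  refine hq.of_iff fun ρ => ?_
  constructor
  · intro h
    refine ⟨_, Nat.lt_succ_of_le (Nat.unpair_right_le (f fun i => ρ (i + 1))), ?_⟩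
    rw [h, Nat.pair_unpair]
  · rintro ⟨q, -, h⟩
    rw [← h, Nat.unpair_pair]

theorem unpair_snd (hf : DFun f) : DFun fun ρ => (f ρ).unpair.2 := by
  refine of_graph (hf.add (const 1)) ?_ fun ρ => Nat.lt_succ_of_le (Nat.unpair_right_le _)
  have hf' := hf.comp fun i => i + 1
  have hq := DRel.bex (R := fun q ρ => Nat.pair q (ρ 0) = f (fun i => ρ (i + 1)))
    (hf'.add (const 1)) (DRel.eq ((var 0).pair (var 1)) (hf'.comp fun i => i + 1))
  refine hq.of_iff fun ρ => ?_
  constructor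
  · intro h
    refine ⟨_, Nat.lt_succ_of_le (Nat.unpair_left_le (f fun i => ρ (i + 1))), ?_⟩
    rw [h, Nat.pair_unpair]
  · rintro ⟨q, -, h⟩
    rw [← h, Nat.unpair_pair]

theorem beta (hf : DFun f) (hg : DFun g) : DFun fun ρ => Nat.beta (f ρ) (g ρ) :=
  hf.unpair_fst.mod ((hg.add (const 1)).mul hf.unpair_snd)

end DFun

namespace SRel

variable {R S : (ℕ → ℕ) → Prop}

theorem of_DRel (h : DRel R) : SRel R := by
  obtain ⟨φ, hφ⟩ := h
  refine ⟨φ, fun ρ => ?_, fun M _ h ρ => (hφ M h ρ).2⟩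
  simpa using hφ ℕ nat_isPAm ρ

theorem or (hR : SRel R) (hS : SRel S) : SRel fun ρ => R ρ ∨ S ρ := by
  obtain ⟨φ, h1, h2⟩ := hR
  obtain ⟨ψ, h3, h4⟩ := hS
  refine ⟨φ ⊔ ψ, fun ρ => by simp [h1, h3], fun M _ h ρ hρ => ?_⟩
  rw [Formula.realize_sup]
  exact hρ.imp (h2 M h ρ) (h4 M h ρ)

theorem ex {R : ℕ → (ℕ → ℕ) → Prop} (hR : SRel fun ρ => R (ρ 0) fun i => ρ (i + 1)) :
    SRel fun ρ => ∃ a, R a ρ := by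
  obtain ⟨φ, h1, h2⟩ := hR
  refine ⟨exH φ, fun ρ => by simp [h1], fun M _ h ρ ⟨a, ha⟩ => ?_⟩
  rw [realize_exH]
  exact ⟨num M a, by rw [← comp_ncons]; exact h2 M h _ ha⟩

theorem ball {R : ℕ → (ℕ → ℕ) → Prop} {f : (ℕ → ℕ) → ℕ} (hf : DFun f)
    (hR : SRel fun ρ => R (ρ 0) fun i => ρ (i + 1)) : SRel fun ρ => ∀ a, a < f ρ → R a ρ := by
  obtain ⟨φ, hφ⟩ := hf
  obtain ⟨ψ, h1, h2⟩ := hR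
  have hφ' : ∀ ρ z, φ.Realize (ncons z ρ) ↔ z = f ρ := fun ρ z => by
    simpa using hφ ℕ nat_isPAm ρ z
  refine ⟨exH (φ ⊓ allH ((ltN (Term.var 0) (Term.var 1)).imp
    (ψ.relabel fun i => ncons 0 (fun j => j + 2) i))), fun ρ => ?_, fun M _ h ρ hρ => ?_⟩
  · simp [hφ', comp_relabel, h1]
  · simp only [realize_exH, Formula.realize_inf, hφ M h, exists_eq_left, realize_allH,
      Formula.realize_imp, realize_ltN, Term.realize_var, ncons_zero, Formula.realize_relabel,
      comp_relabel]
    intro a ha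
    obtain ⟨k, hk, rfl⟩ := h.lt_num ha
    rw [← comp_ncons]
    exact h2 M h _ (hρ k hk)

theorem comp (hR : SRel R) (g : ℕ → ℕ) : SRel fun ρ => R fun i => ρ (g i) := by
  obtain ⟨φ, h1, h2⟩ := hR
  refine ⟨φ.relabel g, fun ρ => ?_, fun M _ h ρ hρ => ?_⟩
  · rw [Formula.realize_relabel]; exact h1 _
  · rw [Formula.realize_relabel]; exact h2 M h _ hρ

end SRel

/-! ### Absoluteness of `Δ₀` formulas and persistence of negated `Π₁` formulas -/

theorem snoc_num {M : Type} [LA.Structure M] {n : ℕ} (xs : Fin n → ℕ) (k : ℕ) :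
    (Fin.snoc (fun i => num M (xs i)) (num M k) : Fin (n + 1) → M) =
      fun i => num M ((Fin.snoc xs k : Fin (n + 1) → ℕ) i) := by
  funext i
  induction i using Fin.lastCases <;> simp

theorem func_zero_eq {α : Type} (ts : Fin 0 → LA.Term α) :
    Term.func (L := LA) ArithFunc.zero ts = 0 := by
  rw [Subsingleton.elim ts ![] ]; rfl

theorem func_one_eq {α : Type} (ts : Fin 0 → LA.Term α) :
    Term.func (L := LA) ArithFunc.one ts = 1 := by
  rw [Subsingleton.elim ts ![] ]; rfl

theorem vec2_eq {α : Type} (ts : Fin 2 → α) : ts = ![ts 0, ts 1] := by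
  funext i; fin_cases i <;> rfl

theorem func_add_eq {α : Type} (ts : Fin 2 → LA.Term α) :
    Term.func (L := LA) ArithFunc.add ts = ts 0 + ts 1 := by
  rw [vec2_eq ts]; rfl

theorem func_mul_eq {α : Type} (ts : Fin 2 → LA.Term α) :
    Term.func (L := LA) ArithFunc.mul ts = ts 0 * ts 1 := by
  rw [vec2_eq ts]; rfl

theorem IsPAm.num_one {M : Type} [LA.Structure M] (h : IsPAm M) : num M 1 = on := by
  have := h.add_comm (ze : M) on
  rw [h.add_zero] at this
  exact this

theorem realize_term_num {M : Type} [LA.Structure M] (h : IsPAm M) {α : Type} (t : LA.Term α)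
    (v : α → ℕ) : t.realize (fun i => num M (v i)) = num M (t.realize v) := by
  induction t with
  | var i => rfl
  | func f ts ih =>
    cases f with
    | zero => rw [func_zero_eq]; simp [num]
    | one => rw [func_one_eq]; simp [h.num_one]
    | add => rw [func_add_eq]; simp [h.num_add, ih]
    | mul => rw [func_mul_eq]; simp [h.num_mul, ih]

theorem IsDelta0.absolute {M : Type} [LA.Structure M] (h : IsPAm M) {γ : Type} {n : ℕ}
    {φ : LA.BoundedFormula γ n} (hφ : IsDelta0 φ) (v : γ → ℕ) (xs : Fin n → ℕ) :
    φ.Realize (fun i => num M (v i)) (fun i => num M (xs i)) ↔ φ.Realize v xs := by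
  have hel : ∀ {n : ℕ} (xs : Fin n → ℕ), (Sum.elim (fun i => num M (v i)) fun i => num M (xs i)) =
      fun i => num M (Sum.elim v xs i) := fun xs => by
    funext i; rcases i with i | i <;> rfl
  induction hφ with
  | falsum => exact Iff.rfl
  | equal s t =>
    simp only [BoundedFormula.Realize, hel, realize_term_num h, h.num_inj]
  | rel R ts =>
    simp only [BoundedFormula.Realize, hel, realize_term_num h]
    cases R
    rw [vec2_eq fun i => num M _, vec2_eq fun i => Term.realize _ _]
    exact h.num_lt_iff
  | imp _ _ ih1 ih2 => simp only [BoundedFormula.realize_imp, ih1, ih2]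
  | ball t _ ih =>
    simp only [realize_ball, hel, realize_term_num h]
    constructor
    · intro H a ha
      have := H _ (h.num_lt ha)
      rw [snoc_num] at this
      exact (ih _).1 this
    · intro H a ha
      obtain ⟨k, hk, rfl⟩ := h.lt_num ha
      rw [snoc_num]
      exact (ih _).2 (H k hk)
  | bex t _ ih =>
    simp only [realize_bex, hel, realize_term_num h]
    constructor
    · rintro ⟨a, ha, H⟩
      obtain ⟨k, hk, rfl⟩ := h.lt_num ha
      rw [snoc_num] at H
      exact ⟨k, hk, (ih _).1 H⟩
    · rintro ⟨k, hk, H⟩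
      exact ⟨_, h.num_lt hk, by rw [snoc_num]; exact (ih _).2 H⟩

theorem IsPi1.not_persistent {M : Type} [LA.Structure M] (h : IsPAm M) {γ : Type} {n : ℕ}
    {φ : LA.BoundedFormula γ n} (hφ : IsPi1 φ) (v : γ → ℕ) (xs : Fin n → ℕ)
    (H : ¬ φ.Realize v xs) : ¬ φ.Realize (fun i => num M (v i)) (fun i => num M (xs i)) := by
  induction hφ with
  | delta0 hφ => rwa [hφ.absolute h]
  | all _ ih =>
    rw [BoundedFormula.realize_all] at H ⊢
    push Not at H
    obtain ⟨a, ha⟩ := H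
    intro H'
    exact ih _ ha (by rw [← snoc_num]; exact H' _)

/-- A `Σ₂` formula is equivalent in `ℕ` to the existence of a number with a property whose negation
is persistent: the block of existential quantifiers is coded by a single number. -/
theorem IsSigma2.exists_rel {n : ℕ} {φ : LA.BoundedFormula (Fin 1) n} (hφ : IsSigma2 φ) :
    ∃ R : ℕ → (ℕ → ℕ) → Prop, SRel (fun ρ => ¬ R (ρ 0) fun i => ρ (i + 1)) ∧
      ∀ ρ : ℕ → ℕ, φ.Realize (fun _ => ρ 0) (fun i => ρ (i + 1)) ↔ ∃ e, R e ρ := by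
  induction hφ with
  | @pi1 n φ hφ =>
    refine ⟨fun _ ρ => φ.Realize (fun _ => ρ 0) (fun i => ρ (i + 1)), ?_, fun ρ => by simp⟩
    have key : ∀ (M : Type) [LA.Structure M] (ρ : ℕ → M),
        (φ.toFormula.relabel (Sum.elim (fun _ => 1) fun i : Fin n => (i : ℕ) + 2)).not.Realize ρ ↔
          ¬ φ.Realize (fun _ => ρ 1) (fun i => ρ (i + 2)) := fun M _ ρ => by
      rw [Formula.realize_not, Formula.realize_relabel, BoundedFormula.realize_toFormula]
      exact Iff.rfl
    refine ⟨_, fun ρ => key ℕ ρ, fun M _ h ρ hρ => ?_⟩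
    rw [key]
    exact hφ.not_persistent h _ _ hρ
  | @ex n φ _ ih =>
    obtain ⟨R, hR, h⟩ := ih
    refine ⟨fun e ρ => ∃ a < e + 1, ∃ b < e + 1,
      Nat.pair a b = e ∧ R b (Function.update ρ (n + 1) a), ?_, fun ρ => ?_⟩
    · have hc := hR.comp fun i => ncons 0 (fun i => if i = n + 1 then 1 else i + 3) i
      have := SRel.ball (R := fun a ρ => ∀ b, b < ρ 0 + 1 → (¬ Nat.pair a b = ρ 0 ∨
          ¬ R b (Function.update (fun i => ρ (i + 1)) (n + 1) a))) ((DFun.var 0).add (.const 1))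
        (SRel.ball (R := fun b ρ => (¬ Nat.pair (ρ 0) b = ρ 1 ∨
          ¬ R b (Function.update (fun i => ρ (i + 2)) (n + 1) (ρ 0)))) ((DFun.var 1).add (.const 1))
          ((SRel.of_DRel (DRel.eq ((DFun.var 1).pair (.var 0)) (.var 2)).not).or ?_))
      · convert this using 1
        funext ρ
        push Not
        simp only [imp_iff_not_or, ne_eq]
      · convert hc using 1
        funext ρ
        congr 2
        funext i
        simp only [ncons_succ, Function.update_apply]
        split <;> rfl
    · rw [BoundedFormula.realize_ex]
      have key : ∀ a, φ.Realize (fun _ => ρ 0) (Fin.snoc (fun i : Fin n => ρ (i + 1)) a) ↔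
          ∃ e, R e (Function.update ρ (n + 1) a) := fun a => by
        rw [← h]
        refine iff_of_eq (congrArg₂ _ ?_ ?_)
        · funext; simp
        · funext i
          induction i using Fin.lastCases with
          | last => simp
          | cast i => simp [i.isLt.ne]
      simp only [key]
      constructor
      · rintro ⟨a, e, he⟩
        exact ⟨Nat.pair a e, a, Nat.lt_succ_of_le (Nat.left_le_pair a e), e,
          Nat.lt_succ_of_le (Nat.right_le_pair a e), rfl, he⟩
      · rintro ⟨_, a, -, b, -, -, hR⟩
        exact ⟨a, b, hR⟩

/-! ### Structures for the full language -/

/-- The arithmetical part of a structure for the full language. -/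
instance (priority := low) redStructure {M : Type} [LP.Structure M] : LA.Structure M :=
  incl.reduct M

instance (priority := low) redExpansion {M : Type} [LP.Structure M] : incl.IsExpansionOn M :=
  LHom.isExpansionOn_reduct incl M

section LPTerms

variable {α : Type}

/-- The term `0` of the full language. -/
def lpZero : LP.Term α := Term.func (L := LP) (Sum.inl ArithFunc.zero) ![]
/-- The term `1` of the full language. -/
def lpOne : LP.Term α := Term.func (L := LP) (Sum.inl ArithFunc.one) ![]
/-- The sum of two terms of the full language. -/
def lpAdd (s t : LP.Term α) : LP.Term α := Term.func (L := LP) (Sum.inl ArithFunc.add) ![s, t]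
/-- The product of two terms of the full language. -/
def lpMul (s t : LP.Term α) : LP.Term α := Term.func (L := LP) (Sum.inl ArithFunc.mul) ![s, t]

/-- Case analysis for terms of the full language. -/
@[elab_as_elim]
theorem LPTerm.induction {P : LP.Term α → Prop} (var : ∀ i, P (Term.var i)) (zero : P lpZero)
    (one : P lpOne) (add : ∀ s t, P s → P t → P (lpAdd s t))
    (mul : ∀ s t, P s → P t → P (lpMul s t)) (t : LP.Term α) : P t := by
  induction t with
  | var i => exact var i
  | func f ts ih =>
    rcases f with f | f
    · cases f with
      | zero => rw [Subsingleton.elim ts ![] ]; exact zero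
      | one => rw [Subsingleton.elim ts ![] ]; exact one
      | add => rw [vec2_eq ts]; exact add _ _ (ih 0) (ih 1)
      | mul => rw [vec2_eq ts]; exact mul _ _ (ih 0) (ih 1)
    · exact f.elim

variable {M : Type} [LP.Structure M] (v : α → M)

@[simp] theorem realize_lpZero : (lpZero : LP.Term α).realize v = ze := by
  change Structure.funMap (L := LP) _ _ = _
  rw [Subsingleton.elim (fun i => _) (![] : Fin 0 → M)]; rfl

@[simp] theorem realize_lpOne : (lpOne : LP.Term α).realize v = on := by
  change Structure.funMap (L := LP) _ _ = _
  rw [Subsingleton.elim (fun i => _) (![] : Fin 0 → M)]; rfl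

@[simp] theorem realize_lpAdd (s t : LP.Term α) :
    (lpAdd s t).realize v = ad (s.realize v) (t.realize v) := by
  change Structure.funMap (L := LP) _ _ = _
  rw [comp_vec2 (Term.realize v)]; rfl

@[simp] theorem realize_lpMul (s t : LP.Term α) :
    (lpMul s t).realize v = ml (s.realize v) (t.realize v) := by
  change Structure.funMap (L := LP) _ _ = _
  rw [comp_vec2 (Term.realize v)]; rfl

end LPTerms

/-- The truth value, at the first `l` entries of `u`, of the relation symbol of arity `l` whose
code is `P`; false if there is no such symbol. -/
def relAt {M : Type} [LP.Structure M] (P l : ℕ) (u : ℕ → M) : Prop :=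
  match P with
  | 0 => l = 2 ∧ ls (u 0) (u 1)
  | k + 1 => Structure.RelMap (L := LP) (n := l) (Sum.inr k) fun i => u i

/-! ### Codes and decoding -/

/-- The code of the constant `0`. -/
def zeroCode : ℕ := Nat.pair 1 (Nat.pair 0 0)
/-- The code of the constant `1`. -/
def oneCode : ℕ := Nat.pair 1 (Nat.pair 1 0)
/-- The code of the list with head `t` and tail coded by `l`. -/
def consCode (t l : ℕ) : ℕ := Nat.pair t l + 1
/-- The code of a sum. -/
def addCode (s t : ℕ) : ℕ := Nat.pair 1 (Nat.pair 2 (consCode s (consCode t 0)))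
/-- The code of a product. -/
def mulCode (s t : ℕ) : ℕ := Nat.pair 1 (Nat.pair 3 (consCode s (consCode t 0)))
/-- The code of an equation. -/
def eqCode (s t : ℕ) : ℕ := Nat.pair 1 (Nat.pair s t)
/-- The code of an atomic formula other than an equation. -/
def relCode (P l : ℕ) : ℕ := Nat.pair 2 (Nat.pair P l)
/-- The code of an implication. -/
def impCode (x y : ℕ) : ℕ := Nat.pair 3 (Nat.pair x y)
/-- The code of a universal quantification. -/
def allCode (x : ℕ) : ℕ := Nat.pair 4 x

theorem lt_pair_of_pos {a b c : ℕ} (ha : 0 < a) (hc : c ≤ b) : c < Nat.pair a b := by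
  have := Nat.add_le_pair a b
  omega

/-- The list coded by a number. -/
def decL (l : ℕ) : List ℕ := Denumerable.ofNat (List ℕ) l

@[simp] theorem decL_zero : decL 0 = [] := Denumerable.list_ofNat_zero

@[simp] theorem decL_consCode (t l : ℕ) : decL (consCode t l) = t :: decL l := by
  simp [decL, consCode]

theorem decL_codeTuple {l : ℕ} (v : Fin l → ℕ) : decL (codeTuple v) = List.ofFn v :=
  Denumerable.ofNat_encode _

/-- The term with `n` variables coded by a number; it is `0` at numbers that code no term. -/
def decT (n t : ℕ) : LP.Term (Empty ⊕ Fin n) :=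
  if t.unpair.1 = 0 then
    if hi : t.unpair.2 < n then Term.var (Sum.inr ⟨t.unpair.2, hi⟩) else lpZero
  else if t.unpair.2.unpair.1 = 0 then lpZero
  else if t.unpair.2.unpair.1 = 1 then lpOne
  else
    let s₁ := (t.unpair.2.unpair.2 - 1).unpair.1
    let s₂ := ((t.unpair.2.unpair.2 - 1).unpair.2 - 1).unpair.1
    if t.unpair.2.unpair.1 = 2 then lpAdd (decT n s₁) (decT n s₂)
    else lpMul (decT n s₁) (decT n s₂)
termination_by t
decreasing_by
  all_goals
    have h1 : t.unpair.2 < t := by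
      conv_rhs => rw [← Nat.pair_unpair t]
      exact lt_pair_of_pos (by omega) le_rfl
    have h2 := Nat.unpair_right_le t.unpair.2
    have h3 := Nat.unpair_left_le (t.unpair.2.unpair.2 - 1)
    have h4 := Nat.unpair_right_le (t.unpair.2.unpair.2 - 1)
    have h5 := Nat.unpair_left_le ((t.unpair.2.unpair.2 - 1).unpair.2 - 1)
    omega

/-- The atomic formula with relation symbol coded by `P` and arguments coded by the entries of a
list; it is `⊥` if there is no such symbol. -/
def decR (n P : ℕ) (l : List ℕ) : LP.BoundedFormula Empty n :=
  match P with
  | 0 => if l.length = 2 then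
      BoundedFormula.rel (L := LP) (l := 2) (Sum.inl ArithRel.lt)
        ![decT n (l.getD 0 0), decT n (l.getD 1 0)]
      else ⊥
  | k + 1 => BoundedFormula.rel (L := LP) (l := l.length) (Sum.inr k) fun i => decT n (l.get i)

/-- The formula with `n` free variables coded by a number; it is `⊥` at numbers that code no
formula. -/
def dec (n x : ℕ) : LP.BoundedFormula Empty n :=
  if x.unpair.1 = 1 then .equal (decT n x.unpair.2.unpair.1) (decT n x.unpair.2.unpair.2)
  else if x.unpair.1 = 2 then decR n x.unpair.2.unpair.1 (decL x.unpair.2.unpair.2)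
  else if x.unpair.1 = 3 then .imp (dec n x.unpair.2.unpair.1) (dec n x.unpair.2.unpair.2)
  else if x.unpair.1 = 4 then .all (dec (n + 1) x.unpair.2)
  else .falsum
termination_by x
decreasing_by
  all_goals
    have h1 : x.unpair.2 < x := by
      conv_rhs => rw [← Nat.pair_unpair x]
      exact lt_pair_of_pos (by omega) le_rfl
    have h2 := Nat.unpair_left_le x.unpair.2
    have h3 := Nat.unpair_right_le x.unpair.2
    omega

section Sat

variable {M : Type} (S : LP.Structure M)

/-- The value in the structure `S` of the term coded by `t`, under the assignment `a`. -/
def tval (n t : ℕ) (a : ℕ → M) : M := (decT n t).realize (Sum.elim default fun i : Fin n => a i)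

/-- Satisfaction in the structure `S` of the formula coded by `x`, under the assignment `a`. -/
def sat (n x : ℕ) (a : ℕ → M) : Prop := (dec n x).Realize default fun i : Fin n => a i

variable {n : ℕ} (a b : ℕ → M)

theorem tval_var {i : ℕ} (hi : i < n) : tval S n (Nat.pair 0 i) a = a i := by
  rw [tval, decT]; simp [hi]

theorem tval_zero : tval S n zeroCode a = ze := by
  rw [tval, decT]; simp [zeroCode]

theorem tval_one : tval S n oneCode a = on := by
  rw [tval, decT]; simp [oneCode]

theorem tval_add (s t : ℕ) : tval S n (addCode s t) a = ad (tval S n s a) (tval S n t a) := by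
  rw [tval, decT]; simp [addCode, consCode, tval]

theorem tval_mul (s t : ℕ) : tval S n (mulCode s t) a = ml (tval S n s a) (tval S n t a) := by
  rw [tval, decT]; simp [mulCode, consCode, tval]

theorem sat_bot : ¬ sat S n 0 a := by
  rw [sat, dec]; simp [BoundedFormula.Realize]

theorem sat_eq (s t : ℕ) : sat S n (eqCode s t) a ↔ tval S n s a = tval S n t a := by
  rw [sat, dec]; simp [eqCode, BoundedFormula.Realize, tval]

theorem sat_imp (x y : ℕ) : sat S n (impCode x y) a ↔ (sat S n x a → sat S n y a) := by
  rw [sat, dec]; simp [impCode, sat]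

theorem sat_all (x : ℕ) :
    sat S n (allCode x) a ↔ ∀ d, sat S (n + 1) x (Function.update a n d) := by
  rw [sat, dec]
  simp only [allCode, Nat.unpair_pair, sat]
  simp only [OfNat.ofNat_ne_one, if_false, Nat.reduceEqDiff, if_true]
  refine forall_congr' fun d => iff_of_eq (congrArg _ ?_)
  funext i
  induction i using Fin.lastCases with
  | last => simp
  | cast i => simp [i.isLt.ne]

theorem sat_congr (x : ℕ) {a b : ℕ → M} (h : ∀ i < n, a i = b i) : sat S n x a ↔ sat S n x b := by
  rw [sat, sat, show (fun i : Fin n => a i) = fun i : Fin n => b i from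
    funext fun i => h i i.isLt]

theorem sat_rel (P L : ℕ) (u : ℕ → M) (hu : ∀ j (h : j < (decL L).length),
    tval S n (decL L)[j] a = u j) : sat S n (relCode P L) a ↔ relAt P (decL L).length u := by
  rw [sat, dec]
  simp only [relCode, Nat.unpair_pair, OfNat.ofNat_ne_one, if_false, if_true]
  rcases P with - | k
  · rw [decR, relAt]
    split
    · rename_i h
      have h0 := hu 0 (by omega)
      have h1 := hu 1 (by omega)
      change Structure.RelMap (L := LP) _ _ ↔ _
      rw [comp_vec2 (Term.realize _)]
      rw [List.getD_eq_getElem _ _ (by omega), List.getD_eq_getElem _ _ (by omega)]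
      rw [tval] at h0 h1
      rw [h0, h1]
      simp only [h, true_and]
      exact Iff.rfl
    · rename_i h
      simp [h]
  · rw [decR, relAt]
    change Structure.RelMap (L := LP) _ _ ↔ _
    refine iff_of_eq (congrArg _ (funext fun i => ?_))
    exact hu i i.isLt

theorem codeTerm_func {l : ℕ} (f : LP.Functions l) (ts : Fin l → LP.Term (Empty ⊕ Fin n)) :
    codeTerm (Term.func f ts) =
      Nat.pair 1 (Nat.pair (codeFunc f) (codeTuple fun i => codeTerm (ts i))) := by
  rw [codeTerm]

theorem codeTerm_lpAdd (s t : LP.Term (Empty ⊕ Fin n)) :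
    codeTerm (lpAdd s t) = addCode (codeTerm s) (codeTerm t) := by
  refine (codeTerm_func _ _).trans ?_
  simp [codeFunc, codeTuple, List.ofFn_succ, addCode, consCode]

theorem codeTerm_lpMul (s t : LP.Term (Empty ⊕ Fin n)) :
    codeTerm (lpMul s t) = mulCode (codeTerm s) (codeTerm t) := by
  refine (codeTerm_func _ _).trans ?_
  simp [codeFunc, codeTuple, List.ofFn_succ, mulCode, consCode]

theorem codeTerm_lpZero : codeTerm (lpZero : LP.Term (Empty ⊕ Fin n)) = zeroCode := by
  refine (codeTerm_func _ _).trans ?_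
  simp [codeFunc, codeTuple, zeroCode]

theorem codeTerm_lpOne : codeTerm (lpOne : LP.Term (Empty ⊕ Fin n)) = oneCode := by
  refine (codeTerm_func _ _).trans ?_
  simp [codeFunc, codeTuple, oneCode]

theorem tval_code (t : LP.Term (Empty ⊕ Fin n)) :
    tval S n (codeTerm t) a = t.realize (Sum.elim default fun i : Fin n => a i) := by
  induction t using LPTerm.induction with
  | var i =>
    rcases i with i | i
    · exact i.elim
    · rw [codeTerm, tval_var S a i.isLt]; rfl
  | zero => rw [codeTerm_lpZero, tval_zero, realize_lpZero]
  | one => rw [codeTerm_lpOne, tval_one, realize_lpOne]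
  | add s t h1 h2 => rw [codeTerm_lpAdd, tval_add, realize_lpAdd, h1, h2]
  | mul s t h1 h2 => rw [codeTerm_lpMul, tval_mul, realize_lpMul, h1, h2]

theorem sat_code (φ : LP.BoundedFormula Empty n) :
    sat S n (codeFormula φ) a ↔ φ.Realize default fun i : Fin n => a i := by
  induction φ generalizing a with
  | falsum => exact iff_of_false (sat_bot S a) (by simp [BoundedFormula.Realize])
  | equal s t =>
    rw [show codeFormula (.equal s t) = eqCode (codeTerm s) (codeTerm t) by rw [codeFormula]; rfl,
      sat_eq, tval_code, tval_code]
    rfl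
  | @rel n l R ts =>
    rw [show codeFormula (.rel R ts) = relCode (codeRel R) (codeTuple fun i => codeTerm (ts i)) by
      rw [codeFormula]; rfl]
    have hl := decL_codeTuple fun i => codeTerm (ts i)
    have hlen : (decL (codeTuple fun i => codeTerm (ts i))).length = l := by
      rw [hl, List.length_ofFn]
    rw [sat_rel S a _ _ (fun j => if h : j < l then (ts ⟨j, h⟩).realize
      (Sum.elim default fun i : Fin n => a i) else a 0) ?_, hlen]
    · rcases R with R | k
      · cases R
        rw [codeRel, relAt]
        change (2 = 2 ∧ ls _ _) ↔ Structure.RelMap (L := LP) _ _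
        rw [vec2_eq fun i => Term.realize _ _]
        simp only [true_and]
        exact Iff.rfl
      · change Structure.RelMap (L := LP) _ _ ↔ Structure.RelMap (L := LP) _ _
        simp only [Fin.is_lt, dite_true, Fin.eta]
    · intro j hj
      have hj' : j < l := by rwa [hlen] at hj
      simp only [hl, List.getElem_ofFn, hj', dite_true]
      exact tval_code S a _
  | imp φ ψ h1 h2 =>
    rw [show codeFormula (.imp φ ψ) = impCode (codeFormula φ) (codeFormula ψ) by
      rw [codeFormula]; rfl, sat_imp, h1, h2]
    rfl
  | @all n φ ih =>
    rw [show codeFormula (.all φ) = allCode (codeFormula φ) by rw [codeFormula]; rfl, sat_all,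
      BoundedFormula.realize_all]
    refine forall_congr' fun d => (ih _).trans (iff_of_eq (congrArg _ ?_))
    funext i
    induction i using Fin.lastCases with
    | last => simp
    | cast i => simp [i.isLt.ne]

end Sat

/-! ### Henkin valuations -/

/-- Every finite sequence is coded by a number, by means of Gödel's `β` function. -/
theorem exists_beta (f : ℕ → ℕ) (n : ℕ) : ∃ s, ∀ i < n, Nat.beta s i = f i := by
  refine ⟨Nat.unbeta ((List.range n).map f), fun i hi => ?_⟩
  have := Nat.beta_unbeta_coe ((List.range n).map f) ⟨i, by simpa using hi⟩
  simpa using this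

theorem beta_le (s i : ℕ) : Nat.beta s i ≤ s :=
  (Nat.mod_le _ _).trans (Nat.unpair_left_le s)

/-- The tuples coded by `s` and `u` have the same first `n` entries. -/
def Agree (n s u : ℕ) : Prop := ∀ i, i < n → Nat.beta s i = Nat.beta u i

/-- The index of the interpretation of `0`. -/
def ixZero : ℕ := Nat.pair 0 0
/-- The index of the interpretation of `1`. -/
def ixOne : ℕ := Nat.pair 1 0
/-- The index of the sum of the elements with indices `a` and `b`. -/
def ixAdd (a b : ℕ) : ℕ := Nat.pair 2 (Nat.pair a b)
/-- The index of the product of the elements with indices `a` and `b`. -/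
def ixMul (a b : ℕ) : ℕ := Nat.pair 3 (Nat.pair a b)
/-- The index of the interpretation of the numeral `j`. -/
def ixNum (j : ℕ) : ℕ := Nat.pair 4 j
/-- The index of a counterexample, if there is one, to the universal closure in the variable `n`
of the formula coded by `x`, under the assignment coded by `s`, in the sense `μ` of truth. -/
def ixWit (μ n x s : ℕ) : ℕ := Nat.pair 5 (Nat.pair μ (Nat.pair n (Nat.pair x s)))

section Bits

variable (v : ℕ → Prop)

/-- The formula coded by `x` is true under the assignment `s`: for `μ = 0` in the structure itself,
and for `μ = 1` in the structure whose predicates are given by a translation. -/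
def bTrue (μ n x s : ℕ) : Prop := v (Nat.pair 0 (Nat.pair μ (Nat.pair n (Nat.pair x s))))
/-- The element with index `a` is the value of the term coded by `t` under the assignment `s`. -/
def bVal (n t s a : ℕ) : Prop := v (Nat.pair 1 (Nat.pair n (Nat.pair t (Nat.pair s a))))
/-- The values of the terms in the list coded by `L` under the assignment `s` are the entries of
`u` with numbers `i, ..., l - 1`. -/
def bList (n L s i u l : ℕ) : Prop :=
  v (Nat.pair 2 (Nat.pair n (Nat.pair L (Nat.pair s (Nat.pair i (Nat.pair u l))))))
/-- The relation symbol of arity `l` with code `P` holds of the first `l` entries of `u`. -/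
def bRel (P l u : ℕ) : Prop := v (Nat.pair 3 (Nat.pair P (Nat.pair l u)))
/-- The elements with indices `a` and `b` are equal. -/
def bEq (a b : ℕ) : Prop := v (Nat.pair 4 (Nat.pair a b))

/-- The conditions, for one choice of the parameters `μ, n, x, y, s, r, i, l, u`, on a valuation
`v` that describes a structure, with elements indexed by numbers, and its image under the
translation coded by `t`. The formula coded by `k` is true of the numeral `k` in the structure, and
the sentence coded by `b` is false in its image. -/
structure Clause (k b t μ n x y s r i l u : ℕ) : Prop where
  eq_refl : bEq v x x
  eq_symm : bEq v x y → bEq v y x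
  eq_trans : bEq v x y → bEq v y s → bEq v x s
  add_congr : bEq v x y → bEq v s r → bEq v (ixAdd x s) (ixAdd y r)
  mul_congr : bEq v x y → bEq v s r → bEq v (ixMul x s) (ixMul y r)
  rel_congr : (∀ j, j < l → bEq v (Nat.beta u j) (Nat.beta s j)) → bRel v x l u → bRel v x l s
  num_zero : bEq v (ixNum 0) ixZero
  num_succ : bEq v (ixNum (n + 1)) (ixAdd (ixNum n) ixOne)
  val_var : i < n → bVal v n (Nat.pair 0 i) s (Nat.beta s i)
  val_zero : bVal v n zeroCode s ixZero
  val_one : bVal v n oneCode s ixOne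
  val_add : bVal v n x s i → bVal v n y s l → bVal v n (addCode x y) s (ixAdd i l)
  val_mul : bVal v n x s i → bVal v n y s l → bVal v n (mulCode x y) s (ixMul i l)
  list_nil : bList v n 0 s l u l
  list_cons : bVal v n x s (Nat.beta u i) → bList v n y s (i + 1) u l →
    bList v n (consCode x y) s i u l
  bot : ¬ bTrue v μ n 0 s
  imp : bTrue v μ n (impCode x y) s ↔ (bTrue v μ n x s → bTrue v μ n y s)
  all_elim : Agree n s u → bTrue v μ n (allCode x) s → bTrue v μ (n + 1) x u
  all_intro : Agree n s u → Nat.beta u n = ixWit μ n x s → bTrue v μ (n + 1) x u →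
    bTrue v μ n (allCode x) s
  eq : bVal v n x s i → bVal v n y s l → (bTrue v μ n (eqCode x y) s ↔ bEq v i l)
  lt : bList v n y s 0 u l → (bTrue v μ n (relCode 0 y) s ↔ bRel v 0 l u)
  rel : bList v n y s 0 u l → (bTrue v 0 n (relCode (x + 1) y) s ↔ bRel v (x + 1) l u)
  rel_image : bList v n y s 0 u l → (bTrue v 1 n (relCode (x + 1) y) s ↔
    bTrue v 0 l (Nat.beta t (Nat.pair l x)) u)
  code_true : Nat.beta s 0 = ixNum k → bTrue v 0 1 k s
  code_false : ¬ bTrue v 1 0 b s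

/-- The conditions as one conjunction, to which closure properties can be applied part by part. -/
theorem clause_iff (k b t μ n x y s r i l u : ℕ) : Clause v k b t μ n x y s r i l u ↔
  bEq v x x ∧
    (bEq v x y → bEq v y x) ∧
    (bEq v x y → bEq v y s → bEq v x s) ∧
    (bEq v x y → bEq v s r → bEq v (ixAdd x s) (ixAdd y r)) ∧
    (bEq v x y → bEq v s r → bEq v (ixMul x s) (ixMul y r)) ∧
    ((∀ j, j < l → bEq v (Nat.beta u j) (Nat.beta s j)) → bRel v x l u → bRel v x l s) ∧
    bEq v (ixNum 0) ixZero ∧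
    bEq v (ixNum (n + 1)) (ixAdd (ixNum n) ixOne) ∧
    (i < n → bVal v n (Nat.pair 0 i) s (Nat.beta s i)) ∧
    bVal v n zeroCode s ixZero ∧
    bVal v n oneCode s ixOne ∧
    (bVal v n x s i → bVal v n y s l → bVal v n (addCode x y) s (ixAdd i l)) ∧
    (bVal v n x s i → bVal v n y s l → bVal v n (mulCode x y) s (ixMul i l)) ∧
    bList v n 0 s l u l ∧
    (bVal v n x s (Nat.beta u i) → bList v n y s (i + 1) u l →
      bList v n (consCode x y) s i u l) ∧
    (¬ bTrue v μ n 0 s) ∧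
    (bTrue v μ n (impCode x y) s ↔ (bTrue v μ n x s → bTrue v μ n y s)) ∧
    (Agree n s u → bTrue v μ n (allCode x) s → bTrue v μ (n + 1) x u) ∧
    (Agree n s u → Nat.beta u n = ixWit μ n x s → bTrue v μ (n + 1) x u →
      bTrue v μ n (allCode x) s) ∧
    (bVal v n x s i → bVal v n y s l → (bTrue v μ n (eqCode x y) s ↔ bEq v i l)) ∧
    (bList v n y s 0 u l → (bTrue v μ n (relCode 0 y) s ↔ bRel v 0 l u)) ∧
    (bList v n y s 0 u l → (bTrue v 0 n (relCode (x + 1) y) s ↔ bRel v (x + 1) l u)) ∧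
    (bList v n y s 0 u l →
      (bTrue v 1 n (relCode (x + 1) y) s ↔ bTrue v 0 l (Nat.beta t (Nat.pair l x)) u)) ∧
    (Nat.beta s 0 = ixNum k → bTrue v 0 1 k s) ∧
    (¬ bTrue v 1 0 b s) :=
  ⟨fun h => ⟨h.1, h.2, h.3, h.4, h.5, h.6, h.7, h.8, h.9, h.10, h.11, h.12, h.13,
    h.14, h.15, h.16, h.17, h.18, h.19, h.20, h.21, h.22, h.23, h.24, h.25⟩,
  fun ⟨h1, h2, h3, h4, h5, h6, h7, h8, h9, h10, h11, h12, h13,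
    h14, h15, h16, h17, h18, h19, h20, h21, h22, h23, h24, h25⟩ =>
    ⟨h1, h2, h3, h4, h5, h6, h7, h8, h9, h10, h11, h12, h13,
      h14, h15, h16, h17, h18, h19, h20, h21, h22, h23, h24, h25⟩⟩

/-- The valuation `v` satisfies all the conditions. -/
def IsVal (k b t : ℕ) : Prop := ∀ μ n x y s r i l u, Clause v k b t μ n x y s r i l u

end Bits

/-- The set of numbers coded by `c` satisfies the conditions with parameters below `N`. -/
def Approx (N c k b t : ℕ) : Prop :=
  ∀ μ, μ < N → ∀ n, n < N → ∀ x, x < N → ∀ y, y < N → ∀ s, s < N → ∀ r, r < N →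
    ∀ i, i < N → ∀ l, l < N → ∀ u, u < N →
      Clause (fun q => Nat.beta c q = 0) k b t μ n x y s r i l u

theorem dRel_approx : DRel fun ρ => Approx (ρ 0) (ρ 1) (ρ 2) (ρ 3) (ρ 4) := by
  simp only [Approx, clause_iff, bTrue, bVal, bList, bRel, bEq, Agree, ixZero, ixOne, ixAdd, ixMul,
    ixNum, ixWit, zeroCode, oneCode, consCode, addCode, mulCode, eqCode, relCode, impCode, allCode]
  repeat'
    beta_reduce
    first
    | with_reducible exact DFun.var _
    | with_reducible exact DFun.const _
    | with_reducible apply DFun.beta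
    | with_reducible apply DFun.pair
    | with_reducible apply DFun.add
    | with_reducible apply DRel.and
    | with_reducible apply DRel.iff
    | with_reducible apply DRel.not
    | with_reducible apply DRel.ball
    | with_reducible apply DRel.imp
    | with_reducible apply DRel.eq
    | with_reducible apply DRel.lt

/-! ### Compactness -/

/-- A condition on sets of numbers that depends on finitely many numbers only. -/
def FinDep (Φ : (ℕ → Prop) → Prop) : Prop :=
  ∃ K, ∀ v w : ℕ → Prop, (∀ q < K, v q ↔ w q) → (Φ v ↔ Φ w)

namespace FinDep

variable {Φ Ψ : (ℕ → Prop) → Prop}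

theorem atom (q : ℕ) : FinDep fun v => v q := ⟨q + 1, fun _ _ h => h q (Nat.lt_succ_self q)⟩

theorem const (p : Prop) : FinDep fun _ => p := ⟨0, fun _ _ _ => Iff.rfl⟩

theorem imp : FinDep Φ → FinDep Ψ → FinDep fun v => Φ v → Ψ v := by
  rintro ⟨K, hK⟩ ⟨J, hJ⟩
  refine ⟨max K J, fun v w h => ?_⟩
  beta_reduce
  rw [hK v w fun q hq => h q (lt_max_of_lt_left hq), hJ v w fun q hq => h q (lt_max_of_lt_right hq)]

theorem not (h : FinDep Φ) : FinDep fun v => ¬ Φ v := h.imp (const False)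

theorem and : FinDep Φ → FinDep Ψ → FinDep fun v => Φ v ∧ Ψ v := by
  rintro ⟨K, hK⟩ ⟨J, hJ⟩
  refine ⟨max K J, fun v w h => ?_⟩
  beta_reduce
  rw [hK v w fun q hq => h q (lt_max_of_lt_left hq), hJ v w fun q hq => h q (lt_max_of_lt_right hq)]

theorem iff (h : FinDep Φ) (h' : FinDep Ψ) : FinDep fun v => (Φ v ↔ Ψ v) := by
  have := (h.imp h').and (h'.imp h)
  simpa only [← iff_iff_implies_and_implies] using this

theorem ball {Φ : ℕ → (ℕ → Prop) → Prop} (N : ℕ) (h : ∀ a, FinDep (Φ a)) :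
    FinDep fun v => ∀ a, a < N → Φ a v := by
  induction N with
  | zero => exact ⟨0, fun v w _ => by simp⟩
  | succ N ih =>
    have := ih.and (h N)
    convert this using 2 with v
    exact Nat.forall_lt_succ_right

end FinDep

/-- Each condition on a valuation depends on finitely many of its values, since quantifiers in
formulas are described by witnesses. -/
theorem finDep_clause (k b t μ n x y s r i l u : ℕ) :
    FinDep fun v => Clause v k b t μ n x y s r i l u := by
  simp only [clause_iff, bTrue, bVal, bList, bRel, bEq]
  repeat'
    intros
    first
    | exact FinDep.const _
    | exact FinDep.atom _
    | apply FinDep.and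
    | apply FinDep.iff
    | apply FinDep.not
    | apply FinDep.ball
    | apply FinDep.imp

/-- A valuation can be cut off to a finite set of numbers, with a code. -/
theorem exists_approx {v : ℕ → Prop} {k b t : ℕ} (h : IsVal v k b t) (N : ℕ) :
    ∃ c, Approx N c k b t := by
  classical
  have hd : FinDep fun w => ∀ μ, μ < N → ∀ n, n < N → ∀ x, x < N → ∀ y, y < N → ∀ s, s < N →
    ∀ r, r < N → ∀ i, i < N → ∀ l, l < N → ∀ u, u < N →
      Clause w k b t μ n x y s r i l u := by
    repeat refine FinDep.ball N fun _ => ?_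
    exact finDep_clause _ _ _ _ _ _ _ _ _ _ _ _
  obtain ⟨K, hK⟩ := hd
  obtain ⟨c, hc⟩ := exists_beta (fun q => if v q then 0 else 1) K
  refine ⟨c, (hK v _ fun q hq => ?_).1
    fun μ _ n _ x _ y _ s _ r _ i _ l _ u _ => h μ n x y s r i l u⟩
  rw [hc q hq]
  split <;> simp [*]

/-- The limit of approximations along a nonprincipal ultrafilter is a valuation. -/
theorem exists_isVal {k b t : ℕ} (h : ∀ N, ∃ c, Approx N c k b t) : ∃ v, IsVal v k b t := by
  choose c hc using h
  let U : Ultrafilter ℕ := Filter.hyperfilter ℕ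
  let v : ℕ → Prop := fun q => ∀ᶠ N in U, Nat.beta (c N) q = 0
  refine ⟨v, fun μ n x y s r i l u => ?_⟩
  obtain ⟨K, hK⟩ := finDep_clause k b t μ n x y s r i l u
  have h1 : ∀ q, ∀ᶠ N in U, (v q ↔ Nat.beta (c N) q = 0) := by
    intro q
    by_cases hq : v q
    · exact Filter.Eventually.mono hq fun N hN => iff_of_true hq hN
    · exact (Ultrafilter.eventually_not.2 hq).mono fun N hN => iff_of_false hq hN
  have h2 : ∀ᶠ N in U, ∀ q ∈ Finset.range K, (v q ↔ Nat.beta (c N) q = 0) :=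
    (Filter.eventually_all_finset _).2 fun q _ => h1 q
  have h3 : ∀ᶠ N in (U : Filter ℕ), μ + n + x + y + s + r + i + l + u < N :=
    Filter.Eventually.filter_mono (Nat.hyperfilter_le_atTop) (Filter.eventually_gt_atTop _)
  obtain ⟨N, h4, h5⟩ := (h2.and h3).exists
  refine (hK v _ fun q hq => h4 q (Finset.mem_range.2 hq)).2 ?_
  apply hc N <;> omega

/-! ### Translations -/

theorem Translation.realize_apply_rel {M : Type} [LP.Structure M] (τ : Translation) {γ : Type}
    {n l : ℕ} (P : predLang.Relations l) (ts : Fin l → LP.Term (γ ⊕ Fin n)) (w : γ → M)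
    (xs : Fin n → M) :
    (τ.apply (BoundedFormula.rel (L := LP) (Sum.inr P) ts)).Realize w xs ↔
      (τ l P).Realize fun i => (ts i).realize (Sum.elim w xs) := by
  rw [Translation.apply]
  refine (BoundedFormula.realize_relabel (n := 0) (m := n)).trans ?_
  rw [BoundedFormula.realize_subst, Formula.Realize,
    Subsingleton.elim (xs ∘ Fin.natAdd n : Fin 0 → M) default]
  exact Iff.rfl

/-- The identity translation. -/
def idTranslation : Translation := fun _ P =>
  Relations.formula (L := LP) (Sum.inr P) fun i => Term.var i

theorem realize_idTranslation {M : Type} [LP.Structure M] {l : ℕ} (P : predLang.Relations l)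
    (xs : Fin l → M) :
    (idTranslation l P).Realize xs ↔ Structure.RelMap (L := LP) (Sum.inr P) xs :=
  Formula.realize_rel (L := LP)

theorem realize_idTranslation_apply {M : Type} [LP.Structure M] {γ : Type} {n : ℕ}
    (φ : LP.BoundedFormula γ n) (w : γ → M) (xs : Fin n → M) :
    (idTranslation.apply φ).Realize w xs ↔ φ.Realize w xs := by
  induction φ with
  | falsum => exact Iff.rfl
  | equal s t => exact Iff.rfl
  | rel R ts =>
    rcases R with R | P
    · exact Iff.rfl
    · rw [Translation.realize_apply_rel, realize_idTranslation]; exact Iff.rfl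
  | imp φ ψ h1 h2 => exact imp_congr (h1 xs) (h2 xs)
  | all φ ih => exact forall_congr' fun a => ih _

/-- A formula with free variables indexed by `Fin l`, as a formula in the scope of `l`
quantifiers. -/
def toBdd {L : FirstOrder.Language.{0, 0}} {l : ℕ} (φ : L.Formula (Fin l)) :
    L.BoundedFormula Empty l :=
  (BoundedFormula.relabel (Sum.inr : Fin l → Empty ⊕ Fin l) φ : L.BoundedFormula Empty (l + 0))

theorem realize_toBdd {L : FirstOrder.Language.{0, 0}} {M : Type} [L.Structure M] {l : ℕ}
    (φ : L.Formula (Fin l)) (w : Empty → M) (xs : Fin l → M) :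
    (toBdd φ).Realize w xs ↔ φ.Realize xs :=
  Formula.realize_relabel_sumInr φ

/-- A bound for the (codes of the) predicate symbols that occur in a formula. -/
def symBound : ∀ {n : ℕ}, LP.BoundedFormula Empty n → ℕ
  | _, .falsum => 0
  | _, .equal _ _ => 0
  | _, .rel (Sum.inl _) _ => 0
  | _, .rel (l := l) (Sum.inr P) _ => Nat.pair l P + 1
  | _, .imp φ ψ => max (symBound φ) (symBound ψ)
  | _, .all φ => symBound φ

/-- The entry number `n` of a coded tuple can be replaced by a given one. -/
theorem exists_snoc {n s : ℕ} (c : ℕ) : ∃ u, Agree n s u ∧ Nat.beta u n = c := by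
  obtain ⟨u, hu⟩ := exists_beta (fun i => if i < n then Nat.beta s i else c) (n + 1)
  refine ⟨u, fun i hi => ?_, ?_⟩
  · rw [hu i (by omega), if_pos hi]
  · rw [hu n (by omega), if_neg (lt_irrefl n)]

/-! ### The structure described by a valuation -/

section TermModel

variable {v : ℕ → Prop} {k b t : ℕ}

namespace IsVal

variable (h : IsVal v k b t)
include h

theorem eq_refl (a : ℕ) : bEq v a a := (h 0 0 a 0 0 0 0 0 0).eq_refl
theorem eq_symm {a c : ℕ} : bEq v a c → bEq v c a := (h 0 0 a c 0 0 0 0 0).eq_symm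
theorem eq_trans {a c d : ℕ} : bEq v a c → bEq v c d → bEq v a d := (h 0 0 a c d 0 0 0 0).eq_trans

/-- The setoid of indices of equal elements. -/
def setoid : Setoid ℕ := ⟨bEq v, h.eq_refl, h.eq_symm, h.eq_trans⟩

/-- The universe of the structure described by a valuation. -/
def Dom : Type := Quotient h.setoid

/-- The element with a given index. -/
def el (a : ℕ) : h.Dom := Quotient.mk h.setoid a

theorem el_eq {a c : ℕ} : h.el a = h.el c ↔ bEq v a c := Quotient.eq (r := h.setoid)

theorem exists_el (d : h.Dom) : ∃ a, h.el a = d := Quotient.exists_rep d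

/-- The structure described by a valuation. -/
instance domStructure : LP.Structure h.Dom where
  funMap := fun f xs =>
    match f, xs with
    | Sum.inl .zero, _ => h.el ixZero
    | Sum.inl .one, _ => h.el ixOne
    | Sum.inl .add, xs => Quotient.map₂ (sa := h.setoid) (sb := h.setoid) (sc := h.setoid) ixAdd
        (fun a c h1 d e h2 => (h 0 0 a c d e 0 0 0).add_congr h1 h2) (xs 0) (xs 1)
    | Sum.inl .mul, xs => Quotient.map₂ (sa := h.setoid) (sb := h.setoid) (sc := h.setoid) ixMul
        (fun a c h1 d e h2 => (h 0 0 a c d e 0 0 0).mul_congr h1 h2) (xs 0) (xs 1)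
  RelMap := fun {n} R xs => ∃ u, (∀ i : Fin n, h.el (Nat.beta u i) = xs i) ∧ bRel v (codeRel R) n u

theorem el_zero : (ze : h.Dom) = h.el ixZero := rfl
theorem el_one : (on : h.Dom) = h.el ixOne := rfl
theorem el_add (a c : ℕ) : ad (h.el a) (h.el c) = h.el (ixAdd a c) := rfl

theorem el_num (j : ℕ) : num h.Dom j = h.el (ixNum j) := by
  induction j with
  | zero =>
    have h1 := (h 0 0 0 0 0 0 0 0 0).num_zero
    exact (h.el_zero).trans (h.el_eq.2 h1).symm
  | succ j ih =>
    have h1 := (h 0 j 0 0 0 0 0 0 0).num_succ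
    rw [num, ih, el_one, el_add]
    exact (h.el_eq.2 h1).symm

theorem relMap_iff {l : ℕ} (R : LP.Relations l) (u : ℕ) :
    Structure.RelMap R (fun i : Fin l => h.el (Nat.beta u i)) ↔ bRel v (codeRel R) l u := by
  constructor
  · rintro ⟨s, h1, h2⟩
    have h3 := (h 0 0 (codeRel R) 0 u 0 0 l s).rel_congr
    exact h3 (fun j hj => h.el_eq.1 (h1 ⟨j, hj⟩)) h2
  · exact fun h1 => ⟨u, fun _ => rfl, h1⟩

theorem exists_val {n : ℕ} (r : LP.Term (Empty ⊕ Fin n)) (s : ℕ) :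
    ∃ a, bVal v n (codeTerm r) s a ∧
      h.el a = r.realize (Sum.elim default fun i : Fin n => h.el (Nat.beta s i)) := by
  induction r using LPTerm.induction with
  | var i =>
    rcases i with i | i
    · exact i.elim
    · have h1 := (h 0 n 0 0 s 0 i 0 0).val_var
      rw [codeTerm]
      exact ⟨_, h1 i.isLt, rfl⟩
  | zero =>
    have h1 := (h 0 n 0 0 s 0 0 0 0).val_zero
    rw [codeTerm_lpZero, realize_lpZero]
    exact ⟨_, h1, rfl⟩
  | one =>
    have h1 := (h 0 n 0 0 s 0 0 0 0).val_one
    rw [codeTerm_lpOne, realize_lpOne]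
    exact ⟨_, h1, rfl⟩
  | add r₁ r₂ ih1 ih2 =>
    obtain ⟨a, h1, h2⟩ := ih1
    obtain ⟨c, h3, h4⟩ := ih2
    have h5 := (h 0 n (codeTerm r₁) (codeTerm r₂) s 0 a c 0).val_add
    rw [codeTerm_lpAdd, realize_lpAdd, ← h2, ← h4]
    exact ⟨_, h5 h1 h3, rfl⟩
  | mul r₁ r₂ ih1 ih2 =>
    obtain ⟨a, h1, h2⟩ := ih1
    obtain ⟨c, h3, h4⟩ := ih2
    have h5 := (h 0 n (codeTerm r₁) (codeTerm r₂) s 0 a c 0).val_mul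
    rw [codeTerm_lpMul, realize_lpMul, ← h2, ← h4]
    exact ⟨_, h5 h1 h3, rfl⟩

theorem list_val {n s u l : ℕ} (L : List ℕ) (i : ℕ) (hi : i + L.length = l)
    (hL : ∀ j (hj : j < L.length), bVal v n L[j] s (Nat.beta u (i + j))) :
    bList v n (Encodable.encode L) s i u l := by
  induction L generalizing i with
  | nil =>
    have h1 := (h 0 n 0 0 s 0 0 l u).list_nil
    obtain rfl : i = l := hi
    exact h1
  | cons a L ih =>
    have h1 := (h 0 n a (Encodable.encode L) s 0 i l u).list_cons
    refine h1 (hL 0 (by simp)) (ih (i + 1) (by simp at hi; omega) fun j hj => ?_)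
    have := hL (j + 1) (by simpa using hj)
    rwa [List.getElem_cons_succ, ← Nat.add_assoc, Nat.add_right_comm] at this

theorem exists_list {n l : ℕ} (ts : Fin l → LP.Term (Empty ⊕ Fin n)) (s : ℕ) :
    ∃ u, bList v n (codeTuple fun i => codeTerm (ts i)) s 0 u l ∧
      ∀ i, (ts i).realize (Sum.elim default fun i : Fin n => h.el (Nat.beta s i)) =
        h.el (Nat.beta u i) := by
  choose a h1 h2 using fun i => h.exists_val (ts i) s
  obtain ⟨u, hu⟩ := exists_beta (fun i => if hi : i < l then a ⟨i, hi⟩ else 0) l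
  have hu' : ∀ i : Fin l, Nat.beta u i = a i := fun i => by rw [hu i i.isLt]; simp
  refine ⟨u, h.list_val _ 0 (by simp) fun j hj => ?_, fun i => by rw [hu', h2]⟩
  have hj' : j < l := by simpa using hj
  rw [List.getElem_ofFn, Nat.zero_add]
  have := h1 ⟨j, hj'⟩
  rwa [← hu' ⟨j, hj'⟩] at this

/-- The truth lemma: the formulas that the valuation makes true are those whose translations hold,
provided this is so for atomic formulas. -/
theorem true_iff_of_rel (μ K : ℕ) (τ : Translation)
    (hτ : ∀ l j, Nat.pair l j < K → ∀ n L s u, bList v n L s 0 u l →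
      (bTrue v μ n (relCode (j + 1) L) s ↔
        (τ l j).Realize fun i : Fin l => h.el (Nat.beta u i)))
    {n : ℕ} (φ : LP.BoundedFormula Empty n) (hφ : symBound φ ≤ K) (s : ℕ) :
    bTrue v μ n (codeFormula φ) s ↔
      (τ.apply φ).Realize default fun i : Fin n => h.el (Nat.beta s i) := by
  induction φ generalizing s with
  | @falsum n =>
    have h1 := (h μ n 0 0 s 0 0 0 0).bot
    exact iff_of_false h1 id
  | @equal n r₁ r₂ =>
    obtain ⟨a, h1, h2⟩ := h.exists_val r₁ s
    obtain ⟨c, h3, h4⟩ := h.exists_val r₂ s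
    have h5 := (h μ n (codeTerm r₁) (codeTerm r₂) s 0 a c 0).eq
    rw [codeFormula]
    refine (h5 h1 h3).trans ?_
    rw [← h.el_eq, h2, h4]
    exact Iff.rfl
  | @rel n l R ts =>
    obtain ⟨u, h1, h2⟩ := h.exists_list ts s
    rw [codeFormula]
    rcases R with R | P
    · cases R
      have h5 := (h μ n 0 (codeTuple fun i => codeTerm (ts i)) s 0 0 2 u).lt
      refine (h5 h1).trans ?_
      refine (h.relMap_iff (Sum.inl ArithRel.lt : LP.Relations 2) u).symm.trans ?_
      simp only [← h2]
      exact Iff.rfl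
    · rw [Translation.realize_apply_rel]
      simp only [h2]
      exact hτ l P (Nat.lt_of_lt_of_le (Nat.lt_succ_self _) hφ) n _ s u h1
  | @imp n φ ψ ih1 ih2 =>
    have h1 := (h μ n (codeFormula φ) (codeFormula ψ) s 0 0 0 0).imp
    rw [codeFormula]
    refine h1.trans ?_
    rw [ih1 ((le_max_left _ _).trans hφ), ih2 ((le_max_right _ _).trans hφ)]
    exact Iff.rfl
  | @all n φ ih =>
    have ih' := fun u => ih hφ u
    rw [codeFormula]
    have hs : ∀ u, Agree n s u → (fun i : Fin (n + 1) => h.el (Nat.beta u i)) =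
        Fin.snoc (fun i : Fin n => h.el (Nat.beta s i)) (h.el (Nat.beta u n)) := fun u hu => by
      funext i
      induction i using Fin.lastCases with
      | last => simp
      | cast i => simp [hu i i.isLt]
    have h1 := fun u => h μ n (codeFormula φ) 0 s 0 0 0 u
    change bTrue v μ n (allCode (codeFormula φ)) s ↔ ∀ a, (τ.apply φ).Realize _ _
    constructor
    · intro H d
      obtain ⟨c, rfl⟩ := h.exists_el d
      obtain ⟨u, hu, rfl⟩ := exists_snoc (n := n) (s := s) c
      rw [← hs u hu, ← ih' u]
      exact (h1 u).all_elim hu H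
    · intro H
      obtain ⟨u, hu, h2⟩ := exists_snoc (n := n) (s := s) (ixWit μ n (codeFormula φ) s)
      refine (h1 u).all_intro hu h2 ?_
      rw [ih' u, hs u hu]
      exact H _

theorem true_iff {n : ℕ} (φ : LP.BoundedFormula Empty n) (s : ℕ) :
    bTrue v 0 n (codeFormula φ) s ↔ φ.Realize default fun i : Fin n => h.el (Nat.beta s i) := by
  rw [← realize_idTranslation_apply φ]
  refine h.true_iff_of_rel 0 (symBound φ) idTranslation (fun l j _ n L s u hu => ?_) φ le_rfl s
  have h5 := (h 0 n j L s 0 0 l u).rel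
  exact (h5 hu).trans ((h.relMap_iff (Sum.inr j : LP.Relations l) u).symm.trans
    (realize_idTranslation (l := l) j _).symm)

/-- In the structure described by the valuation, the formula with code `k` is true of `k`. -/
theorem realize_of_code {φ : LP.BoundedFormula Empty 1} (hφ : codeFormula φ = k) :
    φ.Realize default fun _ => num h.Dom k := by
  obtain ⟨s, hs⟩ := exists_beta (fun _ => ixNum k) 1
  have h0 := hs 0 Nat.one_pos
  have h5 := (h 0 0 0 0 s 0 0 0 0).code_true
  have h6 := h5 h0
  rw [← hφ, h.true_iff] at h6
  convert h6 using 2 with i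
  rw [Subsingleton.elim i 0, h.el_num]
  exact congrArg h.el h0.symm

/-- If `t` codes the translation `τ` of the symbols that occur in the sentence with code `b`, then
the translation of that sentence is false in the structure described by the valuation. -/
theorem not_realize_apply {σ : LP.Sentence} (hσ : godel σ = b) (τ : Translation)
    (hτ : ∀ l j, Nat.pair l j < symBound σ →
      Nat.beta t (Nat.pair l j) = codeFormula (toBdd (τ l j))) :
    ¬ (τ.apply σ).Realize default (default : Fin 0 → h.Dom) := by
  have h5 := (h 0 0 0 0 0 0 0 0 0).code_false
  intro H
  refine h5 ?_
  rw [← hσ]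
  refine (h.true_iff_of_rel 1 (symBound σ) τ (fun l j hj n L s u hu => ?_) σ le_rfl 0).2 ?_
  · have h5 := (h 0 n j L s 0 0 l u).rel_image
    rw [h5 hu, hτ l j hj, h.true_iff, realize_toBdd]
  · rw [Subsingleton.elim (fun i : Fin 0 => _) default]
    exact H

end IsVal

end TermModel

/-! ### The valuation of a structure -/

section Image

variable {M : Type} (S : LP.Structure M) (t : ℕ)

/-- The image of a structure under the translation coded by `t`: the predicate symbol number `j` of
arity `l` is interpreted by the formula with code `Nat.beta t (Nat.pair l j)`. -/
@[reducible] def image : LP.Structure M where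
  funMap := fun f xs => S.funMap f xs
  RelMap := fun {l} R xs =>
    match R with
    | Sum.inl R => S.RelMap (Sum.inl R) xs
    | Sum.inr j => (dec l (Nat.beta t (Nat.pair l j))).Realize default xs

/-- The structure itself, for `μ = 0`, and its image under a translation. -/
@[reducible] def fam : ℕ → LP.Structure M
  | 0 => S
  | _ + 1 => image S t

theorem fam_zero : fam S t 0 = S := rfl

theorem fam_ls (μ : ℕ) (a b : M) :
    @ls M (@redStructure M (fam S t μ)) a b ↔ @ls M (@redStructure M S) a b := by
  cases μ <;> exact Iff.rfl

theorem relAt_zero (l : ℕ) (a : ℕ → M) : relAt 0 l a ↔ l = 2 ∧ ls (a 0) (a 1) := Iff.rfl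

theorem relAt_image (j l : ℕ) (a : ℕ → M) :
    @relAt M (image S t) (j + 1) l a ↔ sat S l (Nat.beta t (Nat.pair l j)) a := Iff.rfl

theorem realize_fam {α : Type} (r : LP.Term α) (w : α → M) (μ : ℕ) :
    @Term.realize LP M (fam S t μ) α w r = r.realize w := by
  cases μ with
  | zero => rfl
  | succ μ =>
    induction r with
    | var i => rfl
    | func f ts ih =>
      change S.funMap f _ = S.funMap f _
      congr 1
      funext i
      exact ih i

theorem tval_fam (μ n r : ℕ) (a : ℕ → M) : tval (fam S t μ) n r a = tval S n r a :=
  realize_fam S t _ _ μ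

/-- The element of a structure with a given index. For the index of a counterexample, it is chosen
by `Classical.epsilon`; the assignment refers to elements with smaller indices. -/
noncomputable def elem (e : ℕ) : M :=
  if e.unpair.1 = 0 then ze
  else if e.unpair.1 = 1 then on
  else if e.unpair.1 = 2 then ad (elem e.unpair.2.unpair.1) (elem e.unpair.2.unpair.2)
  else if e.unpair.1 = 3 then ml (elem e.unpair.2.unpair.1) (elem e.unpair.2.unpair.2)
  else if e.unpair.1 = 4 then num M e.unpair.2
  else
    let μ := e.unpair.2.unpair.1
    let n := e.unpair.2.unpair.2.unpair.1
    let x := e.unpair.2.unpair.2.unpair.2.unpair.1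
    let s := e.unpair.2.unpair.2.unpair.2.unpair.2
    @Classical.epsilon M ⟨ze⟩ fun d => ¬ sat (fam S t μ) (n + 1) x
      (Function.update (fun i => elem (Nat.beta s i)) n d)
termination_by e
decreasing_by
  all_goals
    have h1 : e.unpair.2 < e := by
      conv_rhs => rw [← Nat.pair_unpair e]
      exact lt_pair_of_pos (by omega) le_rfl
    have h2 := Nat.unpair_left_le e.unpair.2
    have h3 := Nat.unpair_right_le e.unpair.2
    have h4 := Nat.unpair_right_le e.unpair.2.unpair.2
    have h5 := Nat.unpair_right_le e.unpair.2.unpair.2.unpair.2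
    first
    | omega
    | exact lt_of_le_of_lt (beta_le _ _) (by omega)

theorem elem_zero : elem S t ixZero = ze := by rw [elem]; simp [ixZero]
theorem elem_one : elem S t ixOne = on := by rw [elem]; simp [ixOne]
theorem elem_add (a b : ℕ) : elem S t (ixAdd a b) = ad (elem S t a) (elem S t b) := by
  rw [elem]; simp [ixAdd]
theorem elem_mul (a b : ℕ) : elem S t (ixMul a b) = ml (elem S t a) (elem S t b) := by
  rw [elem]; simp [ixMul]
theorem elem_num (j : ℕ) : elem S t (ixNum j) = num M j := by rw [elem]; simp [ixNum]

/-- The assignment coded by `s`. -/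
noncomputable def asg (s i : ℕ) : M := elem S t (Nat.beta s i)

/-- The element with the index of a counterexample is one, if there is any. -/
theorem sat_all_of_wit {μ n x s : ℕ}
    (h : sat (fam S t μ) (n + 1) x
      (Function.update (asg S t s) n (elem S t (ixWit μ n x s)))) :
    sat (fam S t μ) n (allCode x) (asg S t s) := by
  rw [sat_all]
  by_contra hd
  push Not at hd
  have : Nonempty M := ⟨ze⟩
  refine Classical.epsilon_spec hd ?_
  have key : elem S t (ixWit μ n x s) = @Classical.epsilon M ⟨ze⟩ fun d =>
      ¬ sat (fam S t μ) (n + 1) x (Function.update (asg S t s) n d) := by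
    rw [elem]; simp [ixWit]; rfl
  rw [key] at h
  exact h

/-- The valuation of a structure, that is, the set of the numbers that express true facts about it
in the coding used for the conditions on valuations. -/
def valOf (q : ℕ) : Prop :=
  let p := q.unpair.2
  let p' := p.unpair.2
  let p'' := p'.unpair.2
  match q.unpair.1 with
  | 0 => sat (fam S t p.unpair.1) p'.unpair.1 p''.unpair.1 (asg S t p''.unpair.2)
  | 1 => tval S p.unpair.1 p'.unpair.1 (asg S t p''.unpair.1) = elem S t p''.unpair.2
  | 2 =>
    let i := p''.unpair.2.unpair.1
    let u := p''.unpair.2.unpair.2.unpair.1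
    let l := p''.unpair.2.unpair.2.unpair.2
    i + (decL p'.unpair.1).length = l ∧ ∀ j (h : j < (decL p'.unpair.1).length),
      tval S p.unpair.1 (decL p'.unpair.1)[j] (asg S t p''.unpair.1) = asg S t u (i + j)
  | 3 => relAt p.unpair.1 p'.unpair.1 (asg S t p'.unpair.2)
  | _ => elem S t p.unpair.1 = elem S t p.unpair.2

theorem bTrue_valOf (μ n x s : ℕ) :
    bTrue (valOf S t) μ n x s ↔ sat (fam S t μ) n x (asg S t s) := by
  simp [bTrue, valOf]

theorem bVal_valOf (n r s a : ℕ) :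
    bVal (valOf S t) n r s a ↔ tval S n r (asg S t s) = elem S t a := by
  simp [bVal, valOf]

theorem bList_valOf (n L s i u l : ℕ) : bList (valOf S t) n L s i u l ↔
    i + (decL L).length = l ∧ ∀ j (h : j < (decL L).length),
      tval S n (decL L)[j] (asg S t s) = asg S t u (i + j) := by
  simp [bList, valOf]

theorem bRel_valOf (P l u : ℕ) : bRel (valOf S t) P l u ↔ relAt P l (asg S t u) := by
  simp [bRel, valOf]

theorem bEq_valOf (a b : ℕ) : bEq (valOf S t) a b ↔ elem S t a = elem S t b := by
  simp [bEq, valOf]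

attribute [irreducible] valOf

theorem relAt_congr (P l : ℕ) {a b : ℕ → M} (h : ∀ i < l, a i = b i) :
    relAt P l a ↔ relAt P l b := by
  cases P with
  | zero =>
    refine and_congr_right fun hl => ?_
    subst hl
    rw [h 0 (by omega), h 1 (by omega)]
  | succ j =>
    rw [relAt, relAt, show (fun i : Fin l => a i) = fun i : Fin l => b i from
      funext fun i => h i i.isLt]

theorem sat_rel_fam {μ n L s u l : ℕ} (P : ℕ) (h : bList (valOf S t) n L s 0 u l) :
    sat (fam S t μ) n (relCode P L) (asg S t s) ↔
      @relAt M (fam S t μ) P l (asg S t u) := by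
  rw [bList_valOf, Nat.zero_add] at h
  obtain ⟨rfl, h⟩ := h
  exact sat_rel _ _ P L _ fun j hj => by rw [tval_fam, h j hj, Nat.zero_add]

/-- The valuation of a structure satisfies the conditions if the formula with code `k` is true of
`k` in the structure and the sentence with code `b` is false in its image. -/
theorem isVal_valOf {k b : ℕ} (hk : sat S 1 k fun _ => num M k)
    (hb : ∀ a, ¬ sat (image S t) 0 b a) : IsVal (valOf S t) k b t := by
  intro μ n x y s r i l u
  have hup : ∀ {n s u : ℕ}, Agree n s u → ∀ j < n + 1,
      asg S t u j = Function.update (asg S t s) n (asg S t u n) j := by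
    intro n s u hsu j hj
    rcases Nat.lt_succ_iff_lt_or_eq.1 hj with h1 | rfl
    · rw [Function.update_of_ne h1.ne, asg, asg, hsu j h1]
    · rw [Function.update_self]
  refine ⟨?_, ?_, ?_, ?_, ?_, ?_, ?_, ?_, ?_, ?_, ?_, ?_, ?_, ?_, ?_, ?_, ?_, ?_, ?_, ?_, ?_, ?_,
    ?_, ?_, ?_⟩
  · rw [bEq_valOf]
  · simp only [bEq_valOf]; exact Eq.symm
  · simp only [bEq_valOf]; exact Eq.trans
  · simp only [bEq_valOf, elem_add]; intro h1 h2; rw [h1, h2]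
  · simp only [bEq_valOf, elem_mul]; intro h1 h2; rw [h1, h2]
  · simp only [bEq_valOf, bRel_valOf]
    exact fun h1 => (relAt_congr S x l h1).1
  · rw [bEq_valOf, elem_num, elem_zero]; rfl
  · rw [bEq_valOf, elem_num, elem_add, elem_num, elem_one]; rfl
  · intro h1
    rw [bVal_valOf, tval_var S _ h1]; rfl
  · rw [bVal_valOf, tval_zero, elem_zero]
  · rw [bVal_valOf, tval_one, elem_one]
  · simp only [bVal_valOf, tval_add, elem_add]; intro h1 h2; rw [h1, h2]
  · simp only [bVal_valOf, tval_mul, elem_mul]; intro h1 h2; rw [h1, h2]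
  · rw [bList_valOf]; simp
  · simp only [bVal_valOf, bList_valOf, decL_consCode, List.length_cons]
    rintro h1 ⟨h2, h3⟩
    refine ⟨by omega, fun j hj => ?_⟩
    cases j with
    | zero => exact h1
    | succ j =>
      rw [List.getElem_cons_succ, h3 j (by omega), show i + (j + 1) = i + 1 + j by omega]
  · rw [bTrue_valOf]; exact sat_bot _ _
  · simp only [bTrue_valOf]; exact sat_imp _ _ _ _
  · simp only [bTrue_valOf]
    intro h1 h2
    rw [sat_congr _ _ (hup h1)]
    exact (sat_all _ _ x).1 h2 _
  · simp only [bTrue_valOf]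
    intro h1 h2 h3
    rw [sat_congr _ _ (hup h1), asg, h2] at h3
    exact sat_all_of_wit S t h3
  · simp only [bVal_valOf, bTrue_valOf, bEq_valOf, sat_eq, tval_fam]
    intro h1 h2
    rw [h1, h2]
  · intro h1
    rw [bTrue_valOf, bRel_valOf, sat_rel_fam S t 0 h1]
    rw [relAt_zero, relAt_zero, fam_ls]
  · intro h1
    rw [bTrue_valOf, bRel_valOf, sat_rel_fam S t _ h1, fam_zero]
  · intro h1
    rw [bTrue_valOf, bTrue_valOf]
    exact (sat_rel_fam S t (μ := 1) (x + 1) h1).trans (relAt_image S t x l _)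
  · intro h1
    rw [bTrue_valOf]
    refine (sat_congr S k fun j hj => ?_).1 hk
    obtain rfl : j = 0 := by omega
    rw [asg, h1, elem_num]
  · rw [bTrue_valOf]
    exact hb _

end Image

/-! ### Formulas defined uniformly in all structures -/

/-- A property of environments in structures for the full language that is expressed by a
formula. -/
def UDef (P : ∀ (M : Type) [LP.Structure M], (ℕ → M) → Prop) : Prop :=
  ∃ φ : LP.Formula ℕ, ∀ (M : Type) [LP.Structure M] (ρ : ℕ → M), φ.Realize ρ ↔ P M ρ

/-- The environment with entries `a`, `b`, `c`, `c`, .... -/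
def env3 {M : Type} (a b c : M) : ℕ → M := ncons a (ncons b fun _ => c)

theorem env3_apply {M : Type} (ρ : ℕ → M) (i j k : ℕ) :
    (fun m => ρ (env3 i j k m)) = env3 (ρ i) (ρ j) (ρ k) := by
  rw [env3, comp_ncons, comp_ncons]; rfl

theorem num_env3 {M : Type} [LA.Structure M] (i j k : ℕ) :
    (fun m => num M (env3 i j k m)) = env3 (num M i) (num M j) (num M k) := by
  rw [env3, comp_ncons, comp_ncons]; rfl

/-- The function `f` has an absolute graph. -/
def BinCode (f : ℕ → ℕ → ℕ) : Prop := DRel fun ρ => ρ 0 = f (ρ 1) (ρ 2)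

/-- In the sense of an arithmetical structure, `c = f a b`. -/
def IsCode {f : ℕ → ℕ → ℕ} (hf : BinCode f) {M : Type} [LA.Structure M] (c a b : M) : Prop :=
  (Classical.choose hf).Realize (env3 c a b)

theorem isCode_num {f : ℕ → ℕ → ℕ} (hf : BinCode f) {M : Type} [LA.Structure M] (h : IsPAm M)
    (c a b : ℕ) : IsCode hf (num M c) (num M a) (num M b) ↔ c = f a b := by
  rw [IsCode, ← num_env3]
  exact Classical.choose_spec hf M h _

theorem isCode_nat {f : ℕ → ℕ → ℕ} (hf : BinCode f) (c a b : ℕ) :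
    IsCode hf c a b ↔ c = f a b := by
  have := isCode_num hf nat_isPAm c a b
  rwa [nat_num, nat_num, nat_num] at this

/-- The truth predicate: the formula coded by `x`, with `n` free variables, is true under the
assignment coded by `s`. -/
def TrP {M : Type} [LP.Structure M] (n x s : M) : Prop :=
  Structure.RelMap (L := LP) (n := 3) (Sum.inr (0 : ℕ)) ![n, x, s]

/-- The value predicate: `a` is the value of the term coded by `x`, with `n` free variables, under
the assignment coded by `s`. -/
def VaP {M : Type} [LP.Structure M] (n x s a : M) : Prop :=
  Structure.RelMap (L := LP) (n := 4) (Sum.inr (0 : ℕ)) ![n, x, s, a]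

/-- The entry number `i` of the tuple coded by `s` is `a`. -/
def EnP {M : Type} [LP.Structure M] (s i a : M) : Prop :=
  Structure.RelMap (L := LP) (n := 3) (Sum.inr (1 : ℕ)) ![s, i, a]

/-- The tuples coded by `s` and `r` have the same entries with numbers below `n`. -/
def AgP {M : Type} [LP.Structure M] (n s r : M) : Prop :=
  ∀ i, ls i n → ∀ a, EnP s i a ↔ EnP r i a

namespace UDef

variable {P Q : ∀ (M : Type) [LP.Structure M], (ℕ → M) → Prop}

theorem of_iff (hP : UDef P) (h : ∀ (M : Type) [LP.Structure M] (ρ : ℕ → M), Q M ρ ↔ P M ρ) :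
    UDef Q := by
  obtain ⟨φ, hφ⟩ := hP
  exact ⟨φ, fun M _ ρ => by rw [hφ, h]⟩

theorem not (hP : UDef P) : UDef fun M _ ρ => ¬ P M ρ := by
  obtain ⟨φ, hφ⟩ := hP
  exact ⟨φ.not, fun M _ ρ => by rw [Formula.realize_not, hφ]⟩

theorem imp (hP : UDef P) (hQ : UDef Q) : UDef fun M _ ρ => P M ρ → Q M ρ := by
  obtain ⟨φ, hφ⟩ := hP
  obtain ⟨ψ, hψ⟩ := hQ
  exact ⟨φ.imp ψ, fun M _ ρ => by rw [Formula.realize_imp, hφ, hψ]⟩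

theorem and (hP : UDef P) (hQ : UDef Q) : UDef fun M _ ρ => P M ρ ∧ Q M ρ := by
  obtain ⟨φ, hφ⟩ := hP
  obtain ⟨ψ, hψ⟩ := hQ
  exact ⟨φ ⊓ ψ, fun M _ ρ => by rw [Formula.realize_inf, hφ, hψ]⟩

theorem iff (hP : UDef P) (hQ : UDef Q) : UDef fun M _ ρ => (P M ρ ↔ Q M ρ) := by
  obtain ⟨φ, hφ⟩ := hP
  obtain ⟨ψ, hψ⟩ := hQ
  exact ⟨φ.iff ψ, fun M _ ρ => by rw [Formula.realize_iff, hφ, hψ]⟩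

theorem all {R : ∀ (M : Type) [LP.Structure M], M → (ℕ → M) → Prop}
    (hR : UDef fun M _ ρ => R M (ρ 0) fun i => ρ (i + 1)) :
    UDef fun M _ ρ => ∀ a, R M a ρ := by
  obtain ⟨φ, hφ⟩ := hR
  exact ⟨allH φ, fun M _ ρ => by simp only [realize_allH, hφ]; exact Iff.rfl⟩

theorem ex {R : ∀ (M : Type) [LP.Structure M], M → (ℕ → M) → Prop}
    (hR : UDef fun M _ ρ => R M (ρ 0) fun i => ρ (i + 1)) :
    UDef fun M _ ρ => ∃ a, R M a ρ := by
  obtain ⟨φ, hφ⟩ := hR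
  exact ⟨exH φ, fun M _ ρ => by simp only [realize_exH, hφ]; exact Iff.rfl⟩

theorem la (φ : LA.Formula ℕ) (g : ℕ → ℕ) :
    UDef fun _ _ ρ => φ.Realize fun i => ρ (g i) :=
  ⟨incl.onFormula (φ.relabel g), fun M _ ρ => by
    rw [LHom.realize_onFormula, Formula.realize_relabel]; rfl⟩

theorem isCode {f : ℕ → ℕ → ℕ} (hf : BinCode f) (i j k : ℕ) :
    UDef fun _ _ ρ => IsCode hf (ρ i) (ρ j) (ρ k) :=
  (la (Classical.choose hf) (env3 i j k)).of_iff fun M _ ρ => by rw [env3_apply]; rfl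

theorem eq (i j : ℕ) : UDef fun _ _ ρ => ρ i = ρ j :=
  (la ((Term.var 0).equal (Term.var 1)) (env3 i j j)).of_iff fun M _ ρ => by
    rw [env3_apply, Formula.realize_equal]; rfl

theorem eq_ze (i : ℕ) : UDef fun _ _ ρ => ρ i = ze :=
  (la ((Term.var 0).equal 0) (env3 i i i)).of_iff fun M _ ρ => by
    rw [env3_apply, Formula.realize_equal, realize_zero]; rfl

theorem eq_on (i : ℕ) : UDef fun _ _ ρ => ρ i = on :=
  (la ((Term.var 0).equal 1) (env3 i i i)).of_iff fun M _ ρ => by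
    rw [env3_apply, Formula.realize_equal, realize_one]; rfl

theorem eq_ad (i j k : ℕ) : UDef fun _ _ ρ => ρ i = ad (ρ j) (ρ k) :=
  (la ((Term.var 0).equal (Term.var 1 + Term.var 2)) (env3 i j k)).of_iff fun M _ ρ => by
    rw [env3_apply, Formula.realize_equal, realize_add]; rfl

theorem eq_ml (i j k : ℕ) : UDef fun _ _ ρ => ρ i = ml (ρ j) (ρ k) :=
  (la ((Term.var 0).equal (Term.var 1 * Term.var 2)) (env3 i j k)).of_iff fun M _ ρ => by
    rw [env3_apply, Formula.realize_equal, realize_mul]; rfl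

theorem eq_ad_on (i j : ℕ) : UDef fun _ _ ρ => ρ i = ad (ρ j) on :=
  (la ((Term.var 0).equal (Term.var 1 + 1)) (env3 i j j)).of_iff fun M _ ρ => by
    rw [env3_apply, Formula.realize_equal, realize_add, realize_one]; rfl

theorem ls (i j : ℕ) : UDef fun _ _ ρ => ls (ρ i) (ρ j) :=
  (la (ltN (Term.var 0) (Term.var 1)) (env3 i j j)).of_iff fun M _ ρ => by
    rw [env3_apply, realize_ltN]; rfl

theorem pred {l : ℕ} (P : predLang.Relations l) (g : Fin l → ℕ) :
    UDef fun _ _ ρ => Structure.RelMap (L := LP) (Sum.inr P) fun i => ρ (g i) :=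
  ⟨Relations.formula (L := LP) (Sum.inr P) fun i => Term.var (g i), fun _ _ _ =>
    Formula.realize_rel (L := LP)⟩

theorem trP (i j k : ℕ) : UDef fun _ _ ρ => TrP (ρ i) (ρ j) (ρ k) :=
  (pred (l := 3) (0 : ℕ) ![i, j, k]).of_iff fun M _ ρ => by
    rw [show (fun m => ρ (![i, j, k] m)) = ![ρ i, ρ j, ρ k] from by
      funext m; fin_cases m <;> rfl]
    rfl

theorem vaP (i j k m : ℕ) : UDef fun _ _ ρ => VaP (ρ i) (ρ j) (ρ k) (ρ m) :=
  (pred (l := 4) (0 : ℕ) ![i, j, k, m]).of_iff fun M _ ρ => by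
    rw [show (fun q => ρ (![i, j, k, m] q)) = ![ρ i, ρ j, ρ k, ρ m] from by
      funext q; fin_cases q <;> rfl]
    rfl

theorem enP (i j k : ℕ) : UDef fun _ _ ρ => EnP (ρ i) (ρ j) (ρ k) :=
  (pred (l := 3) (1 : ℕ) ![i, j, k]).of_iff fun M _ ρ => by
    rw [show (fun m => ρ (![i, j, k] m)) = ![ρ i, ρ j, ρ k] from by
      funext m; fin_cases m <;> rfl]
    rfl

theorem sentences {S : Set LA.Sentence} (hS : S.Finite) :
    UDef fun M _ _ => ∀ σ ∈ S, M ⊨ σ := by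
  induction S, hS using Set.Finite.induction_on with
  | empty => exact (eq 0 0).of_iff fun M _ ρ => by simp
  | @insert σ S _ _ ih =>
    have : UDef fun M _ _ => M ⊨ σ :=
      ⟨incl.onFormula (σ.relabel Empty.elim), fun M _ ρ => by
        rw [LHom.realize_onFormula, Formula.realize_relabel,
          Subsingleton.elim (ρ ∘ Empty.elim) default]
        exact Iff.rfl⟩
    exact (this.and ih).of_iff fun M _ ρ => Set.forall_mem_insert

end UDef

/-! ### The graphs of the operations on codes -/

theorem binCode_var : BinCode fun i _ => Nat.pair 0 i :=
  DRel.eq (.var 0) ((DFun.const 0).pair (.var 1))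
theorem binCode_zero : BinCode fun _ _ => zeroCode := DRel.eq (.var 0) (.const _)
theorem binCode_one : BinCode fun _ _ => oneCode := DRel.eq (.var 0) (.const _)

theorem binCode_args (k : ℕ) : DFun fun ρ =>
    Nat.pair k (consCode (ρ 1) (consCode (ρ 2) 0)) :=
  (DFun.const k).pair (((DFun.var 1).pair (((DFun.var 2).pair (.const 0)).add (.const 1))).add
    (.const 1))

theorem binCode_add : BinCode addCode := DRel.eq (.var 0) ((DFun.const 1).pair (binCode_args 2))
theorem binCode_mul : BinCode mulCode := DRel.eq (.var 0) ((DFun.const 1).pair (binCode_args 3))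
theorem binCode_eq : BinCode eqCode :=
  DRel.eq (.var 0) ((DFun.const 1).pair ((DFun.var 1).pair (.var 2)))

/-- The code of an inequality. -/
def ltCode (s t : ℕ) : ℕ := relCode 0 (consCode s (consCode t 0))

theorem binCode_lt : BinCode ltCode := DRel.eq (.var 0) ((DFun.const 2).pair (binCode_args 0))
theorem binCode_imp : BinCode impCode :=
  DRel.eq (.var 0) ((DFun.const 3).pair ((DFun.var 1).pair (.var 2)))
theorem binCode_all : BinCode fun x _ => allCode x :=
  DRel.eq (.var 0) ((DFun.const 4).pair (.var 1))

/-! ### The guarded theory of truth -/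

/-- The axioms of arithmetical truth, where the formula `g` with parameter `y` says for which `n`
and `x` the truth predicate is required to be correct about the formula (or term) with `n` free
variables that is coded by `x`. The induction axiom is not guarded. -/
structure Gam (g : LA.Formula ℕ) (M : Type) [LP.Structure M] (y : M) : Prop where
  pa : ∀ σ ∈ PAminus, M ⊨ σ
  exp : ∀ σ ∈ ({expTotal} : Set LA.Sentence), M ⊨ σ
  en_ex : ∀ s i : M, ∃ a, EnP s i a
  en_unique : ∀ s i a b : M, EnP s i a → EnP s i b → a = b
  en_ext : ∀ s n a : M, ∃ r, EnP r n a ∧ AgP n s r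
  var : ∀ n t i s : M, g.Realize (env3 y n t) → IsCode binCode_var t i i → ls i n →
    ∀ a, VaP n t s a ↔ EnP s i a
  zero : ∀ n t s : M, g.Realize (env3 y n t) → IsCode binCode_zero t t t →
    ∀ a, VaP n t s a ↔ a = ze
  one : ∀ n t s : M, g.Realize (env3 y n t) → IsCode binCode_one t t t →
    ∀ a, VaP n t s a ↔ a = on
  add : ∀ n t t₁ t₂ s : M, g.Realize (env3 y n t) → IsCode binCode_add t t₁ t₂ →
    ∀ a, VaP n t s a ↔ ∃ b, ∃ c, VaP n t₁ s b ∧ VaP n t₂ s c ∧ a = ad b c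
  mul : ∀ n t t₁ t₂ s : M, g.Realize (env3 y n t) → IsCode binCode_mul t t₁ t₂ →
    ∀ a, VaP n t s a ↔ ∃ b, ∃ c, VaP n t₁ s b ∧ VaP n t₂ s c ∧ a = ml b c
  bot : ∀ n x s : M, g.Realize (env3 y n x) → x = ze → ¬ TrP n x s
  eq : ∀ n x t₁ t₂ s : M, g.Realize (env3 y n x) → IsCode binCode_eq x t₁ t₂ →
    (TrP n x s ↔ ∃ a, VaP n t₁ s a ∧ VaP n t₂ s a)
  lt : ∀ n x t₁ t₂ s : M, g.Realize (env3 y n x) → IsCode binCode_lt x t₁ t₂ →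
    (TrP n x s ↔ ∃ a, ∃ b, VaP n t₁ s a ∧ VaP n t₂ s b ∧ ls a b)
  imp : ∀ n x x₁ x₂ s : M, g.Realize (env3 y n x) → IsCode binCode_imp x x₁ x₂ →
    (TrP n x s ↔ (TrP n x₁ s → TrP n x₂ s))
  all : ∀ n n' x x' s : M, n' = ad n on → g.Realize (env3 y n x) → IsCode binCode_all x x' x' →
    (TrP n x s ↔ ∀ r, AgP n s r → TrP n' x' r)
  ind : ∀ n n' z x s : M, n' = ad n on → z = ze →
    (∀ r, AgP n s r → EnP r n z → TrP n' x r) →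
    (∀ a, ∀ a', a' = ad a on → (∀ r, AgP n s r → EnP r n a → TrP n' x r) →
      (∀ r, AgP n s r → EnP r n a' → TrP n' x r)) →
    ∀ a, (∀ r, AgP n s r → EnP r n a → TrP n' x r)

/-- The guarded theory of truth is finitely axiomatised. -/
theorem uDef_gam (g : LA.Formula ℕ) : UDef fun M _ ρ => Gam g M (ρ 0) := by
  have hg : ∀ i j k, UDef fun M _ ρ => g.Realize (env3 (ρ i) (ρ j) (ρ k)) := fun i j k =>
    (UDef.la g (env3 i j k)).of_iff fun M _ ρ => by rw [env3_apply]
  have hag : ∀ i j k, UDef fun M _ ρ => AgP (ρ i) (ρ j) (ρ k) := fun i j k =>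
    UDef.all (UDef.imp (UDef.ls 0 (i + 1)) (UDef.all
      (UDef.iff (UDef.enP (j + 2) 1 0) (UDef.enP (k + 2) 1 0))))
  have hpa : UDef fun M _ _ => ∀ σ ∈ PAminus, M ⊨ σ :=
    UDef.sentences (by unfold PAminus; exact Set.toFinite _)
  have hexp : UDef fun M _ _ => ∀ σ ∈ ({expTotal} : Set LA.Sentence), M ⊨ σ :=
    UDef.sentences (Set.finite_singleton _)
  have key : ∀ (M : Type) [LP.Structure M] (ρ : ℕ → M), Gam g M (ρ 0) ↔ _ := fun M _ ρ =>
    ⟨fun h => And.intro h.1 <| And.intro h.2 <| And.intro h.3 <| And.intro h.4 <|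
      And.intro h.5 <| And.intro h.6 <| And.intro h.7 <| And.intro h.8 <| And.intro h.9 <|
      And.intro h.10 <| And.intro h.11 <| And.intro h.12 <| And.intro h.13 <| And.intro h.14 <|
      And.intro h.15 h.16,
    fun ⟨h1, h2, h3, h4, h5, h6, h7, h8, h9, h10, h11, h12, h13, h14, h15, h16⟩ =>
      ⟨h1, h2, h3, h4, h5, h6, h7, h8, h9, h10, h11, h12, h13, h14, h15, h16⟩⟩
  refine UDef.of_iff ?_ key
  repeat'
    beta_reduce
    first
    | with_reducible exact hpa
    | with_reducible exact hexp
    | with_reducible exact UDef.eq _ _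
    | with_reducible exact UDef.eq_ze _
    | with_reducible exact UDef.eq_on _
    | with_reducible exact UDef.eq_ad_on _ _
    | with_reducible exact UDef.eq_ad _ _ _
    | with_reducible exact UDef.eq_ml _ _ _
    | with_reducible exact UDef.ls _ _
    | with_reducible exact UDef.trP _ _ _
    | with_reducible exact UDef.vaP _ _ _ _
    | with_reducible exact UDef.enP _ _ _
    | with_reducible exact UDef.isCode _ _ _ _
    | with_reducible exact hg _ _ _
    | with_reducible exact hag _ _ _
    | with_reducible apply UDef.and
    | with_reducible apply UDef.iff
    | with_reducible apply UDef.not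
    | with_reducible apply UDef.all
    | with_reducible apply UDef.ex
    | with_reducible apply UDef.imp

/-! ### Correctness of the truth predicate -/

/-- Case analysis for terms of the language of arithmetic. -/
@[elab_as_elim]
theorem LATerm.induction {α : Type} {P : LA.Term α → Prop} (var : ∀ i, P (Term.var i)) (zero : P 0)
    (one : P 1) (add : ∀ s t, P s → P t → P (s + t)) (mul : ∀ s t, P s → P t → P (s * t))
    (t : LA.Term α) : P t := by
  induction t with
  | var i => exact var i
  | func f ts ih =>
    cases f with
    | zero => rw [func_zero_eq]; exact zero
    | one => rw [func_one_eq]; exact one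
    | add => rw [func_add_eq]; exact add _ _ (ih 0) (ih 1)
    | mul => rw [func_mul_eq]; exact mul _ _ (ih 0) (ih 1)

section OnTerm

variable {α : Type}

theorem onTerm_zero : incl.onTerm (0 : LA.Term α) = lpZero := by
  change Term.func (L := LP) _ _ = _
  rw [Subsingleton.elim (fun i => _) (![] : Fin 0 → LP.Term α)]; rfl

theorem onTerm_one : incl.onTerm (1 : LA.Term α) = lpOne := by
  change Term.func (L := LP) _ _ = _
  rw [Subsingleton.elim (fun i => _) (![] : Fin 0 → LP.Term α)]; rfl

theorem onTerm_add (s t : LA.Term α) :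
    incl.onTerm (s + t) = lpAdd (incl.onTerm s) (incl.onTerm t) := by
  change Term.func (L := LP) _ _ = _
  rw [comp_vec2 incl.onTerm]; rfl

theorem onTerm_mul (s t : LA.Term α) :
    incl.onTerm (s * t) = lpMul (incl.onTerm s) (incl.onTerm t) := by
  change Term.func (L := LP) _ _ = _
  rw [comp_vec2 incl.onTerm]; rfl

end OnTerm

/-- The Gödel number of a formula of the language of arithmetic. -/
def codeLA {n : ℕ} (φ : LA.BoundedFormula Empty n) : ℕ := codeFormula (incl.onBoundedFormula φ)

theorem codeFormula_rel {n l : ℕ} (R : LP.Relations l) (ts : Fin l → LP.Term (Empty ⊕ Fin n)) :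
    codeFormula (BoundedFormula.rel R ts) =
      Nat.pair 2 (Nat.pair (codeRel R) (codeTuple fun i => codeTerm (ts i))) := by
  rw [codeFormula]

theorem codeFormula_lt {n : ℕ} (ts : Fin 2 → LP.Term (Empty ⊕ Fin n)) :
    codeFormula (BoundedFormula.rel (L := LP) (Sum.inl ArithRel.lt) ts) =
      ltCode (codeTerm (ts 0)) (codeTerm (ts 1)) := by
  refine (codeFormula_rel _ _).trans ?_
  simp [codeRel, codeTuple, List.ofFn_succ, ltCode, relCode, consCode]

theorem realize_substLast {M : Type} [LA.Structure M] {m k : ℕ} (φ : LA.Formula (Fin m ⊕ Fin 1))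
    (t : LA.Term (Fin m ⊕ Fin k)) (p : Fin m → M) (xs : Fin k → M) :
    (substLast φ t).Realize p xs ↔
      φ.Realize (Sum.elim p fun _ => t.realize (Sum.elim p xs)) := by
  rw [substLast]
  refine (BoundedFormula.realize_relabel (n := 0) (m := k)).trans ?_
  rw [BoundedFormula.realize_subst, Formula.Realize,
    Subsingleton.elim (xs ∘ Fin.natAdd k : Fin 0 → M) default]
  refine iff_of_eq (congrArg (fun w => BoundedFormula.Realize φ w default) ?_)
  funext i
  rcases i with i | i <;> rfl

theorem models_indAxiom {M : Type} [LA.Structure M] {m : ℕ} (φ : LA.Formula (Fin m ⊕ Fin 1)) :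
    M ⊨ indAxiom φ ↔ ∀ p : Fin m → M, φ.Realize (Sum.elim p fun _ => ze) →
      (∀ a, φ.Realize (Sum.elim p fun _ => a) → φ.Realize (Sum.elim p fun _ => ad a on)) →
        ∀ a, φ.Realize (Sum.elim p fun _ => a) := by
  rw [Sentence.Realize, indAxiom, univClosure, BoundedFormula.realize_alls]
  refine forall_congr' fun p => (Formula.realize_relabel_sumInr _).trans ?_
  rw [Formula.Realize, BoundedFormula.realize_imp, BoundedFormula.realize_inf]
  simp only [BoundedFormula.realize_all, BoundedFormula.realize_imp, realize_substLast,
    realize_zero, realize_one, realize_add, realize_bv, Sum.elim_inr]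
  exact and_imp

namespace Gam

variable {g : LA.Formula ℕ} {M : Type} [LP.Structure M] {k : ℕ}
  (h : Gam g M (num M k)) (hg : ∀ n x : ℕ, g.Realize (env3 (num M k) (num M n) (num M x)))

include h

theorem isPAm : IsPAm M := isPAm_of_models h.pa

include hg

theorem val_iff {n : ℕ} (t : LA.Term (Empty ⊕ Fin n)) {s : M} {xs : Fin n → M}
    (hs : ∀ i : Fin n, EnP s (num M i) (xs i)) (a : M) :
    VaP (num M n) (num M (codeTerm (incl.onTerm t))) s a ↔
      a = t.realize (Sum.elim default xs) := by
  have hpa := h.isPAm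
  induction t using LATerm.induction generalizing a with
  | var i =>
    rcases i with i | i
    · exact i.elim
    · have hc : codeTerm (incl.onTerm (Term.var (Sum.inr i) : LA.Term (Empty ⊕ Fin n))) =
          Nat.pair 0 i := by
        change codeTerm (Term.var (Sum.inr i)) = _
        rw [codeTerm]
      rw [h.var (num M n) _ (num M i) s (hg _ _) ((isCode_num _ hpa _ _ _).2 hc)
        (hpa.num_lt i.isLt)]
      exact ⟨fun h1 => h.en_unique _ _ _ _ h1 (hs i), fun h1 => h1 ▸ hs i⟩
  | zero =>
    rw [realize_zero]
    exact h.zero _ _ s (hg _ _)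
      ((isCode_num _ hpa _ _ _).2 (by rw [onTerm_zero, codeTerm_lpZero])) a
  | one =>
    rw [realize_one]
    exact h.one _ _ s (hg _ _)
      ((isCode_num _ hpa _ _ _).2 (by rw [onTerm_one, codeTerm_lpOne])) a
  | add r₁ r₂ h1 h2 =>
    rw [realize_add, h.add _ _ _ _ s (hg _ _) ((isCode_num _ hpa _ _ _).2
      (by rw [onTerm_add, codeTerm_lpAdd]))]
    simp only [h1, h2, exists_and_left, exists_eq_left]
  | mul r₁ r₂ h1 h2 =>
    rw [realize_mul, h.mul _ _ _ _ s (hg _ _) ((isCode_num _ hpa _ _ _).2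
      (by rw [onTerm_mul, codeTerm_lpMul]))]
    simp only [h1, h2, exists_and_left, exists_eq_left]

/-- The truth predicate is correct about standard formulas, at assignments with arbitrary entries.
-/
theorem true_iff {n : ℕ} (φ : LA.BoundedFormula Empty n) {s : M} {xs : Fin n → M}
    (hs : ∀ i : Fin n, EnP s (num M i) (xs i)) :
    TrP (num M n) (num M (codeLA φ)) s ↔ φ.Realize default xs := by
  have hpa := h.isPAm
  induction φ generalizing s with
  | falsum =>
    refine iff_of_false (h.bot _ _ s (hg _ _) ?_) id
    rw [codeLA, show codeFormula _ = 0 by change codeFormula .falsum = 0; rw [codeFormula]; rfl]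
    rfl
  | @equal n r₁ r₂ =>
    rw [h.eq _ _ _ _ s (hg _ _) ((isCode_num _ hpa _ _ _).2 (by
      change codeFormula (.equal (incl.onTerm _) (incl.onTerm _)) = _
      rw [codeFormula, eqCode]))]
    simp only [h.val_iff hg r₁ hs, h.val_iff hg r₂ hs, exists_eq_left]
    exact Iff.rfl
  | @rel n l R ts =>
    cases R
    rw [h.lt _ _ _ _ s (hg _ _) ((isCode_num _ hpa _ _ _).2 (by
      change codeFormula (BoundedFormula.rel (L := LP) (Sum.inl ArithRel.lt) _) = _
      rw [codeFormula_lt]))]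
    simp only [Function.comp_apply, h.val_iff hg (ts 0) hs, h.val_iff hg (ts 1) hs, exists_and_left,
      exists_eq_left]
    change _ ↔ Structure.RelMap (L := LA) _ _
    rw [vec2_eq fun i => Term.realize _ _]
    exact Iff.rfl
  | @imp n φ ψ ih1 ih2 =>
    rw [h.imp _ _ _ _ s (hg _ _) ((isCode_num _ hpa _ _ _).2 (by
      change codeFormula (.imp (incl.onBoundedFormula _) (incl.onBoundedFormula _)) = _
      rw [codeFormula]; rfl))]
    change (TrP _ (num M (codeLA φ)) s → TrP _ (num M (codeLA ψ)) s) ↔ _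
    exact imp_congr (ih1 hs) (ih2 hs)
  | @all n φ ih =>
    rw [h.all _ _ _ _ s rfl (hg _ _) ((isCode_num _ hpa _ _ _).2 (by
      change codeFormula (.all (incl.onBoundedFormula _)) = _
      rw [codeFormula]; rfl)), BoundedFormula.realize_all]
    have hr : ∀ r a, AgP (num M n) s r → EnP r (num M n) a → ∀ i : Fin (n + 1),
        EnP r (num M i) ((Fin.snoc xs a : Fin (n + 1) → M) i) := by
      intro r a h1 h2 i
      induction i using Fin.lastCases with
      | last => simpa using h2
      | cast i =>
        rw [Fin.snoc_castSucc]
        exact (h1 _ (hpa.num_lt i.isLt) _).1 (hs i)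
    constructor
    · intro H a
      obtain ⟨r, h1, h2⟩ := h.en_ext s (num M n) a
      exact (ih (hr r a h2 h1)).1 (H r h2)
    · intro H r h2
      obtain ⟨a, h1⟩ := h.en_ex r (num M n)
      exact (ih (hr r a h2 h1)).2 (H a)

omit hg in
/-- Every finite sequence of elements of the model is coded in the model. -/
theorem exists_tuple {m : ℕ} (p : Fin m → M) : ∃ s, ∀ i : Fin m, EnP s (num M i) (p i) := by
  induction m with
  | zero => exact ⟨ze, fun i => i.elim0⟩
  | succ m ih =>
    obtain ⟨s, hs⟩ := ih fun i => p i.castSucc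
    obtain ⟨r, h1, h2⟩ := h.en_ext s (num M m) (p (Fin.last m))
    refine ⟨r, fun i => ?_⟩
    induction i using Fin.lastCases with
    | last => exact h1
    | cast i => exact (h2 _ (h.isPAm.num_lt i.isLt) _).1 (hs i)

/-- The induction axiom of the truth predicate gives induction for all arithmetical formulas. -/
theorem models_indAxiom {m : ℕ} (φ : LA.Formula (Fin m ⊕ Fin 1)) : M ⊨ indAxiom φ := by
  rw [TruthDefinitions.models_indAxiom]
  intro p h0 hstep a
  let ψ : LA.BoundedFormula Empty (m + 1) :=
    toBdd (φ.relabel (Sum.elim Fin.castSucc fun _ => Fin.last m))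
  obtain ⟨s, hs⟩ := h.exists_tuple p
  have key : ∀ a r, AgP (num M m) s r → EnP r (num M m) a →
      (TrP (ad (num M m) on) (num M (codeLA ψ)) r ↔ φ.Realize (Sum.elim p fun _ => a)) := by
    intro a r h1 h2
    have hr : ∀ i : Fin (m + 1), EnP r (num M i) ((Fin.snoc p a : Fin (m + 1) → M) i) := by
      intro i
      induction i using Fin.lastCases with
      | last => simpa using h2
      | cast i =>
        rw [Fin.snoc_castSucc]
        exact (h1 _ (h.isPAm.num_lt i.isLt) _).1 (hs i)
    refine (h.true_iff hg ψ hr).trans ((realize_toBdd _ _ _).trans ?_)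
    rw [Formula.realize_relabel]
    refine iff_of_eq (congrArg _ ?_)
    funext i
    rcases i with i | i <;> simp
  have ex : ∀ a, ∃ r, EnP r (num M m) a ∧ AgP (num M m) s r := fun a => h.en_ext s _ a
  have hind := h.ind (num M m) _ ze (num M (codeLA ψ)) s rfl rfl
    (fun r h1 h2 => (key _ r h1 h2).2 h0) ?_ a
  · obtain ⟨r, h1, h2⟩ := ex a
    exact (key a r h2 h1).1 (hind r h2 h1)
  · rintro a _ rfl ha r h1 h2
    obtain ⟨q, h3, h4⟩ := ex a
    exact (key _ r h1 h2).2 (hstep a ((key a q h4 h3).1 (ha q h4 h3)))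

theorem models_EA {σ : LA.Sentence} (hσ : σ ∈ EA) : M ⊨ σ := by
  rcases hσ with (hσ | ⟨m, φ, -, rfl⟩) | hσ
  · exact h.pa σ hσ
  · exact h.models_indAxiom hg φ
  · exact h.exp σ hσ

theorem true_sentence_iff (σ : LA.Sentence) (s : M) :
    TrP ze (num M (godel (incl.onSentence σ))) s ↔ M ⊨ σ :=
  h.true_iff hg (n := 0) σ (s := s) (xs := default) fun i => i.elim0

end Gam

/-! ### The guarded theories as sentences -/

/-- A formula in one free variable that expresses the guarded theory of truth. -/
noncomputable def gamF (g : LA.Formula ℕ) : LP.BoundedFormula Empty 1 :=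
  toBdd ((Classical.choose (uDef_gam g)).relabel fun _ => (0 : Fin 1))

theorem realize_gamF (g : LA.Formula ℕ) {M : Type} [LP.Structure M] (w : Empty → M) (y : M) :
    (gamF g).Realize w (fun _ => y) ↔ Gam g M y := by
  rw [gamF, realize_toBdd, Formula.realize_relabel, Classical.choose_spec (uDef_gam g)]
  exact Iff.rfl

/-- The guarded theory of truth whose parameter is the numeral `k`. -/
noncomputable def gamS (g : LA.Formula ℕ) (k : ℕ) : LP.Sentence :=
  ((Term.var (Sum.inr 0) : LP.Term (Empty ⊕ Fin 1)).bdEqual (incl.onTerm (numeral k)) ⟹ gamF g).all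

theorem models_gamS (g : LA.Formula ℕ) (k : ℕ) {M : Type} [LP.Structure M] :
    M ⊨ gamS g k ↔ Gam g M (num M k) := by
  rw [Sentence.Realize, Formula.Realize, gamS, BoundedFormula.realize_all]
  have key : ∀ y : M, (Fin.snoc default y : Fin 1 → M) = fun _ => y := fun y => by
    funext i; obtain rfl : i = Fin.last 0 := Fin.ext (by omega); exact Fin.snoc_last _ _
  simp only [BoundedFormula.realize_imp, BoundedFormula.realize_bdEqual, key, realize_gamF,
    LHom.realize_onTerm, realize_numeral, Term.realize_var, Sum.elim_inr, forall_eq]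

/-- Provability in terms of nonempty structures on types in the lowest universe. -/
theorem proves_iff (α σ : LP.Sentence) :
    Proves α σ ↔ ∀ (M : Type) [LP.Structure M] [Nonempty M], M ⊨ α → M ⊨ σ := by
  rw [Proves, Theory.models_sentence_iff]
  constructor
  · intro H M _ _ hM
    have : M ⊨ ({α} : LP.Theory) := Theory.model_singleton_iff.2 hM
    exact H (Theory.ModelType.of _ M)
  · intro H M
    exact H M (Theory.model_singleton_iff.1 M.is_model)

theorem models_applyToCode {M : Type} [LP.Structure M] (Θ : LP.Formula (Fin 1)) (σ : LA.Sentence) :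
    M ⊨ applyToCode Θ σ ↔ Θ.Realize fun _ => num M (godel (incl.onSentence σ)) := by
  rw [Sentence.Realize, Formula.Realize, applyToCode, BoundedFormula.realize_subst]
  simp only [LHom.realize_onTerm, realize_numeral]
  exact Iff.rfl

/-- The definition of `DEF` in terms of models. -/
theorem mem_DEF_iff (α : LP.Sentence) : α ∈ DEF ↔
    (∃ (M : Type) (_ : LP.Structure M), Nonempty M ∧ M ⊨ α) ∧
    (∀ (M : Type) [LP.Structure M] [Nonempty M], M ⊨ α → ∀ σ ∈ EA, M ⊨ σ) ∧
    ∃ Θ : LP.Formula (Fin 1), ∀ (M : Type) [LP.Structure M] [Nonempty M], M ⊨ α →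
      ∀ σ : LA.Sentence, Θ.Realize (fun _ => num M (godel (incl.onSentence σ))) ↔ M ⊨ σ := by
  refine and_congr ?_ (and_congr ?_ (exists_congr fun Θ => ?_))
  · rw [proves_iff]
    push Not
    exact exists₂_congr fun M _ => ⟨fun ⟨h1, h2, _⟩ => ⟨h1, h2⟩, fun ⟨h1, h2⟩ => ⟨h1, h2, id⟩⟩
  · simp only [proves_iff]
    exact ⟨fun H M _ _ hM σ hσ => (LHom.realize_onSentence M incl σ).1 (H σ hσ M hM),
      fun H σ hσ M _ _ hM => (LHom.realize_onSentence M incl σ).2 (H M hM σ hσ)⟩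
  · simp only [proves_iff]
    have key : ∀ (M : Type) [LP.Structure M] (σ : LA.Sentence),
        M ⊨ (applyToCode Θ σ ⇔ incl.onSentence σ : LP.Sentence) ↔
          (Θ.Realize (fun _ => num M (godel (incl.onSentence σ))) ↔ M ⊨ σ) := fun M _ σ => by
      rw [Sentence.realize_iff, models_applyToCode, LHom.realize_onSentence]
    exact ⟨fun H M _ _ hM σ => (key M σ).1 (H σ M hM), fun H σ M _ _ hM => (key M σ).2 (H M hM σ)⟩

/-- A guarded theory of truth with a model is a definition of truth if the guard holds at all
numerals. -/
theorem gamS_mem_DEF {g : LA.Formula ℕ} {k : ℕ} {N : Type} [LP.Structure N] (hN : Gam g N (num N k))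
    (hg : ∀ (M : Type) [LA.Structure M], IsPAm M → ∀ n x : ℕ,
      g.Realize (env3 (num M k) (num M n) (num M x))) : gamS g k ∈ DEF := by
  rw [mem_DEF_iff]
  simp only [models_gamS]
  refine ⟨⟨N, _, ⟨ze⟩, hN⟩, fun M _ _ h σ hσ => h.models_EA (hg M h.isPAm) hσ,
    Relations.formula (L := LP) (n := 3) (Sum.inr (0 : ℕ)) ![lpZero, Term.var 0, lpZero],
    fun M _ _ h σ => ?_⟩
  rw [← h.true_sentence_iff (hg M h.isPAm) σ ze]
  refine (Formula.realize_rel (L := LP)).trans ?_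
  rw [TrP]
  refine iff_of_eq (congrArg _ ?_)
  funext i
  fin_cases i
  · exact realize_lpZero _
  · rfl
  · exact realize_lpZero _

/-! ### Exponentiation in the standard model -/

/-- `⌊m / u⌋` is odd. -/
def Bit (u m : ℕ) : Prop := ∃ q r, r < u ∧ m = (q + q + 1) * u + r

/-- `⌊m / u⌋ mod u = d`. -/
def Dig (u m d : ℕ) : Prop := d < u ∧ ∃ q r, r < u ∧ m = (q * u + d) * u + r

theorem Dig.add {c m d k : ℕ} (h : Dig c m d) (hk : c * c ∣ k) : Dig c (m + k) d := by
  obtain ⟨hd, q, r, hr, rfl⟩ := h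
  obtain ⟨t, rfl⟩ := hk
  exact ⟨hd, q + t, r, hr, by ring⟩

theorem Bit.add {c m k : ℕ} (h : Bit c m) (hk : c + c ∣ k) : Bit c (m + k) := by
  obtain ⟨q, r, hr, rfl⟩ := h
  obtain ⟨t, rfl⟩ := hk
  exact ⟨q + t, r, hr, by ring⟩

theorem Bit.of_add {c m k : ℕ} (h : Bit c (m + k)) (hk : c + c ∣ k) : Bit c m := by
  obtain ⟨q, r, hr, e⟩ := h
  obtain ⟨t, rfl⟩ := hk
  have hq : t ≤ q := by
    by_contra! hlt
    have : (q + q + 2) * c ≤ (c + c) * t := by nlinarith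
    nlinarith
  obtain ⟨d, rfl⟩ := Nat.exists_eq_add_of_le hq
  exact ⟨d, r, hr, by nlinarith⟩

theorem Bit.le {c m : ℕ} (h : Bit c m) : c ≤ m := by
  obtain ⟨q, r, _, rfl⟩ := h
  nlinarith [Nat.zero_le (q * c)]

/-- The marks in `m + u` are those in `m` and one more at `u`. -/
theorem Bit.eq_or {k l m : ℕ} (h : Bit (2 ^ k) (m + 2 ^ l)) (hm : m < 2 ^ l) :
    2 ^ k = 2 ^ l ∨ Bit (2 ^ k) m := by
  rcases lt_trichotomy k l with hkl | rfl | hkl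
  · refine Or.inr (h.of_add ?_)
    rw [← mul_two, ← pow_succ]
    exact pow_dvd_pow 2 hkl
  · exact Or.inl rfl
  · have h1 := h.le
    have h2 : 2 ^ (l + 1) ≤ 2 ^ k := Nat.pow_le_pow_right (by omega) hkl
    rw [pow_succ] at h2
    omega

/-- The computation of `x ^ e` by repeated squaring, where the location of the result is `(2 ^ j) ^
(2 ^ L)`: the bits of `e` are processed from the top, and each step squares the location and stores
the new pair above everything stored so far. -/
theorem exists_computation {x j : ℕ} (hx : 2 ≤ x) (hj : x * x ≤ 2 ^ j) (L e : ℕ) (h1 : 2 ^ L ≤ e)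
    (h2 : e < 2 ^ (L + 1)) : ∃ M X Y u k : ℕ, u = (2 ^ j) ^ 2 ^ L ∧ u = 2 ^ k ∧ M < u + u ∧
      X < u * u ∧ Y < u * u ∧ Bit u M ∧ Dig u X e ∧ Dig u Y (x ^ e) ∧
      ∀ l, Bit (2 ^ l) M → (Dig (2 ^ l) X 1 ∧ Dig (2 ^ l) Y x) ∨
        ∃ v e w, v < 2 ^ l ∧ 2 ^ l = v * v ∧ Bit v M ∧ Dig v X e ∧ Dig v Y w ∧
          ((Dig (2 ^ l) X (e + e) ∧ Dig (2 ^ l) Y (w * w)) ∨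
            (Dig (2 ^ l) X (e + e + 1) ∧ Dig (2 ^ l) Y (w * w * x))) := by
  have hbd : x ^ e < (2 ^ j) ^ 2 ^ L := by
    calc x ^ e < x ^ 2 ^ (L + 1) := Nat.pow_lt_pow_right (by omega) h2
      _ = (x * x) ^ 2 ^ L := by rw [← pow_two, ← pow_mul, pow_succ, mul_comm]
      _ ≤ _ := Nat.pow_le_pow_left hj _
  have hbe : e < (2 ^ j) ^ 2 ^ L := (Nat.lt_pow_self (by omega)).trans hbd
  induction L generalizing e with
  | zero =>
    obtain rfl : e = 1 := by simp at h1 h2; omega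
    simp only [pow_zero, pow_one] at hbd hbe ⊢
    have hu : 0 < 2 ^ j := by positivity
    refine ⟨2 ^ j, 2 ^ j, x * 2 ^ j, 2 ^ j, j, rfl, rfl, by omega, by nlinarith, by nlinarith,
      ⟨0, 0, hu, by ring⟩, ⟨hbe, 0, 0, hu, by ring⟩, ⟨hbd, 0, 0, hu, by ring⟩, fun l hl => ?_⟩
    rw [← zero_add (2 ^ j)] at hl
    rcases hl.eq_or hu with h | h
    · rw [h]
      exact Or.inl ⟨⟨hbe, 0, 0, hu, by ring⟩, ⟨hbd, 0, 0, hu, by ring⟩⟩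
    · have := h.le
      have : 0 < 2 ^ l := by positivity
      omega
  | succ L ih =>
    have hpow : (2 ^ j) ^ 2 ^ (L + 1) = (2 ^ j) ^ 2 ^ L * (2 ^ j) ^ 2 ^ L := by
      rw [← pow_add, pow_succ, mul_two]
    have hL1 : 2 ^ L ≤ e / 2 := by rw [pow_succ] at h1; omega
    have hL2 : e / 2 < 2 ^ (L + 1) := by rw [pow_succ 2 (L + 1)] at h2; omega
    have hbd' : x ^ (e / 2) < (2 ^ j) ^ 2 ^ L := by
      calc x ^ (e / 2) < x ^ 2 ^ (L + 1) := Nat.pow_lt_pow_right (by omega) hL2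
        _ = (x * x) ^ 2 ^ L := by rw [← pow_two, ← pow_mul, pow_succ, mul_comm]
        _ ≤ _ := Nat.pow_le_pow_left hj _
    obtain ⟨M, X, Y, u, k, hu, huk, hM, hX, hY, hb, hd, hw, H⟩ :=
      ih (e / 2) hL1 hL2 hbd' ((Nat.lt_pow_self (by omega)).trans hbd')
    rw [hpow, ← hu] at hbd hbe ⊢
    have hu2 : 2 ≤ u := by
      rw [← hu] at hbd'
      have : 0 < x ^ (e / 2) := by positivity
      omega
    have huu : u * u = 2 ^ (k + k) := by rw [huk, pow_add]
    have huu0 : 2 * u ≤ u * u := Nat.mul_le_mul_right u hu2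
    -- adding a multiple of `u * u` does not change what is stored up to the location `u`
    have hdig : ∀ {c a d : ℕ} (b : ℕ), c ∣ u → Dig c a d → Dig c (a + b * (u * u)) d :=
      fun b hc h => h.add (Dvd.dvd.mul_left (mul_dvd_mul hc hc) b)
    have hbit : ∀ {c}, c ∣ u → Bit c M → Bit c (M + u * u) := fun hc h =>
      h.add (by
        rw [← mul_two]
        refine mul_dvd_mul hc ?_
        rw [huk]
        refine dvd_pow_self 2 ?_
        rintro rfl
        simp [huk] at hu2)
    refine ⟨M + u * u, X + e * (u * u), Y + x ^ e * (u * u), u * u, k + k, rfl, huu, by omega,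
      by nlinarith, by nlinarith, ⟨0, M, by omega, by ring⟩, ⟨hbe, 0, X, hX, by ring⟩,
      ⟨hbd, 0, Y, hY, by ring⟩, fun l hl => ?_⟩
    rw [huu] at hl
    rcases hl.eq_or (by rw [← huu]; omega) with h | h
    · refine Or.inr ⟨u, e / 2, x ^ (e / 2), ?_, ?_, hbit dvd_rfl hb, hdig _ dvd_rfl hd,
        hdig _ dvd_rfl hw, ?_⟩
      · rw [h, ← huu]; omega
      · rw [h, ← huu]
      · rw [h, ← huu]
        rcases Nat.even_or_odd' e with ⟨f, rfl | rfl⟩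
        · left
          rw [show 2 * f / 2 = f by omega, ← pow_add, ← two_mul]
          exact ⟨⟨hbe, 0, X, hX, by ring⟩, ⟨hbd, 0, Y, hY, by ring⟩⟩
        · right
          rw [show (2 * f + 1) / 2 = f by omega, ← pow_add, ← two_mul, ← pow_succ]
          exact ⟨⟨hbe, 0, X, hX, by ring⟩, ⟨hbd, 0, Y, hY, by ring⟩⟩
    · have hlk : l ≤ k := by
        by_contra! hlt
        have h3 : 2 ^ (k + 1) ≤ 2 ^ l := Nat.pow_le_pow_right (by omega) hlt
        have := h.le
        rw [pow_succ, ← huk] at h3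
        omega
      have hdvd : 2 ^ l ∣ u := huk ▸ pow_dvd_pow 2 hlk
      rcases H l h with ⟨ha, hb⟩ | ⟨v, e', w, hv, hvv, h3, h4, h5, h6⟩
      · exact Or.inl ⟨hdig _ hdvd ha, hdig _ hdvd hb⟩
      · have hvu : v ∣ u := (Dvd.intro _ hvv.symm).trans hdvd
        exact Or.inr ⟨v, e', w, hv, hvv, hbit hvu h3, hdig _ hvu h4, hdig _ hvu h5,
          h6.imp (And.imp (hdig _ hdvd) (hdig _ hdvd)) (And.imp (hdig _ hdvd) (hdig _ hdvd))⟩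

section Realize

variable {γ : Type} {n : ℕ} {w : γ → ℕ} {xs : Fin n → ℕ} (u m d : LA.Term (γ ⊕ Fin n))

theorem realize_pow2F : (pow2F u).Realize w xs ↔ ∃ k, u.realize (Sum.elim w xs) = 2 ^ k := by
  simp only [pow2F, BoundedFormula.realize_inf, realize_ltF, realize_ball, realize_bex,
    BoundedFormula.realize_imp, BoundedFormula.realize_sup, BoundedFormula.realize_bdEqual,
    realize_zero, realize_one, realize_add, realize_mul, realize_up, realize_bv]
  simp
  generalize u.realize (Sum.elim w xs) = u
  constructor
  · rintro ⟨h0, h⟩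
    rcases Nat.eq_two_pow_or_exists_odd_prime_and_dvd u with ⟨k, hk⟩ | ⟨p, hp, ⟨c, hc⟩, ho⟩
    · exact ⟨k, hk⟩
    · exfalso
      have hc0 : 0 < c := Nat.pos_of_ne_zero (by rintro rfl; omega)
      have hp0 := hp.pos
      rcases h p (by nlinarith) c (by nlinarith) hc.symm with h1 | ⟨b, -, hb⟩
      · exact hp.one_lt.ne' h1
      · obtain ⟨d, hd⟩ := ho
        omega
  · rintro ⟨k, rfl⟩
    refine ⟨by positivity, fun a _ c _ hac => ?_⟩
    obtain ⟨i, -, rfl⟩ := (Nat.dvd_prime_pow Nat.prime_two).1 (Dvd.intro _ hac)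
    rcases i with _ | i
    · exact Or.inl rfl
    · have : 0 < 2 ^ i := by positivity
      exact Or.inr ⟨2 ^ i, by rw [pow_succ]; omega, by rw [pow_succ]; ring⟩

theorem realize_bitF : (bitF u m).Realize w xs ↔
    Bit (u.realize (Sum.elim w xs)) (m.realize (Sum.elim w xs)) := by
  simp only [bitF, realize_bex, BoundedFormula.realize_bdEqual,
    realize_one, realize_add, realize_mul, realize_up, realize_bv]
  simp [Bit]
  constructor
  · rintro ⟨q, -, h⟩
    exact ⟨q, h⟩
  · rintro ⟨q, r, hr, h⟩
    refine ⟨q, ?_, r, hr, h⟩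
    rw [h]
    nlinarith [Nat.zero_le (q * u.realize (Sum.elim w xs))]

theorem realize_digF : (digF u m d).Realize w xs ↔
    Dig (u.realize (Sum.elim w xs)) (m.realize (Sum.elim w xs)) (d.realize (Sum.elim w xs)) := by
  simp only [digF, BoundedFormula.realize_inf, realize_ltF, realize_bex,
    BoundedFormula.realize_bdEqual, realize_add, realize_one, realize_mul, realize_up, realize_bv]
  simp [Dig]
  intro hd
  constructor
  · rintro ⟨q, -, h⟩
    exact ⟨q, h⟩
  · rintro ⟨q, r, hr, h⟩
    refine ⟨q, ?_, r, hr, h⟩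
    rw [h]
    have : 1 ≤ u.realize (Sum.elim w xs) := by omega
    have h1 := Nat.le_mul_of_pos_right q this
    have h2 := Nat.le_mul_of_pos_right
      (q * u.realize (Sum.elim w xs) + d.realize (Sum.elim w xs)) this
    omega

end Realize

theorem realize_expCore (v : Fin 3 → ℕ) (hx : 1 < v 0) (hy : 0 < v 1) (hz : v 0 ^ v 1 = v 2) :
    expCore.Realize v := by
  rw [Formula.Realize, expCore]
  simp only [BoundedFormula.realize_inf, realize_ball, realize_bex,
    BoundedFormula.realize_imp, BoundedFormula.realize_sup, BoundedFormula.realize_bdEqual,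
    realize_one, realize_add, realize_mul, realize_bv, realize_pow2F,
    realize_bitF, realize_digF, Term.realize_var, Sum.elim_inl, Sum.elim_inr, nat_ls,
    nat_ad, nat_ml, nat_on]
  simp [Fin.snoc]
  -- the first location is at least `x ^ 2`, so that all the values fit, and at most `x ^ 3`
  obtain ⟨j, hj1, hj2⟩ : ∃ j, v 0 * v 0 ≤ 2 ^ j ∧ 2 ^ j ≤ v 0 ^ 3 := by
    refine ⟨Nat.clog 2 (v 0 * v 0), Nat.le_pow_clog (by omega) _, ?_⟩
    have h1 := Nat.pow_pred_clog_lt_self (b := 2) (by omega) (x := v 0 * v 0) (by nlinarith)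
    have h2 : 0 < Nat.clog 2 (v 0 * v 0) := Nat.clog_pos (by omega) (by nlinarith)
    obtain ⟨i, hi⟩ := Nat.exists_eq_succ_of_ne_zero h2.ne'
    rw [hi, Nat.pred_succ] at h1
    rw [hi, Nat.succ_eq_add_one, pow_succ, pow_succ, pow_two]
    nlinarith
  obtain ⟨M, X, Y, u, k, hu, huk, hM, hX, hY, hb, hd, hw, H⟩ := exists_computation hx hj1
    (Nat.log 2 (v 1)) (v 1) (Nat.pow_log_le_self 2 hy.ne') (Nat.lt_pow_succ_log_self (by omega) _)
  -- the location of the result is at most `z ^ 3`, hence the three codes are below `z ^ 6`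
  have hu3 : u ≤ v 2 ^ 3 := by
    calc u ≤ (v 0 ^ 3) ^ 2 ^ Nat.log 2 (v 1) := hu ▸ Nat.pow_le_pow_left hj2 _
      _ = (v 0 ^ 2 ^ Nat.log 2 (v 1)) ^ 3 := by rw [← pow_mul, ← pow_mul, mul_comm]
      _ ≤ (v 0 ^ v 1) ^ 3 := Nat.pow_le_pow_left
        (Nat.pow_le_pow_right (by omega) (Nat.pow_log_le_self 2 hy.ne')) _
      _ = _ := by rw [hz]
  have hu6 : u * u ≤ v 2 * v 2 * v 2 * v 2 * v 2 * v 2 := by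
    calc u * u ≤ v 2 ^ 3 * v 2 ^ 3 := Nat.mul_le_mul hu3 hu3
      _ = _ := by ring
  have hu2 : u + u ≤ u * u := by
    have : 2 ≤ u := by
      have h1 := hw.1
      have h2 : v 0 ≤ v 0 ^ v 1 := Nat.le_self_pow hy.ne' _
      omega
    nlinarith
  rw [hz] at hw
  subst huk
  refine ⟨M, by omega, X, by omega, Y, by omega, ⟨k, by omega, hb, hd, hw⟩, ?_⟩
  rintro _ ha l rfl hl
  refine (H l hl).imp id ?_
  rintro ⟨c, e, w, h1, h2, h3, h4, h5, h6⟩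
  exact ⟨c, h1, ⟨h2, h3⟩, e, (h4.1.trans h1).le.trans ha, w, (h5.1.trans h1).le.trans ha,
    ⟨h4, h5⟩, h6⟩

theorem nat_models_expTotal : ℕ ⊨ expTotal := by
  rw [Sentence.Realize, Formula.Realize, expTotal]
  simp only [BoundedFormula.realize_all, BoundedFormula.realize_ex]
  intro x y
  refine ⟨x ^ y, ?_⟩
  refine (BoundedFormula.realize_relabel (n := 0) (m := 3)).2 ?_
  rw [Subsingleton.elim (_ ∘ Fin.natAdd 3 : Fin 0 → ℕ) default]
  generalize hv : (Sum.elim _ _ ∘ _ : Fin 3 → ℕ) = v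
  have h0 : v 0 = x := by rw [← hv]; rfl
  have h1 : v 1 = y := by rw [← hv]; rfl
  have h2 : v 2 = x ^ y := by rw [← hv]; rfl
  clear hv
  simp only [expF, BoundedFormula.realize_inf, realize_ltF,
    BoundedFormula.realize_sup, BoundedFormula.realize_bdEqual,
    realize_zero, realize_one, Term.realize_var, Sum.elim_inl, nat_ls, nat_on, nat_ze, h0, h1, h2]
  rcases Nat.eq_zero_or_pos y with rfl | hy
  · simp
  · have : x = 0 ∨ x = 1 ∨ 1 < x := by omega
    rcases this with rfl | rfl | hx
    · exact Or.inr (Or.inl ⟨hy, Or.inl rfl, zero_pow hy.ne'⟩)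
    · exact Or.inr (Or.inl ⟨hy, Or.inr rfl, one_pow _⟩)
    · exact Or.inr (Or.inr ⟨⟨hy, hx⟩, realize_expCore v (h0 ▸ hx) (h1 ▸ hy) (by rw [h0, h1, h2])⟩)

/-! ### Partial truth in the standard model -/

theorem sat_lt {M : Type} (S : LP.Structure M) {n : ℕ} (a : ℕ → M) (s t : ℕ) :
    sat S n (ltCode s t) a ↔ ls (tval S n s a) (tval S n t a) := by
  have hL : decL (consCode s (consCode t 0)) = [s, t] := by
    simp [decL, consCode]
  rw [ltCode, sat_rel S a 0 _ (fun i => if i = 0 then tval S n s a else tval S n t a), hL, relAt]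
  · simp
  · intro j hj
    simp only [hL] at hj ⊢
    have : j = 0 ∨ j = 1 := by simp at hj; omega
    rcases this with rfl | rfl <;> rfl

/-- The standard model with the given interpretation of the predicate symbols. -/
@[reducible] def natLP (P : ∀ l, ℕ → (Fin l → ℕ) → Prop) : LP.Structure ℕ where
  funMap := fun f v =>
    match f with
    | Sum.inl f => natStructure.funMap f v
    | Sum.inr f => f.elim
  RelMap := fun {l} R v =>
    match R with
    | Sum.inl R => natStructure.RelMap R v
    | Sum.inr j => P l j v

theorem num_natLP (P : ∀ l, ℕ → (Fin l → ℕ) → Prop) (k : ℕ) :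
    @num ℕ (@redStructure ℕ (natLP P)) k = k := nat_num k

/-- The standard model with empty interpretations of the predicate symbols. -/
@[reducible] def trivLP : LP.Structure ℕ := natLP fun _ _ _ => False

/-- The truth and value predicates, restricted to codes for which `C` holds, and the predicate for
the entries of coded tuples. -/
def truthPred (C : ℕ → Prop) : ∀ l, ℕ → (Fin l → ℕ) → Prop
  | 3, 0, v => C (v 0 + v 1) ∧ sat trivLP (v 0) (v 1) (Nat.beta (v 2))
  | 3, 1, v => Nat.beta (v 0) (v 1) = v 2
  | 4, 0, v => C (v 0 + v 1) ∧ v 3 = tval trivLP (v 0) (v 1) (Nat.beta (v 2))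
  | _, _, _ => False

/-- The standard model with truth for the formulas whose codes satisfy `C`. -/
@[reducible] def natTruth (C : ℕ → Prop) : LP.Structure ℕ := natLP (truthPred C)

section NatTruth

variable (C : ℕ → Prop)

theorem natTruth_trP (n x s : ℕ) :
    @TrP ℕ (natTruth C) n x s ↔ C (n + x) ∧ sat trivLP n x (Nat.beta s) := Iff.rfl

theorem natTruth_vaP (n x s a : ℕ) :
    @VaP ℕ (natTruth C) n x s a ↔ C (n + x) ∧ a = tval trivLP n x (Nat.beta s) := Iff.rfl

theorem natTruth_enP (s i a : ℕ) : @EnP ℕ (natTruth C) s i a ↔ Nat.beta s i = a := Iff.rfl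

theorem natTruth_agP (n s r : ℕ) :
    @AgP ℕ (natTruth C) n s r ↔ ∀ i < n, Nat.beta s i = Nat.beta r i := by
  refine forall₂_congr fun i _ => ⟨fun h => (h _).2 rfl, fun h a => ?_⟩
  rw [natTruth_enP, natTruth_enP, h]

variable {C}

/-- The standard model with partial truth satisfies the guarded theory of truth if the guard
implies that truth is interpreted correctly. -/
theorem gam_natTruth {g : LA.Formula ℕ} {k : ℕ} (hg : ∀ n x : ℕ, g.Realize (env3 k n x) → C (n + x))
    (hC : ∀ m n, m ≤ n → C n → C m) : @Gam g ℕ (natTruth C) k := by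
  let _ := natTruth C
  have hp : ∀ a b : ℕ, a ≤ Nat.pair a b ∧ b ≤ Nat.pair a b := fun a b =>
    ⟨Nat.left_le_pair a b, Nat.right_le_pair a b⟩
  have hc : ∀ s t, s ≤ consCode s (consCode t 0) ∧ t ≤ consCode s (consCode t 0) := fun s t => by
    have h1 := hp s (consCode t 0)
    have h2 := hp t 0
    unfold consCode at *
    omega
  have hbin : ∀ u v s t, s ≤ Nat.pair u (Nat.pair v (consCode s (consCode t 0))) ∧
      t ≤ Nat.pair u (Nat.pair v (consCode s (consCode t 0))) := fun u v s t => by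
    have h1 := hp u (Nat.pair v (consCode s (consCode t 0)))
    have h2 := hp v (consCode s (consCode t 0))
    have h3 := hc s t
    omega
  have hbin' : ∀ u s t, s ≤ Nat.pair u (Nat.pair s t) ∧ t ≤ Nat.pair u (Nat.pair s t) :=
    fun u s t => by
    have h1 := hp u (Nat.pair s t)
    have h2 := hp s t
    omega
  refine ⟨nat_models_PAminus, ?_, fun s i => ⟨Nat.beta s i, rfl⟩,
    fun s i a b (h1 : Nat.beta s i = a) (h2 : Nat.beta s i = b) => h1.symm.trans h2, ?_, ?_,
    ?_, ?_, ?_, ?_, ?_, ?_, ?_, ?_, ?_, ?_⟩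
  · rintro _ rfl
    exact nat_models_expTotal
  · intro s n a
    obtain ⟨u, hu, hun⟩ := exists_snoc (n := n) (s := s) a
    exact ⟨u, hun, (natTruth_agP C n s u).2 hu⟩
  · intro n t i s hgt ht (hi : i < n) a
    obtain rfl := (isCode_nat binCode_var t i i).1 ht
    rw [natTruth_vaP, natTruth_enP, tval_var _ _ hi, and_iff_right (hg _ _ hgt), eq_comm]
  · intro n t s hgt ht a
    obtain rfl := (isCode_nat binCode_zero t t t).1 ht
    rw [natTruth_vaP, tval_zero, and_iff_right (hg _ _ hgt)]
    exact Iff.rfl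
  · intro n t s hgt ht a
    obtain rfl := (isCode_nat binCode_one t t t).1 ht
    rw [natTruth_vaP, tval_one, and_iff_right (hg _ _ hgt)]
    exact Iff.rfl
  · intro n t t₁ t₂ s hgt ht a
    obtain rfl := (isCode_nat binCode_add t t₁ t₂).1 ht
    have h := hbin 1 2 t₁ t₂
    simp only [natTruth_vaP, and_iff_right (hg _ _ hgt),
      and_iff_right (hC _ _ (Nat.add_le_add_left h.1 n) (hg _ _ hgt)),
      and_iff_right (hC _ _ (Nat.add_le_add_left h.2 n) (hg _ _ hgt)), tval_add]
    exact ⟨fun h => ⟨_, _, rfl, rfl, h⟩, by rintro ⟨_, _, rfl, rfl, h⟩; exact h⟩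
  · intro n t t₁ t₂ s hgt ht a
    obtain rfl := (isCode_nat binCode_mul t t₁ t₂).1 ht
    have h := hbin 1 3 t₁ t₂
    simp only [natTruth_vaP, and_iff_right (hg _ _ hgt),
      and_iff_right (hC _ _ (Nat.add_le_add_left h.1 n) (hg _ _ hgt)),
      and_iff_right (hC _ _ (Nat.add_le_add_left h.2 n) (hg _ _ hgt)), tval_mul]
    exact ⟨fun h => ⟨_, _, rfl, rfl, h⟩, by rintro ⟨_, _, rfl, rfl, h⟩; exact h⟩
  · rintro n x s - rfl h
    exact sat_bot _ _ h.2
  · intro n x t₁ t₂ s hgt ht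
    obtain rfl := (isCode_nat binCode_eq x t₁ t₂).1 ht
    have h := hbin' 1 t₁ t₂
    simp only [natTruth_vaP, natTruth_trP, and_iff_right (hg _ _ hgt),
      and_iff_right (hC _ _ (Nat.add_le_add_left h.1 n) (hg _ _ hgt)),
      and_iff_right (hC _ _ (Nat.add_le_add_left h.2 n) (hg _ _ hgt)), sat_eq]
    exact ⟨fun h => ⟨_, rfl, h⟩, by rintro ⟨_, rfl, h⟩; exact h⟩
  · intro n x t₁ t₂ s hgt ht
    obtain rfl := (isCode_nat binCode_lt x t₁ t₂).1 ht
    have h := hbin 2 0 t₁ t₂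
    simp only [natTruth_vaP, natTruth_trP, and_iff_right (hg _ _ hgt),
      and_iff_right (hC _ _ (Nat.add_le_add_left h.1 n) (hg _ _ hgt)),
      and_iff_right (hC _ _ (Nat.add_le_add_left h.2 n) (hg _ _ hgt)), sat_lt]
    exact ⟨fun h => ⟨_, _, rfl, rfl, h⟩, by rintro ⟨_, _, rfl, rfl, h⟩; exact h⟩
  · intro n x x₁ x₂ s hgt ht
    obtain rfl := (isCode_nat binCode_imp x x₁ x₂).1 ht
    have h := hbin' 3 x₁ x₂
    simp only [natTruth_trP, and_iff_right (hg _ _ hgt),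
      and_iff_right (hC _ _ (Nat.add_le_add_left h.1 n) (hg _ _ hgt)),
      and_iff_right (hC _ _ (Nat.add_le_add_left h.2 n) (hg _ _ hgt)), sat_imp]
  · intro n n' x x' s hn hgt ht
    obtain rfl : n' = n + 1 := hn
    obtain rfl := (isCode_nat binCode_all x x' x').1 ht
    have h : x' < allCode x' := lt_pair_of_pos (by omega) le_rfl
    simp only [natTruth_trP, and_iff_right (hg _ _ hgt), natTruth_agP,
      and_iff_right (hC (n + 1 + x') _ (by omega) (hg _ _ hgt)), sat_all]
    constructor
    · intro H r hr
      refine (sat_congr _ _ fun i hi => ?_).1 (H (Nat.beta r n))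
      rcases (Nat.lt_succ_iff_lt_or_eq.1 hi) with hi | rfl
      · rw [Function.update_of_ne hi.ne, hr i hi]
      · rw [Function.update_self]
    · intro H d
      obtain ⟨r, hr, hrn⟩ := exists_snoc (n := n) (s := s) d
      refine (sat_congr _ _ fun i hi => ?_).1 (H r hr)
      rcases (Nat.lt_succ_iff_lt_or_eq.1 hi) with hi | rfl
      · rw [Function.update_of_ne hi.ne, hr i hi]
      · rw [Function.update_self, hrn]
  · intro n n' z x s _ hz h0 hs a
    induction a with
    | zero => obtain rfl : z = 0 := hz; exact h0
    | succ a ih => exact hs a (a + 1) rfl ih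

end NatTruth

/-! ### Arithmetical relations and the undefinability of truth -/

/-- A relation on `ℕ` is arithmetical if it is defined in `ℕ` by a formula of the language of
arithmetic. -/
def Arith (R : (ℕ → ℕ) → Prop) : Prop := ∃ φ : LA.Formula ℕ, ∀ ρ, φ.Realize ρ ↔ R ρ

namespace Arith

variable {R S : (ℕ → ℕ) → Prop}

theorem of_DRel (h : DRel R) : Arith R := by
  obtain ⟨φ, hφ⟩ := h
  refine ⟨φ, fun ρ => ?_⟩
  have := hφ ℕ nat_isPAm ρ
  simpa only [nat_num] using this

theorem of_iff (hR : Arith R) (h : ∀ ρ, S ρ ↔ R ρ) : Arith S := by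
  obtain ⟨φ, hφ⟩ := hR
  exact ⟨φ, fun ρ => (hφ ρ).trans (h ρ).symm⟩

theorem not : Arith R → Arith fun ρ => ¬ R ρ := by
  rintro ⟨φ, hφ⟩
  exact ⟨φ.not, fun ρ => by rw [Formula.realize_not, hφ]⟩

theorem imp : Arith R → Arith S → Arith fun ρ => R ρ → S ρ := by
  rintro ⟨φ, hφ⟩ ⟨ψ, hψ⟩
  exact ⟨φ.imp ψ, fun ρ => by rw [Formula.realize_imp, hφ, hψ]⟩

theorem and (hR : Arith R) (hS : Arith S) : Arith fun ρ => R ρ ∧ S ρ :=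
  (hR.imp hS.not).not.of_iff fun ρ => by tauto

theorem or (hR : Arith R) (hS : Arith S) : Arith fun ρ => R ρ ∨ S ρ :=
  (hR.not.imp hS).of_iff fun ρ => by tauto

theorem all {R : ℕ → (ℕ → ℕ) → Prop} (hR : Arith fun ρ => R (ρ 0) fun i => ρ (i + 1)) :
    Arith fun ρ => ∀ a, R a ρ := by
  obtain ⟨φ, hφ⟩ := hR
  refine ⟨allH φ, fun ρ => ?_⟩
  rw [realize_allH]
  exact forall_congr' fun a => hφ _

theorem ex {R : ℕ → (ℕ → ℕ) → Prop} (hR : Arith fun ρ => R (ρ 0) fun i => ρ (i + 1)) :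
    Arith fun ρ => ∃ a, R a ρ :=
  (all (R := fun a ρ => ¬ R a ρ) hR.not).not.of_iff fun ρ => by simp

theorem const (p : Prop) : Arith fun _ => p := by
  by_cases hp : p
  · exact (of_DRel (DRel.eq (.const 0) (.const 0))).of_iff fun _ => by simp [hp]
  · exact (of_DRel (DRel.eq (.const 0) (.const 1))).of_iff fun _ => by simp [hp]

/-- A disjunction of arithmetical relations that is finite in the metatheory. -/
theorem exists_lt {R : ℕ → (ℕ → ℕ) → Prop} (hR : ∀ n, Arith (R n)) (c : ℕ) :
    Arith fun ρ => ∃ n < c, R n ρ := by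
  induction c with
  | zero => exact (const False).of_iff fun ρ => by simp
  | succ c ih => exact (ih.or (hR c)).of_iff fun ρ => Nat.exists_lt_succ_right

end Arith

/-- A predicate of tuples is arithmetical if it is so at all absolute arguments. -/
def ArithPred {ι : Type} (P : (ι → ℕ) → Prop) : Prop :=
  ∀ f : ι → (ℕ → ℕ) → ℕ, (∀ i, DFun (f i)) → Arith fun ρ => P fun i => f i ρ

section Realize

variable (P : ∀ l, ℕ → (Fin l → ℕ) → Prop) {α : Type}

theorem dFun_realize_natLP (t : LP.Term α) {f : α → (ℕ → ℕ) → ℕ} (hf : ∀ i, DFun (f i)) :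
    DFun fun ρ => @Term.realize LP ℕ (natLP P) α (fun i => f i ρ) t := by
  induction t using LPTerm.induction with
  | var i => exact hf i
  | zero => exact DFun.const 0
  | one => exact DFun.const 1
  | add s t h1 h2 => simp only [realize_lpAdd]; exact h1.add h2
  | mul s t h1 h2 => simp only [realize_lpMul]; exact h1.mul h2

/-- Expanding `ℕ` by arithmetical predicates does not make more relations definable. -/
theorem arith_realize_natLP (hP : ∀ l j, ArithPred (P l j)) {n : ℕ} (φ : LP.BoundedFormula α n)
    {f : α → (ℕ → ℕ) → ℕ} (hf : ∀ i, DFun (f i)) {g : Fin n → (ℕ → ℕ) → ℕ} (hg : ∀ i, DFun (g i)) :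
    Arith fun ρ =>
      @BoundedFormula.Realize LP ℕ (natLP P) α n φ (fun i => f i ρ) fun i => g i ρ := by
  have henv : ∀ {n : ℕ} {f : α → (ℕ → ℕ) → ℕ} {g : Fin n → (ℕ → ℕ) → ℕ}, (∀ i, DFun (f i)) →
      (∀ i, DFun (g i)) → ∀ t : LP.Term (α ⊕ Fin n), DFun fun ρ =>
        @Term.realize LP ℕ (natLP P) _ (Sum.elim (fun i => f i ρ) fun i => g i ρ) t := by
    intro n f g hf hg t
    have := dFun_realize_natLP P t (f := Sum.elim f g) (by rintro (i | i); exacts [hf i, hg i])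
    convert this using 3 with ρ
    funext i
    rcases i with i | i <;> rfl
  induction φ generalizing f with
  | falsum => exact Arith.const False
  | equal s t => exact .of_DRel (.eq (henv hf hg s) (henv hf hg t))
  | @rel n l R ts =>
    rcases R with R | j
    · cases R
      exact .of_DRel (.lt (henv hf hg (ts 0)) (henv hf hg (ts 1)))
    · exact hP l j _ fun i => henv hf hg (ts i)
  | imp φ ψ h1 h2 => exact (h1 hf hg).imp (h2 hf hg)
  | @all n φ ih =>
    refine Arith.all (R := fun a ρ => @BoundedFormula.Realize LP ℕ (natLP P) α (n + 1) φ
      (fun i => f i ρ) (Fin.snoc (fun i => g i ρ) a)) ?_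
    refine (ih (f := fun i ρ => f i fun j => ρ (j + 1))
      (g := Fin.snoc (fun i ρ => g i fun j => ρ (j + 1)) fun ρ => ρ 0)
      (fun i => (hf i).comp _) fun i => ?_).of_iff fun ρ => iff_of_eq (congrArg _ ?_)
    · induction i using Fin.lastCases with
      | last => simpa using DFun.var 0
      | cast i => simpa using (hg i).comp _
    · funext i
      induction i using Fin.lastCases <;> simp

theorem arithPred_realize_dec (hP : ∀ l j, ArithPred (P l j)) (n x : ℕ)
    (w : Empty → ℕ) :
    ArithPred fun v : Fin n → ℕ => @BoundedFormula.Realize LP ℕ (natLP P) _ _ (dec n x) w v :=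
  fun _ hf => arith_realize_natLP P hP (dec n x) (f := fun i _ => w i) (fun i => i.elim) hf

end Realize

/-- Truth restricted to codes below a fixed number is arithmetical, as a disjunction over the
finitely many formulas in question. -/
theorem arithPred_truthPred (c : ℕ) (l j : ℕ) : ArithPred (truthPred (· < c) l j) := by
  have h0 : ∀ l j : ℕ, ArithPred fun _ : Fin l → ℕ => False := fun _ _ _ _ => Arith.const False
  intro f hf
  rcases l with _ | _ | _ | _ | _ | l <;> rcases j with _ | _ | j <;> try exact Arith.const False
  · refine (Arith.exists_lt (R := fun n ρ => ∃ x < c, (f 0 ρ = n ∧ f 1 ρ = x) ∧ n + x < c ∧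
        sat trivLP n x (Nat.beta (f 2 ρ))) (fun n => Arith.exists_lt (fun x => ?_) c) c).of_iff
      fun ρ => ?_
    · refine (Arith.of_DRel (.and (.eq (hf 0) (.const _)) (.eq (hf 1) (.const _)))).and
        ((Arith.const _).and ?_)
      exact arithPred_realize_dec _ h0 n x _ _ fun i => (hf 2).beta (.const _)
    · constructor
      · rintro ⟨h1 : f 0 ρ + f 1 ρ < c, h2⟩
        exact ⟨_, by omega, _, by omega, ⟨rfl, rfl⟩, h1, h2⟩
      · rintro ⟨_, _, _, _, ⟨rfl, rfl⟩, h⟩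
        exact h
  · exact .of_DRel (.eq ((hf 0).beta (hf 1)) (hf 2))
  · refine (Arith.exists_lt (R := fun n ρ => ∃ x < c, (f 0 ρ = n ∧ f 1 ρ = x) ∧ n + x < c ∧
        f 3 ρ = tval trivLP n x (Nat.beta (f 2 ρ)))
        (fun n => Arith.exists_lt (fun x => ?_) c) c).of_iff fun ρ => ?_
    · refine (Arith.of_DRel (.and (.eq (hf 0) (.const _)) (.eq (hf 1) (.const _)))).and
        ((Arith.const _).and (.of_DRel (.eq (hf 3) ?_)))
      have := dFun_realize_natLP (fun _ _ _ => False) (decT n x)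
        (f := Sum.elim (fun i => i.elim) fun i ρ => Nat.beta (f 2 ρ) i)
        (by rintro (i | i); exacts [i.elim, (hf 2).beta (.const _)])
      convert this using 3 with ρ
      rw [tval]
      congr 1
      funext i
      rcases i with i | i
      · exact i.elim
      · rfl
    · constructor
      · rintro ⟨h1 : f 0 ρ + f 1 ρ < c, h2⟩
        exact ⟨_, by omega, _, by omega, ⟨rfl, rfl⟩, h1, h2⟩
      · rintro ⟨_, _, _, _, ⟨rfl, rfl⟩, h⟩
        exact h

/-- The interpretation of the predicate symbols in the image of a structure under the translation
coded by `t`. -/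
def imagePred (P : ∀ l, ℕ → (Fin l → ℕ) → Prop) (t l j : ℕ) (v : Fin l → ℕ) : Prop :=
  @Structure.RelMap LP ℕ (image (natLP P) t) l (Sum.inr j) v

theorem image_natLP (P : ∀ l, ℕ → (Fin l → ℕ) → Prop) (t : ℕ) :
    image (natLP P) t = natLP (imagePred P t) := by
  refine Structure.ext ?_ ?_
  · rfl
  · funext l R v
    rcases R with R | R <;> rfl

theorem arithPred_imagePred {P : ∀ l, ℕ → (Fin l → ℕ) → Prop} (hP : ∀ l j, ArithPred (P l j))
    (t l j : ℕ) : ArithPred (imagePred P t l j) :=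
  arithPred_realize_dec P hP l _ _

/-- The code of a numeral. -/
def numCode : ℕ → ℕ
  | 0 => zeroCode
  | n + 1 => addCode (numCode n) oneCode

theorem codeTerm_numeral {n : ℕ} (k : ℕ) :
    codeTerm (incl.onTerm (numeral k : LA.Term (Empty ⊕ Fin n))) = numCode k := by
  induction k with
  | zero => rw [numeral, onTerm_zero, codeTerm_lpZero, numCode]
  | succ k ih =>
    rw [numeral, onTerm_add, onTerm_one, codeTerm_lpAdd, codeTerm_lpOne, ih, numCode]

/-- The code of the sentence `∀ z (z = c → x(z))`, for the code `c` of a closed term and the code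
`x` of a formula. -/
def diagCode (c x : ℕ) : ℕ := allCode (impCode (eqCode (Nat.pair 0 0) c) x)

/-- Truth in `ℕ` is not arithmetical: otherwise there is a formula `χ(x)` which says that the
sentence `∀ z (z = x → x(z))` is not true, where `x` is read as the code of a formula, and this
sentence for `x = ⌜χ⌝` is true if and only if it is not. -/
theorem not_arith_truth (T : ℕ → Prop) (hT : ∀ f, DFun f → Arith fun ρ => T (f ρ)) :
    ¬ ∀ σ : LA.Sentence, T (godel (incl.onSentence σ)) ↔ ℕ ⊨ σ := by
  intro H
  obtain ⟨ψ, hψ⟩ : Arith fun ρ => ∀ c, (∃ s, Nat.beta s 0 = zeroCode ∧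
      (∀ i < ρ 0, Nat.beta s (i + 1) = addCode (Nat.beta s i) oneCode) ∧ Nat.beta s (ρ 0) = c) →
        ¬ T (diagCode c (ρ 0)) := by
    refine Arith.all (R := fun c ρ => (∃ s, Nat.beta s 0 = zeroCode ∧
      (∀ i < ρ 0, Nat.beta s (i + 1) = addCode (Nat.beta s i) oneCode) ∧ Nat.beta s (ρ 0) = c) →
        ¬ T (diagCode c (ρ 0))) (Arith.imp ?_ (Arith.not (hT _ ?_)))
    · refine Arith.ex (R := fun s ρ => Nat.beta s 0 = zeroCode ∧
        (∀ i < ρ 1, Nat.beta s (i + 1) = addCode (Nat.beta s i) oneCode) ∧ Nat.beta s (ρ 1) = ρ 0)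
        (.of_DRel (.and (.eq ((DFun.var 0).beta (.const 0)) (.const _)) (.and ?_
          (.eq ((DFun.var 0).beta (.var 2)) (.var 1)))))
      refine DRel.ball (R := fun i ρ => Nat.beta (ρ 0) (i + 1) = addCode (Nat.beta (ρ 0) i) oneCode)
        (.var 2) (.eq ((DFun.var 1).beta ((DFun.var 0).add (.const 1))) ?_)
      exact (DFun.const 1).pair ((DFun.const 2).pair
        ((((DFun.var 1).beta (.var 0)).pair (.const _)).add (.const 1)))
    · exact (DFun.const 4).pair ((DFun.const 3).pair
        (((DFun.const 1).pair ((DFun.const _).pair (.var 0))).pair (.var 1)))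
  -- the sequence `s` that is quantified over lists the codes of the numerals up to `x`
  have hψ' : ∀ (w : Empty → ℕ) (x : ℕ),
      (toBdd (ψ.relabel fun _ => (0 : Fin 1))).Realize w (fun _ => x) ↔
        ¬ T (diagCode (numCode x) x) := by
    intro w x
    rw [realize_toBdd, Formula.realize_relabel]
    refine (hψ _).trans ?_
    constructor
    · intro h
      refine h _ ?_
      obtain ⟨s, hs⟩ := exists_beta numCode (x + 1)
      refine ⟨s, hs 0 (by omega), fun i hi => ?_, hs x (by omega)⟩
      rw [hs _ (Nat.succ_lt_succ hi), hs i (Nat.lt_succ_of_lt hi), numCode]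
    · rintro h c ⟨s, h0, hs, rfl⟩
      have key : ∀ i ≤ x, Nat.beta s i = numCode i := by
        intro i hi
        induction i with
        | zero => exact h0
        | succ i ih => rw [hs i hi, ih (by omega), numCode]
      simp only [Function.comp_apply]
      rwa [key x le_rfl]
  let χ : LA.BoundedFormula Empty 1 := toBdd (ψ.relabel fun _ => (0 : Fin 1))
  have h1 := H (((bv 0 : LA.Term (Empty ⊕ Fin 1)) =' numeral (codeLA χ)) ⟹ χ).all
  have h2 : ℕ ⊨ (((bv 0 : LA.Term (Empty ⊕ Fin 1)) =' numeral (codeLA χ)) ⟹ χ).all ↔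
      ¬ T (diagCode (numCode (codeLA χ)) (codeLA χ)) := by
    rw [Sentence.Realize, Formula.Realize, BoundedFormula.realize_all]
    have key : ∀ (p : Fin 0 → ℕ) (y : ℕ), (Fin.snoc p y : Fin 1 → ℕ) = fun _ => y := fun p y => by
      funext i; obtain rfl : i = Fin.last 0 := Fin.ext (by omega); exact Fin.snoc_last _ _
    simp only [BoundedFormula.realize_imp, BoundedFormula.realize_bdEqual, key, realize_numeral,
      realize_bv, Sum.elim_inr, forall_eq, nat_num, χ, hψ']
  have h3 : godel (incl.onSentence
      (((bv 0 : LA.Term (Empty ⊕ Fin 1)) =' numeral (codeLA χ)) ⟹ χ).all) =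
        diagCode (numCode (codeLA χ)) (codeLA χ) := by
    rw [← codeTerm_numeral (n := 1)]
    change codeFormula (.all (.imp (.equal (incl.onTerm (bv 0)) (incl.onTerm (numeral (codeLA χ))))
      (incl.onBoundedFormula χ))) = _
    rw [codeFormula, codeFormula, codeFormula]
    change Nat.pair 4 (Nat.pair 3
      (Nat.pair (Nat.pair 1 (Nat.pair (codeTerm (Term.var _)) _)) _)) = _
    rw [codeTerm]
    rfl
  rw [h3] at h1
  exact absurd (h1.trans h2) (by tauto)

/-! ### Avoiding a `Σ₂` set of definitions of truth -/

/-- For every `Σ₂` set of definitions of truth there is a definition of truth in which no element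
of the set is definable. -/
theorem exists_forall_not_definable {B : Set LP.Sentence} (hB : B ⊆ DEF)
    (hS : IsSigma2Definable B) : ∃ γ ∈ DEF, ∀ β ∈ B, ¬ Definable β γ := by
  obtain ⟨φ, hφ, hφB⟩ := hS
  obtain ⟨R₀, hR₀, hφR⟩ := hφ.exists_rel
  let R : ℕ → ℕ → Prop := fun e b => R₀ e fun _ => b
  have hR : SRel fun ρ => ¬ R (ρ 0) (ρ 1) := hR₀.comp fun i => if i = 0 then 0 else 1
  have hRB : ∀ b, (∃ e, R e b) ↔ ∃ β ∈ B, godel β = b := fun b => by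
    rw [← hφB, Formula.Realize]
    exact (hφR fun _ => b).symm.trans (iff_of_eq (congrArg _ (Subsingleton.elim _ _)))
  let Good : ℕ → ℕ → Prop := fun y x => ∀ b, b < x + 1 → ∀ t, t < x + 1 → ∀ e, e < x + 1 →
    ∀ N, N < x + 1 → (¬ R e b ∨ ∃ c, Approx N c y b t)
  have hGood : SRel fun ρ => Good (ρ 0) (ρ 1 + ρ 2) := by
    refine SRel.ball (R := fun b ρ => ∀ t, t < ρ 1 + ρ 2 + 1 → ∀ e, e < ρ 1 + ρ 2 + 1 →
      ∀ N, N < ρ 1 + ρ 2 + 1 → (¬ R e b ∨ ∃ c, Approx N c (ρ 0) b t))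
      (((DFun.var 1).add (.var 2)).add (.const 1)) ?_
    refine SRel.ball (R := fun t ρ => ∀ e, e < ρ 2 + ρ 3 + 1 →
      ∀ N, N < ρ 2 + ρ 3 + 1 → (¬ R e (ρ 0) ∨ ∃ c, Approx N c (ρ 1) (ρ 0) t))
      (((DFun.var 2).add (.var 3)).add (.const 1)) ?_
    refine SRel.ball (R := fun e ρ => ∀ N, N < ρ 3 + ρ 4 + 1 →
      (¬ R e (ρ 1) ∨ ∃ c, Approx N c (ρ 2) (ρ 1) (ρ 0)))
      (((DFun.var 3).add (.var 4)).add (.const 1)) ?_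
    refine SRel.ball (R := fun N ρ => (¬ R (ρ 0) (ρ 2) ∨ ∃ c, Approx N c (ρ 3) (ρ 2) (ρ 1)))
      (((DFun.var 4).add (.var 5)).add (.const 1)) ?_
    refine (hR.comp fun i => ncons 1 (fun _ => 3) i).or
      (SRel.ex (R := fun c ρ => Approx (ρ 0) c (ρ 4) (ρ 3) (ρ 2)) ?_)
    exact SRel.of_DRel (dRel_approx.comp
      fun i => ncons 1 (ncons 0 (ncons 5 (ncons 4 fun _ => 3))) i)
  -- `g` is a formula for the guard; its true instances hold in all models of `PA⁻`
  obtain ⟨g, hg, hgM⟩ := hGood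
  have hg' : ∀ y n x : ℕ, g.Realize (env3 y n x) ↔ Good y (n + x) := fun y n x => hg _
  -- the guard is applied to the code of the guarded theory of truth itself
  obtain ⟨k, hk⟩ : ∃ k, codeFormula (gamF g) = k := ⟨_, rfl⟩
  by_cases hQ : ∀ x, Good k x
  · -- the guard is always true, and the guarded theory is as required
    refine ⟨gamS g k, ?_, ?_⟩
    · let _ := natTruth fun _ => True
      refine gamS_mem_DEF (N := ℕ) ?_ fun M _ hM n x => ?_
      · rw [num_natLP]
        exact gam_natTruth (fun _ _ _ => trivial) fun _ _ _ _ => trivial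
      · rw [← num_env3]
        exact hgM M hM _ (hQ (n + x))
    · rintro β hβ ⟨τ, hτ⟩
      obtain ⟨e, he⟩ := (hRB (godel β)).2 ⟨β, hβ, rfl⟩
      obtain ⟨t, ht⟩ := exists_beta
        (fun i => codeFormula (toBdd (τ i.unpair.1 i.unpair.2))) (symBound β)
      have hA : ∀ N, ∃ c, Approx N c k (godel β) t := fun N => by
        have := hQ (godel β + t + e + N) (godel β) (by omega) t (by omega) e (by omega) N (by omega)
        exact this.resolve_left (not_not_intro he)
      obtain ⟨v, hv⟩ := exists_isVal hA
      refine hv.not_realize_apply rfl τ (fun l j hlj => ?_) ?_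
      · rw [ht _ hlj, Nat.unpair_pair]
      · have : Nonempty hv.Dom := ⟨ze⟩
        have h1 : Gam g hv.Dom (num hv.Dom k) := (realize_gamF g _ _).1 (hv.realize_of_code hk)
        exact (proves_iff _ _).1 hτ hv.Dom ((models_gamS g k).2 h1)
  · -- the guard fails at some `x`, and `ℕ` with truth below `x` is a model of the guarded theory
    exfalso
    simp only [Good] at hQ
    push Not at hQ
    obtain ⟨x, b, hb, t, ht, e, he, N, hN, hRe, hA⟩ := hQ
    have hC : ∀ n z : ℕ, g.Realize (env3 k n z) → n + z < x := by
      intro n z h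
      by_contra! hle
      obtain ⟨c, hc⟩ := ((hg' k n z).1 h b (by omega) t (by omega) e (by omega) N
        (by omega)).resolve_left (not_not_intro hRe)
      exact hA c hc
    have hGam := gam_natTruth (C := (· < x)) hC fun m n h1 h2 => by omega
    have hsat : sat (natTruth (· < x)) 1 k fun _ => k := by
      rw [← hk, sat_code, realize_gamF, hk]
      exact hGam
    obtain ⟨β, hβ, rfl⟩ := (hRB b).1 ⟨e, hRe⟩
    obtain ⟨a, ha⟩ : ∃ a, sat (image (natTruth (· < x)) t) 0 (godel β) a := by
      by_contra! H
      have hsat' : sat (natTruth (· < x)) 1 k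
          fun _ => @num ℕ (@redStructure ℕ (natTruth (· < x))) k := by
        rwa [num_natLP]
      obtain ⟨c, hc⟩ := exists_approx (isVal_valOf (natTruth (· < x)) t hsat' H) N
      exact hA c hc
    rw [image_natLP, godel, sat_code] at ha
    have hP : ∀ l j, ArithPred (imagePred (truthPred (· < x)) t l j) :=
      arithPred_imagePred (arithPred_truthPred x) t
    generalize imagePred (truthPred (· < x)) t = P at ha hP
    -- `β` holds in `ℕ` with arithmetical predicates; its truth formula violates Tarski's theorem
    obtain ⟨-, -, Θ, hΘ⟩ := (mem_DEF_iff β).1 (hB hβ)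
    refine not_arith_truth
      (fun x => @Formula.Realize LP ℕ (natLP P) (Fin 1) Θ fun _ => x)
      (fun f hf => (arith_realize_natLP P hP Θ (fun _ => hf) (g := fun i => i.elim0)
        fun i => i.elim0).of_iff fun ρ => ?_) fun σ => ?_
    · let _ := natLP P
      rw [Formula.Realize]
      exact iff_of_eq (congrArg _ (Subsingleton.elim _ _))
    let _ := natLP P
    have hM : ℕ ⊨ β := by
      rw [Sentence.Realize, Formula.Realize]
      convert ha
    have := hΘ ℕ hM σ
    rw [num_natLP] at this
    exact this

/-! ### Disjunctions of definitions of truth -/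

theorem models_sup (α γ : LP.Sentence) {M : Type} [LP.Structure M] :
    M ⊨ (α ⊔ γ : LP.Sentence) ↔ M ⊨ α ∨ M ⊨ γ := BoundedFormula.realize_sup

theorem sup_mem_DEF {α γ : LP.Sentence} (hα : α ∈ DEF) (hγ : γ ∈ DEF) :
    (α ⊔ γ : LP.Sentence) ∈ DEF := by
  rw [mem_DEF_iff] at *
  obtain ⟨⟨N, _, h0, h1⟩, h2, Θ₁, h3⟩ := hα
  obtain ⟨-, h2', Θ₂, h3'⟩ := hγ
  simp only [models_sup]
  refine ⟨⟨N, _, h0, Or.inl h1⟩, fun M _ _ hM => hM.elim (h2 M) (h2' M), ?_⟩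
  -- the truth definition of the first theory is used in its models, that of the second elsewhere
  let α' : LP.Formula (Fin 1) := Formula.relabel (fun i : Empty => i.elim) α
  refine ⟨(α' ⊓ Θ₁) ⊔ (∼α' ⊓ Θ₂), fun M _ _ hM σ => ?_⟩
  have hα' : ∀ w : Fin 1 → M, α'.Realize w ↔ M ⊨ α := fun w => by
    rw [Formula.realize_relabel, Sentence.Realize]
    exact iff_of_eq (congrArg _ (Subsingleton.elim _ _))
  rw [Formula.realize_sup, Formula.realize_inf, Formula.realize_inf, Formula.realize_not, hα']
  by_cases h : M ⊨ α
  · simpa only [h, true_and, not_true_eq_false, false_and, or_false] using h3 M h σ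
  · simpa only [h, true_and, not_false_eq_true, false_and, false_or] using
      h3' M (hM.resolve_left h) σ

theorem definable_sup_left (α γ : LP.Sentence) : Definable (α ⊔ γ) α := by
  refine ⟨idTranslation, (proves_iff _ _).2 fun M _ _ hM => ?_⟩
  exact (realize_idTranslation_apply (α ⊔ γ : LP.Sentence) default default).2
    ((models_sup α γ).2 (Or.inl hM))

theorem Definable.of_sup_right {α β γ : LP.Sentence} (h : Definable β (α ⊔ γ)) : Definable β γ := by
  obtain ⟨τ, hτ⟩ := h
  rw [proves_iff] at hτ
  exact ⟨τ, (proves_iff _ _).2 fun M _ _ hM => hτ M ((models_sup _ _).2 (Or.inr hM))⟩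

theorem sup_mem_cDEF {α γ : LP.Sentence} (hα : α ∈ cDEF) (hγ : γ ∈ DEF) :
    (α ⊔ γ : LP.Sentence) ∈ cDEF := by
  refine ⟨sup_mem_DEF hα.1 hγ, fun σ hσ => hα.2 σ ?_⟩
  rw [proves_iff] at hσ ⊢
  exact fun M _ _ hM => hσ M ((models_sup _ _).2 (Or.inl hM))

theorem isSigma2Definable_singleton (α : LP.Sentence) : IsSigma2Definable {α} := by
  refine ⟨(Term.var (Sum.inl 0) : LA.Term (Fin 1 ⊕ Fin 0)) =' numeral (godel α),
    .pi1 (.delta0 (.equal _ _)), fun k => ?_⟩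
  rw [Formula.Realize, BoundedFormula.realize_bdEqual, realize_numeral, nat_num]
  simp [eq_comm]

/-- No definition of truth is definable in all the others. -/
theorem exists_not_definable {α : LP.Sentence} (hα : α ∈ DEF) : ∃ γ ∈ DEF, ¬ Definable α γ := by
  obtain ⟨γ, hγ, h⟩ := exists_forall_not_definable (Set.singleton_subset_iff.2 hα)
    (isSigma2Definable_singleton α)
  exact ⟨γ, hγ, h α rfl⟩

end TruthDefinitions

theorem mainTheorem4 :
    (∀ B : Set TruthDefinitions.LP.Sentence, B ⊆ TruthDefinitions.DEF →
      TruthDefinitions.IsSigma2Definable B →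
        ¬ TruthDefinitions.IsDenseIn B TruthDefinitions.DEF) ∧
    (∀ α : TruthDefinitions.LP.Sentence,
      ¬ TruthDefinitions.IsMinimalIn TruthDefinitions.DEF α) ∧
    (∀ α : TruthDefinitions.LP.Sentence,
      ¬ TruthDefinitions.IsMinimalIn TruthDefinitions.cDEF α) := by
  refine ⟨fun B hB hS hd => ?_, fun α hα => ?_, fun α hα => ?_⟩
  · obtain ⟨γ, hγ, h⟩ := TruthDefinitions.exists_forall_not_definable hB hS
    obtain ⟨β, hβ, hβγ⟩ := hd.2 γ hγ
    exact h β hβ hβγ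
  · obtain ⟨γ, hγ, h⟩ := TruthDefinitions.exists_not_definable hα.1
    exact h (hα.2 _ (TruthDefinitions.sup_mem_DEF hα.1 hγ)
      (TruthDefinitions.definable_sup_left α γ)).of_sup_right
  · obtain ⟨γ, hγ, h⟩ := TruthDefinitions.exists_not_definable hα.1.1
    exact h (hα.2 _ (TruthDefinitions.sup_mem_cDEF hα.1 hγ)
      (TruthDefinitions.definable_sup_left α γ)).of_sup_right
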